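/- Let $n\ge 3$, let $\Omega\subset\mathbb{R}^n$ be a bounded open set, let $A\in C(\overline\Omega,\mathbb{C}^n)$ and $q\in L^\infty(\Omega,\mathbb{C})$. Write $D=-i\nabla$, $z\cdot w=\sum_j z_jw_j$ for $z,w\in\mathbb{C}^n$, $A^2=A\cdot A$, and $$L_{A,q}u=-\Delta u+A\cdot Du+D\cdot(Au)+(A^2+q)u .$$ Equations in $\Omega$ are understood in the sense of distributions. For $h>0$ put $\|r\|_{H^1_{\mathrm{scl}}(\Omega)}^2=\|r\|_{L^2(\Omega)}^2+\|hDr\|_{L^2(\Omega)}^2$. Let $\zeta=\zeta(h)=\zeta_0+\zeta_1(h)\in\mathbb{C}^n$, where $\zeta_0$ is independent of $h$, $|\mathrm{Re}\,\zeta_0|=|\mathrm{Im}\,\zeta_0|=1$, $\zeta\cdot\zeta=0$ for all small $h>0$, and $\zeta_1=O(h)$ as $h\to0^+$. For $f\in C_0(\mathbb{R}^n)$ (continuous with compact support) put $$(N_{\zeta_0}^{-1}f)(x)=\frac1{2\pi}\int_{\mathbb{R}^2}\frac{f(x-y_1\mathrm{Re}\,\zeta_0-y_2\mathrm{Im}\,\zeta_0)}{y_1+iy_2}\,dy_1\,dy_2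 .$$ The field $A$ extends to a field in $C_0(\mathbb{R}^n,\mathbb{C}^n)$; fix any such extension, again denoted by $A$, and fix any $\sigma\in(0,1/2)$. Then there are functions $\Phi^\sharp(\cdot,\zeta_0;h)$, which depend on $\zeta$ only through $\zeta_0$, such that for all sufficiently small $h>0$ there is a solution $u=u(\cdot,\zeta;h)\in H^1(\Omega)$ of $L_{A,q}u=0$ in $\Omega$ of the form $$u(x,\zeta;h)=e^{x\cdot\zeta/h}\bigl(e^{\Phi^\sharp(x,\zeta_0;h)}+r(x,\zeta;h)\bigr),$$ with the following properties. 1. $\Phi^\sharp(\cdot,\zeta_0;h)\in C^\infty(\mathbb{R}^n)$, and for every multi-index $\alpha$ there is a constant $C_\alpha$, independent of $h$, such that $\|\partial^\alpha\Phi^\sharp(\cdot,\zeta_0;h)\|_{L^\infty(\mathbb{R}^n)}\le C_\alpha h^{-\sigma|\alpha|}$ for all small $h>0$ (the range of $h$ does not depend on $\alpha$). 2. The integral defining $\Phi(\cdot,\zeta_0):=N_{\zeta_0}^{-1}(-i\zeta_0\cdot A)$ converges absolutely at every point, $\Phi(\cdot,\zeta_0)\in C(\mathbb{R}^n)$, and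 $\Phi^\sharp(\cdot,\zeta_0;h)\to\Phi(\cdot,\zeta_0)$ uniformly in $\mathbb{R}^n$ as $h\to0^+$. 3. $r(\cdot,\zeta;h)\in H^1(\Omega)$ and $\|r(\cdot,\zeta;h)\|_{H^1_{\mathrm{scl}}(\Omega)}\to0$ as $h\to0^+$. -/

import Mathlib

open MeasureTheory Filter Topology Asymptotics
open scoped ContDiff ENNReal

noncomputable section

namespace CGO

/-- Real Euclidean space `ℝⁿ`. -/
abbrev RSpace (n : ℕ) := EuclideanSpace ℝ (Fin n)

/-- Complex Euclidean space `ℂⁿ`. -/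
abbrev CSpace (n : ℕ) := EuclideanSpace ℂ (Fin n)

variable {n : ℕ}

/-- The complex bilinear (not sesquilinear) product `z · w = ∑ z_j w_j` on `ℂⁿ`. -/
def cdot (z w : CSpace n) : ℂ := ∑ j, z j * w j

/-- The inclusion `ℝⁿ ⊂ ℂⁿ`. -/
def toC (x : RSpace n) : CSpace n := WithLp.toLp 2 fun j => (x j : ℂ)

/-- The real part of a complex vector. -/
def reVec (z : CSpace n) : RSpace n := WithLp.toLp 2 fun j => (z j).re

/-- The imaginary part of a complex vector. -/
def imVec (z : CSpace n) : RSpace n := WithLp.toLp 2 fun j => (z j).im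

/-- The partial derivative `∂_j f`. -/
def partialDeriv (j : Fin n) (f : RSpace n → ℂ) : RSpace n → ℂ :=
  fun x => fderiv ℝ f x (EuclideanSpace.single j (1 : ℝ))

/-- The gradient `∇ f` of a complex valued function. -/
def gradC (f : RSpace n → ℂ) : RSpace n → CSpace n :=
  fun x => WithLp.toLp 2 fun j => partialDeriv j f x

/-- The partial derivative `∂^α f = ∂_1^{α_1} ⋯ ∂_n^{α_n} f` for a multi-index `α`. -/
def multiDeriv (α : Fin n → ℕ) (f : RSpace n → ℂ) : RSpace n → ℂ :=
  (List.finRange n).foldr (fun j g => (partialDeriv j)^[α j] g) f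

/-- `ψ ∈ C₀^∞(Ω)`: smooth, with compact support contained in `Ω`. -/
structure IsTestFunction (Ω : Set (RSpace n)) (ψ : RSpace n → ℂ) : Prop where
  smooth : ContDiff ℝ ∞ ψ
  hasCompactSupport : HasCompactSupport ψ
  tsupport_subset : tsupport ψ ⊆ Ω

/-- `u ∈ H¹(Ω)` with weak gradient `G`: both are square integrable on `Ω` and
`∫_Ω u ∂_j ψ = - ∫_Ω G_j ψ` for all test functions `ψ` and all `j`. -/
structure IsH1With (Ω : Set (RSpace n)) (u : RSpace n → ℂ) (G : RSpace n → CSpace n) :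
    Prop where
  memLp : MemLp u 2 (volume.restrict Ω)
  memLp_grad : MemLp G 2 (volume.restrict Ω)
  weak_grad : ∀ ψ : RSpace n → ℂ, IsTestFunction Ω ψ → ∀ j : Fin n,
    ∫ x in Ω, u x * partialDeriv j ψ x = -∫ x in Ω, G x j * ψ x

/-- The semiclassical norm of `u ∈ H¹(Ω)` with weak gradient `G`:
`‖u‖² = ‖u‖²_{L²(Ω)} + ‖h D u‖²_{L²(Ω)}`, where `D = -i ∇`. -/
def sclH1Norm (Ω : Set (RSpace n)) (h : ℝ) (u : RSpace n → ℂ) (G : RSpace n → CSpace n) : ℝ :=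
  Real.sqrt ((∫ x in Ω, ‖u x‖ ^ 2) + ∫ x in Ω, ‖((h : ℂ) * -Complex.I) • G x‖ ^ 2)

/-- `u ∈ H¹(Ω)` solves, in the sense of distributions in `Ω`, the equation
`L_{A,q} u = -Δ u + A · D u + D · (A u) + (A² + q) u = 0`, where `D = -i ∇`. Tested against
`ψ ∈ C₀^∞(Ω)`, the terms are `∫ ∇u · ∇ψ`, `∫ (A · (-i ∇u)) ψ`, `- ∫ A u · (-i ∇ψ)` and
`∫ (A² + q) u ψ`. -/
def IsSolution (Ω : Set (RSpace n)) (A : RSpace n → CSpace n) (q : RSpace n → ℂ)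
    (u : RSpace n → ℂ) : Prop :=
  ∃ G : RSpace n → CSpace n, IsH1With Ω u G ∧
    ∀ ψ : RSpace n → ℂ, IsTestFunction Ω ψ →
      ∫ x in Ω, (cdot (G x) (gradC ψ x)
        + cdot (A x) ((-Complex.I) • G x) * ψ x
        - cdot (u x • A x) ((-Complex.I) • gradC ψ x)
        + (cdot (A x) (A x) + q x) * u x * ψ x) = 0

/-- The integrand in the definition of `N_{ζ₀}⁻¹ f (x)`. -/
def invNKernel (ζ₀ : CSpace n) (f : RSpace n → ℂ) (x : RSpace n) (y : ℝ × ℝ) : ℂ :=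
  f (x - y.1 • reVec ζ₀ - y.2 • imVec ζ₀) / ((y.1 : ℂ) + Complex.I * (y.2 : ℂ))

/-- The operator `N_{ζ₀}⁻¹`, the inverse of `N_{ζ₀} = ζ₀ · ∇`:
`(N_{ζ₀}⁻¹ f)(x) = (2π)⁻¹ ∫_{ℝ²} f(x - y₁ Re ζ₀ - y₂ Im ζ₀) / (y₁ + i y₂) dy₁ dy₂`. -/
def invN (ζ₀ : CSpace n) (f : RSpace n → ℂ) (x : RSpace n) : ℂ :=
  1 / (2 * (Real.pi : ℂ)) * ∫ y : ℝ × ℝ, invNKernel ζ₀ f x y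

/-- `B` is a continuous compactly supported vector field on `ℝⁿ` that extends `A` from the
closure of `Ω`. -/
structure IsC0Extension (Ω : Set (RSpace n)) (A B : RSpace n → CSpace n) : Prop where
  continuous : Continuous B
  hasCompactSupport : HasCompactSupport B
  eqOn : Set.EqOn B A (closure Ω)

end CGO

end

noncomputable section

namespace CGO

open scoped InnerProductSpace ComplexConjugate LineDeriv

variable {n : ℕ}

open scoped InnerProductSpace ComplexConjugate

/-! Insert `u = e^{x·ζ/h} a` into the equation and multiply by `h²`. The terms of order one vanish
because `ζ·ζ = 0`. With `a = e^Φ`, those of order `h` vanish when `ζ₀·∇Φ = -i ζ₀·A`. Passing to the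
limit in `ζ·ζ = 0` shows that `Re ζ₀` and `Im ζ₀` are orthonormal, so `ζ₀·∇` is `∂₁ + i∂₂` in the
plane they span, and it is inverted by the Cauchy transform `invN`.

Since `A` is only continuous, `Φ` need not be differentiable. Both `Φ` and `A` are therefore
mollified with the same kernel at scale `h^σ`. Mollification commutes with constant coefficient
operators, so `ζ₀·∇Φ♯ = -i ζ₀·A♯` holds exactly (`dirDeriv_mollify_invN`). The defect of `e^{Φ♯}`
then contains `(h∂Φ♯)²` and `h²∂²Φ♯`, of size `h^{2-2σ}`, terms of size `h·|A - A♯| = o(h)`, and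
smaller ones. As `σ < 1/2`, it is `o(h)` when paired with test functions; derivatives of `A` never
occur, because only the divergence of a field built from `A♯` is integrated by parts
(`formDensity_sub_divergence`, `norm_integral_formDensity_amplitude_le`).

The remainder must cancel this defect, so the conjugated equation has to be solved with loss `1/h`
from `H⁻¹` to `H¹`. The exponent is convexified by `κ(α·x)²/2` with `α = Re ζ`. A positive
commutator (`norm_sq_sub_of_commutator`) yields the Carleman estimate `h√κ ‖g‖_{H¹} ≤ 21 ‖P g‖_{L²}`
(`carleman_estimate`). To weaken the right side to the `H⁻¹` norm, the transposed equation is solved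
in `L²` by duality; its solution, cut off, lies in `H¹` by elliptic regularity for `1 - h²Δ`;
testing `P g` against it gives the claim (`norm_jet_le_principal`). The first order terms have size
`h` and are absorbed by a large `κ` independent of `h`; Hahn–Banach then gives solvability
(`exists_h1Space_pairJ_eq`). On a bounded set the weight is bounded above and below uniformly in
`h`, so the remainder is `O(1/h)·o(h) = o(1)`. -/

/-! ### Functional analysis: solvability from a priori estimates. -/

/-- A linear functional `ℓ` on `V` that is controlled by a linear map `T` into a normed space
factors through a continuous linear functional on that space. -/
theorem exists_dual_comp_eq_of_norm_le {D V : Type*} [NormedAddCommGroup D] [NormedSpace ℂ D]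
    [AddCommGroup V] [Module ℂ V] (T : V →ₗ[ℂ] D)
    (ℓ : V →ₗ[ℂ] ℂ) {C : ℝ} (hC : 0 ≤ C) (h : ∀ g, ‖ℓ g‖ ≤ C * ‖T g‖) :
    ∃ F : StrongDual ℂ D, (∀ g, F (T g) = ℓ g) ∧ ‖F‖ ≤ C := by
  have hker : LinearMap.ker T ≤ LinearMap.ker ℓ := by
    intro g hg
    have := h g
    rw [LinearMap.mem_ker] at hg ⊢
    rw [hg, norm_zero, mul_zero] at this
    exact norm_le_zero_iff.mp this
  -- The estimate makes `ℓ` vanish on the kernel of `T`, so `ℓ` descends to the range of `T` with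
  -- bound `C`; Hahn–Banach extends it from there.
  let f₀ : LinearMap.range T →ₗ[ℂ] ℂ :=
    ((LinearMap.ker T).liftQ ℓ hker) ∘ₗ (T.quotKerEquivRange.symm : _ →ₗ[ℂ] _)
  have hf₀ : ∀ g, f₀ ⟨T g, LinearMap.mem_range_self T g⟩ = ℓ g := by
    intro g
    have : T.quotKerEquivRange.symm ⟨T g, LinearMap.mem_range_self T g⟩
        = (LinearMap.ker T).mkQ g := by
      rw [LinearEquiv.symm_apply_eq]
      rfl
    simp only [f₀, LinearMap.comp_apply, LinearEquiv.coe_coe, this]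
    simp
  have hb : ∀ y, ‖f₀ y‖ ≤ C * ‖y‖ := by
    rintro ⟨_, g, rfl⟩
    rw [hf₀]
    exact h g
  obtain ⟨F, hF, hFn⟩ := exists_extension_norm_eq _ (f₀.mkContinuous C hb)
  refine ⟨F, fun g => ?_, hFn.trans_le (LinearMap.mkContinuous_norm_le _ hC _)⟩
  rw [← hf₀ g]
  exact hF ⟨T g, LinearMap.mem_range_self T g⟩

/-- A linear functional `ℓ` on `V` that is controlled by a linear map `T` into the dual of a
Hilbert space is represented by an element of that space. -/
theorem exists_apply_eq_of_norm_le {K V : Type*} [NormedAddCommGroup K] [InnerProductSpace ℂ K]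
    [CompleteSpace K] [AddCommGroup V] [Module ℂ V] (T : V →ₗ[ℂ] StrongDual ℂ K)
    (ℓ : V →ₗ[ℂ] ℂ) {C : ℝ} (hC : 0 ≤ C) (h : ∀ g, ‖ℓ g‖ ≤ C * ‖T g‖) :
    ∃ r : K, (∀ g, T g r = ℓ g) ∧ ‖r‖ ≤ C := by
  obtain ⟨F, hF, hFC⟩ := exists_dual_comp_eq_of_norm_le T ℓ hC h
  -- Reflexivity of `K`: `F` is a functional on the dual. The Riesz map is antilinear, and the
  -- conjugate restores linearity.
  let φ₀ : K →ₗ[ℂ] ℂ :=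
    { toFun := fun y => conj (F (InnerProductSpace.toDual ℂ K y))
      map_add' := by intro x y; simp
      map_smul' := by
        intro c y
        rw [LinearIsometryEquiv.map_smulₛₗ, map_smul, smul_eq_mul, map_mul, Complex.conj_conj,
          RingHom.id_apply, smul_eq_mul] }
  let φ : StrongDual ℂ K := φ₀.mkContinuous C (fun y => by
    have h1 : ‖F (InnerProductSpace.toDual ℂ K y)‖ ≤ ‖F‖ * ‖InnerProductSpace.toDual ℂ K y‖ :=
      F.le_opNorm _
    have h2 : ‖InnerProductSpace.toDual ℂ K y‖ = ‖y‖ := by simp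
    rw [h2] at h1
    change ‖conj (F (InnerProductSpace.toDual ℂ K y))‖ ≤ _
    rw [RCLike.norm_conj]
    exact h1.trans (by gcongr))
  refine ⟨(InnerProductSpace.toDual ℂ K).symm φ, fun g => ?_, ?_⟩
  · obtain ⟨y, hy⟩ := (InnerProductSpace.toDual ℂ K).surjective (T g)
    rw [← hy, InnerProductSpace.toDual_apply_apply, ← inner_conj_symm,
      InnerProductSpace.toDual_symm_apply, ← hF, ← hy]
    change conj (conj (F (InnerProductSpace.toDual ℂ K y))) = _
    rw [Complex.conj_conj]
  · rw [LinearIsometryEquiv.norm_map]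
    exact LinearMap.mkContinuous_norm_le _ hC _

/-! ### The positive commutator identity. -/

section Commutator

variable {V X : Type*} [AddCommGroup V] [Module ℂ V] [NormedAddCommGroup X]
  [InnerProductSpace ℂ X] {n : ℕ}

/-- The Carleman identity for `P = S - T` with `S = ∑ U_j² + |α|² M²` symmetric and
`T = W M + M W`, `W = ∑ α_j U_j`, antisymmetric, where `[U_j, M] = c α_j`. -/
theorem norm_sq_sub_of_commutator (ι : V →ₗ[ℂ] X) (U : Fin n → V →ₗ[ℂ] V) (M : V →ₗ[ℂ] V)
    (c : ℝ) (α : Fin n → ℝ)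
    (hU : ∀ j f g, ⟪ι (U j f), ι g⟫_ℂ = -⟪ι f, ι (U j g)⟫_ℂ)
    (hM : ∀ f g, ⟪ι (M f), ι g⟫_ℂ = ⟪ι f, ι (M g)⟫_ℂ)
    (hUU : ∀ i j f, U i (U j f) = U j (U i f))
    (hUM : ∀ j f, U j (M f) = M (U j f) + ((c * α j : ℝ) : ℂ) • f) (f : V) :
    ‖ι ((∑ j, U j (U j f) + ((∑ j, α j ^ 2 : ℝ) : ℂ) • M (M f))
        - (∑ j, (α j : ℂ) • U j (M f) + M (∑ j, (α j : ℂ) • U j f)))‖ ^ 2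
      = ‖ι (∑ j, U j (U j f) + ((∑ j, α j ^ 2 : ℝ) : ℂ) • M (M f))‖ ^ 2
        + ‖ι (∑ j, (α j : ℂ) • U j (M f) + M (∑ j, (α j : ℂ) • U j f))‖ ^ 2
        + 4 * c * (‖ι (∑ j, (α j : ℂ) • U j f)‖ ^ 2
            + (∑ j, α j ^ 2) ^ 2 * ‖ι (M f)‖ ^ 2) := by
  set A : ℝ := ∑ j, α j ^ 2 with hA
  let W : V →ₗ[ℂ] V := ∑ j, (α j : ℂ) • U j
  let D : V →ₗ[ℂ] V := ∑ j, U j ∘ₗ U j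
  have hWf : ∀ f, ∑ j, (α j : ℂ) • U j f = W f := fun f => by simp [W]
  have hDf : ∀ f, ∑ j, U j (U j f) = D f := fun f => by simp [D]
  simp only [hWf, hDf]
  have hW : ∀ f g, ⟪ι (W f), ι g⟫_ℂ = -⟪ι f, ι (W g)⟫_ℂ := by
    intro f g
    rw [← hWf, ← hWf]
    simp only [map_sum, map_smul, sum_inner, inner_sum, inner_smul_left, inner_smul_right, hU,
      Complex.conj_ofReal, mul_neg, Finset.sum_neg_distrib]
  have hD : ∀ f g, ⟪ι (D f), ι g⟫_ℂ = ⟪ι f, ι (D g)⟫_ℂ := by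
    intro f g
    rw [← hDf, ← hDf]
    simp only [map_sum, sum_inner, inner_sum, hU, neg_neg]
  have hWM : ∀ f, W (M f) = M (W f) + ((c * A : ℝ) : ℂ) • f := by
    intro f
    rw [← hWf, ← hWf]
    simp only [hUM, smul_add, Finset.sum_add_distrib, map_sum, map_smul, smul_smul,
      ← Finset.sum_smul]
    congr 2
    rw [hA]
    push_cast
    rw [Finset.mul_sum]
    exact Finset.sum_congr rfl fun j _ => by ring
  have hUW : ∀ j f, U j (W f) = W (U j f) := by
    intro j f
    rw [← hWf, ← hWf]
    simp only [map_sum, map_smul, hUU j]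
  have hDW : ∀ f, D (W f) = W (D f) := by
    intro f
    rw [← hDf, ← hDf]
    simp only [hUW, map_sum]
  have hDM : ∀ f, D (M f) = M (D f) + ((2 * c : ℝ) : ℂ) • W f := by
    intro f
    rw [← hDf, ← hDf, ← hWf, Finset.smul_sum, map_sum, ← Finset.sum_add_distrib]
    refine Finset.sum_congr rfl fun j _ => ?_
    rw [hUM, map_add, hUM, map_smul, smul_smul, add_assoc, ← add_smul]
    congr 2
    push_cast
    ring
  set S : V → V := fun f => D f + (A : ℂ) • M (M f) with hS
  set T : V → V := fun f => W (M f) + M (W f) with hT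
  have hSs : ∀ f g, ⟪ι (S f), ι g⟫_ℂ = ⟪ι f, ι (S g)⟫_ℂ := by
    intro f g
    simp only [hS, map_add, map_smul, inner_add_left, inner_add_right, inner_smul_left,
      inner_smul_right, hD, hM, Complex.conj_ofReal]
  have hTs : ∀ f g, ⟪ι (T f), ι g⟫_ℂ = -⟪ι f, ι (T g)⟫_ℂ := by
    intro f g
    simp only [hT, map_add, inner_add_left, inner_add_right, hW, hM]
    ring
  -- As `W` is antisymmetric and `M` symmetric, `W² ≤ 0 ≤ M²`: for `c ≥ 0` the commutator is
  -- nonpositive, and the cross term of `‖S f - T f‖²` has the good sign.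
  have hcomm : S (T f) - T (S f)
      = ((4 * c : ℝ) : ℂ) • W (W f) - ((4 * c * A ^ 2 : ℝ) : ℂ) • M (M f) := by
    simp only [hS, hT, map_add, map_smul, hDM, hDW, hWM, smul_add, smul_smul]
    push_cast
    module
  have key : ⟪ι (S f), ι (T f)⟫_ℂ + ⟪ι (T f), ι (S f)⟫_ℂ
      = -((4 * c : ℝ) : ℂ) * (⟪ι (W f), ι (W f)⟫_ℂ + ((A ^ 2 : ℝ) : ℂ) * ⟪ι (M f), ι (M f)⟫_ℂ) := by
    have h1 : ⟪ι (S f), ι (T f)⟫_ℂ = ⟪ι f, ι (S (T f))⟫_ℂ := hSs _ _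
    have h2 : ⟪ι (T f), ι (S f)⟫_ℂ = -⟪ι f, ι (T (S f))⟫_ℂ := hTs _ _
    rw [h1, h2, ← sub_eq_add_neg, ← inner_sub_right, ← map_sub, hcomm, map_sub, inner_sub_right,
      map_smul, map_smul, inner_smul_right, inner_smul_right, hW f (W f), hM f (M f)]
    push_cast
    ring
  have key' : 2 * (⟪ι (S f), ι (T f)⟫_ℂ).re
      = -(4 * c) * (‖ι (W f)‖ ^ 2 + A ^ 2 * ‖ι (M f)‖ ^ 2) := by
    have h3 := congrArg Complex.re key
    rw [Complex.add_re, ← inner_conj_symm (ι (T f)) (ι (S f)), Complex.conj_re,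
      inner_self_eq_norm_sq_to_K, inner_self_eq_norm_sq_to_K] at h3
    have h4 : -((4 * c : ℝ) : ℂ) * (((‖ι (W f)‖ : ℝ) : ℂ) ^ 2
        + ((A ^ 2 : ℝ) : ℂ) * ((‖ι (M f)‖ : ℝ) : ℂ) ^ 2)
        = ((-(4 * c) * (‖ι (W f)‖ ^ 2 + A ^ 2 * ‖ι (M f)‖ ^ 2) : ℝ) : ℂ) := by
      push_cast; ring
    have h5 := congrArg Complex.re h4
    rw [Complex.ofReal_re] at h5
    rw [two_mul, h3]
    exact h5
  have h6 := @norm_sub_sq ℂ X _ _ _ (ι (S f)) (ι (T f))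
  have h7 : RCLike.re (⟪ι (S f), ι (T f)⟫_ℂ) = (⟪ι (S f), ι (T f)⟫_ℂ).re := rfl
  rw [h7] at h6
  rw [map_sub]
  linarith

/-- The quadratic form of `∑ U_j² + |α|² M²`. -/
theorem sum_norm_sq_eq_of_antisymm (ι : V →ₗ[ℂ] X) (U : Fin n → V →ₗ[ℂ] V) (M : V →ₗ[ℂ] V)
    (A : ℝ) (hU : ∀ j f g, ⟪ι (U j f), ι g⟫_ℂ = -⟪ι f, ι (U j g)⟫_ℂ)
    (hM : ∀ f g, ⟪ι (M f), ι g⟫_ℂ = ⟪ι f, ι (M g)⟫_ℂ) (f : V) :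
    ∑ j, ‖ι (U j f)‖ ^ 2
      = A * ‖ι (M f)‖ ^ 2 - (⟪ι f, ι (∑ j, U j (U j f) + (A : ℂ) • M (M f))⟫_ℂ).re := by
  have h1 : ∀ x : X, ‖x‖ ^ 2 = (⟪x, x⟫_ℂ).re := fun x =>
    (inner_self_eq_norm_sq (𝕜 := ℂ) x).symm
  simp only [h1, hU, hM, map_add, map_sum, map_smul, inner_add_right, inner_sum, inner_smul_right,
    Complex.add_re, Complex.re_sum, Complex.neg_re, Complex.re_ofReal_mul, Finset.sum_neg_distrib]
  ring

end Commutator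

/-! ### `L²`, Schwartz functions, and semiclassical `H¹` as a closed space of jets. -/

/-- Square integrable functions on `ℝⁿ`. -/
abbrev L2 (n : ℕ) := Lp ℂ 2 (volume : Measure (RSpace n))

/-- Schwartz functions on `ℝⁿ`. -/
abbrev Sch (n : ℕ) := SchwartzMap (RSpace n) ℂ

/-- Tuples of `n + 1` square integrable functions: a function, and its gradient. -/
abbrev Jet (n : ℕ) := PiLp 2 (fun _ : Option (Fin n) => L2 n)

/-- Schwartz functions as elements of `L²`. -/
def toL2 : Sch n →ₗ[ℂ] L2 n := (SchwartzMap.toLpCLM ℂ ℂ 2 volume).toLinearMap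

theorem coeFn_toL2 (g : Sch n) : toL2 g =ᵐ[volume] g := SchwartzMap.coeFn_toLp g 2 volume

/-- The bilinear pairing `∫ f g` on `L²`. -/
def pair : L2 n →L[ℂ] L2 n →L[ℂ] ℂ := (ContinuousLinearMap.mul ℂ ℂ).lpPairing volume 2 2

theorem pair_apply (f g : L2 n) : pair f g = ∫ x, f x * g x := by
  simp [pair, ContinuousLinearMap.lpPairing_eq_integral]

theorem pair_comm (f g : L2 n) : pair f g = pair g f := by
  simp only [pair_apply, mul_comm]

theorem norm_star_L2 (f : L2 n) : ‖star f‖ = ‖f‖ := by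
  rw [Lp.norm_def, Lp.norm_def]
  congr 1
  refine eLpNorm_congr_norm_ae ?_
  filter_upwards [Lp.coeFn_star f] with x hx
  rw [hx]
  simp

theorem pair_eq_inner (f g : L2 n) : pair f g = ⟪star f, g⟫_ℂ := by
  rw [pair_apply, L2.inner_def]
  refine integral_congr_ae ?_
  filter_upwards [Lp.coeFn_star f] with x hx
  simp [hx, mul_comm]

theorem norm_pair_le (f g : L2 n) : ‖pair f g‖ ≤ ‖f‖ * ‖g‖ := by
  rw [pair_eq_inner, ← norm_star_L2 f]
  exact norm_inner_le_norm _ _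

/-- The bound is attained at the conjugate of `f`. Thus an `L²` norm may be read as a dual norm, the
form in which `exists_apply_eq_of_norm_le` accepts an estimate. -/
theorem norm_pair (f : L2 n) : ‖pair f‖ = ‖f‖ := by
  refine le_antisymm ((pair f).opNorm_le_bound (norm_nonneg _) (norm_pair_le f)) ?_
  have h1 := (pair f).le_opNorm (star f)
  rw [pair_eq_inner, norm_star_L2, inner_self_eq_norm_sq_to_K, norm_star_L2] at h1
  rcases eq_or_lt_of_le (norm_nonneg f) with h0 | h0
  · rw [← h0]; exact norm_nonneg _
  · have h2 : ‖((‖f‖ : ℂ)) ^ 2‖ = ‖f‖ * ‖f‖ := by simp [sq]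
    have h1' : ‖f‖ * ‖f‖ ≤ ‖pair f‖ * ‖f‖ := h2 ▸ h1
    exact le_of_mul_le_mul_right h1' h0

/-- A family of linear maps into `L²` as a map into `Jet n`. -/
def jetOf {V : Type*} [AddCommGroup V] [Module ℂ V] (C : Option (Fin n) → V →ₗ[ℂ] L2 n) :
    V →ₗ[ℂ] Jet n :=
  (WithLp.linearEquiv 2 ℂ (Option (Fin n) → L2 n)).symm.toLinearMap ∘ₗ LinearMap.pi C

@[simp] theorem jetOf_apply {V : Type*} [AddCommGroup V] [Module ℂ V]
    (C : Option (Fin n) → V →ₗ[ℂ] L2 n) (g : V) (i : Option (Fin n)) :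
    jetOf C g i = C i g := rfl

/-- The bilinear pairing on `Jet n`. -/
def pairJ : Jet n →L[ℂ] Jet n →L[ℂ] ℂ :=
  ∑ i, (pair (n := n)).bilinearComp (PiLp.proj 2 (fun _ : Option (Fin n) => L2 n) i)
    (PiLp.proj 2 (fun _ : Option (Fin n) => L2 n) i)

theorem pairJ_apply (F R : Jet n) : pairJ F R = ∑ i, pair (F i) (R i) := by
  simp [pairJ]

theorem pairJ_apply' (F R : Jet n) :
    pairJ F R = pair (F none) (R none) + ∑ j, pair (F (some j)) (R (some j)) := by
  rw [pairJ_apply, Fintype.sum_option]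

theorem norm_sq_jet (F : Jet n) : ‖F‖ ^ 2 = ‖F none‖ ^ 2 + ∑ j, ‖F (some j)‖ ^ 2 := by
  rw [PiLp.norm_sq_eq_of_L2, Fintype.sum_option]

theorem norm_jet_none_le (F : Jet n) : ‖F none‖ ≤ ‖F‖ := PiLp.norm_apply_le F none

theorem norm_jet_some_le (F : Jet n) (j : Fin n) : ‖F (some j)‖ ≤ ‖F‖ := PiLp.norm_apply_le F _

theorem norm_jet_le_sum (F : Jet n) : ‖F‖ ≤ ‖F none‖ + ∑ j, ‖F (some j)‖ := by
  refine abs_le_of_sq_le_sq' ?_ (by positivity) |>.2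
  rw [norm_sq_jet]
  have h : ∑ j, ‖F (some j)‖ ^ 2 ≤ (∑ j, ‖F (some j)‖) ^ 2 :=
    Finset.sum_sq_le_sq_sum_of_nonneg fun _ _ => norm_nonneg _
  have h2 : 0 ≤ ∑ j, ‖F (some j)‖ := by positivity
  nlinarith [norm_nonneg (F none)]

/-- The complex conjugate of a tuple. -/
def starJ (F : Jet n) : Jet n := WithLp.toLp 2 fun i => star (F i)

theorem norm_starJ (F : Jet n) : ‖starJ F‖ = ‖F‖ := by
  have : ‖starJ F‖ ^ 2 = ‖F‖ ^ 2 := by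
    rw [norm_sq_jet, norm_sq_jet]
    simp [starJ, norm_star_L2]
  exact (sq_eq_sq₀ (norm_nonneg _) (norm_nonneg _)).mp this

theorem pairJ_eq_inner (F R : Jet n) : pairJ F R = ⟪starJ F, R⟫_ℂ := by
  rw [pairJ_apply, PiLp.inner_apply]
  simp [starJ, pair_eq_inner]

theorem norm_pairJ_le (F R : Jet n) : ‖pairJ F R‖ ≤ ‖F‖ * ‖R‖ := by
  rw [pairJ_eq_inner, ← norm_starJ F]
  exact norm_inner_le_norm _ _

theorem pairJ_starJ (F : Jet n) : pairJ F (starJ F) = ((‖F‖ ^ 2 : ℝ) : ℂ) := by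
  rw [pairJ_eq_inner, inner_self_eq_norm_sq_to_K, norm_starJ]
  push_cast
  rfl

/-- The semiclassical derivative `h ∂_j` on Schwartz functions. -/
def dh (h : ℝ) (j : Fin n) : Sch n →ₗ[ℂ] Sch n :=
  (h : ℂ) • (LineDeriv.lineDerivOpCLM ℂ (Sch n) (EuclideanSpace.single j (1 : ℝ))).toLinearMap

theorem dh_apply (h : ℝ) (j : Fin n) (g : Sch n) (x : RSpace n) :
    dh h j g x = h * partialDeriv j g x := by
  simp [dh, partialDeriv, SchwartzMap.lineDerivOp_apply_eq_fderiv]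

/-- Multiplication by a function of temperate growth on Schwartz functions. -/
def mulS (a : RSpace n → ℂ) : Sch n →ₗ[ℂ] Sch n := (SchwartzMap.smulLeftCLM ℂ a).toLinearMap

theorem mulS_apply {a : RSpace n → ℂ} (ha : a.HasTemperateGrowth) (g : Sch n) (x : RSpace n) :
    mulS a g x = a x * g x := by
  simp [mulS, SchwartzMap.smulLeftCLM_apply_apply ha]

/-- Complex conjugation of Schwartz functions. -/
def conjS (g : Sch n) : Sch n :=
  SchwartzMap.postcompCLM (𝕜 := ℝ) (Complex.conjCLE : ℂ →L[ℝ] ℂ) g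

theorem conjS_apply (g : Sch n) (x : RSpace n) : conjS g x = conj (g x) := by
  simp [conjS]

theorem toL2_conjS (g : Sch n) : toL2 (conjS g) = star (toL2 g) := by
  refine Lp.ext ?_
  filter_upwards [coeFn_toL2 (conjS g), coeFn_toL2 g, Lp.coeFn_star (toL2 g)] with x h1 h2 h3
  rw [h1, h3, conjS_apply, Pi.star_apply, h2]
  rfl

theorem partialDeriv_conj (j : Fin n) {f : RSpace n → ℂ} {x : RSpace n}
    (hf : DifferentiableAt ℝ f x) :
    partialDeriv j (fun y => conj (f y)) x = conj (partialDeriv j f x) := by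
  have h : HasFDerivAt (fun y => conj (f y))
      ((Complex.conjCLE : ℂ →L[ℝ] ℂ).comp (fderiv ℝ f x)) x :=
    (Complex.conjCLE : ℂ →L[ℝ] ℂ).hasFDerivAt.comp x hf.hasFDerivAt
  simp [partialDeriv, h.fderiv]

theorem partialDeriv_mul (j : Fin n) {f g : RSpace n → ℂ} {x : RSpace n}
    (hf : DifferentiableAt ℝ f x) (hg : DifferentiableAt ℝ g x) :
    partialDeriv j (fun y => f y * g y) x = f x * partialDeriv j g x + partialDeriv j f x * g x := by
  simp only [partialDeriv]
  rw [show (fun y => f y * g y) = f * g from rfl, fderiv_mul hf hg]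
  simp
  ring

theorem dh_conjS (h : ℝ) (j : Fin n) (g : Sch n) : dh h j (conjS g) = conjS (dh h j g) := by
  ext x
  rw [dh_apply, conjS_apply, dh_apply, show (⇑(conjS g)) = fun y => conj (g y) from
    funext fun y => conjS_apply g y, partialDeriv_conj j g.differentiableAt]
  simp

theorem pair_toL2 (f g : Sch n) : pair (toL2 f) (toL2 g) = ∫ x, f x * g x := by
  rw [pair_apply]
  refine integral_congr_ae ?_
  filter_upwards [coeFn_toL2 f, coeFn_toL2 g] with x h1 h2
  rw [h1, h2]

theorem pair_dh (h : ℝ) (j : Fin n) (f g : Sch n) :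
    pair (toL2 (dh h j f)) (toL2 g) = -pair (toL2 f) (toL2 (dh h j g)) := by
  have h1 := SchwartzMap.integral_mul_lineDerivOp_right_eq_neg_left (μ := volume) f g
    (EuclideanSpace.single j (1 : ℝ))
  have h2 : ∀ g : Sch n, dh h j g
      = (h : ℂ) • (∂_{(EuclideanSpace.single j (1 : ℝ) : RSpace n)} g : Sch n) := fun g => rfl
  rw [h2, h2, map_smul, map_smul, map_smul, map_smul, smul_apply, pair_toL2,
    pair_toL2, h1]
  simp

theorem inner_toL2 (f g : Sch n) : ⟪toL2 f, toL2 g⟫_ℂ = pair (toL2 (conjS f)) (toL2 g) := by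
  rw [pair_eq_inner, toL2_conjS, star_star]

theorem inner_dh (h : ℝ) (j : Fin n) (f g : Sch n) :
    ⟪toL2 (dh h j f), toL2 g⟫_ℂ = -⟪toL2 f, toL2 (dh h j g)⟫_ℂ := by
  rw [inner_toL2, inner_toL2, ← dh_conjS, pair_dh]

theorem dh_comm (h : ℝ) (i j : Fin n) (f : Sch n) : dh h i (dh h j f) = dh h j (dh h i f) := by
  ext x
  have key : ∀ i j : Fin n, dh h i (dh h j f) x = h * (h * fderiv ℝ (fderiv ℝ f) x
      (EuclideanSpace.single i 1) (EuclideanSpace.single j 1)) := by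
    intro i j
    have h0 : (⇑(dh h j f)) = fun y => (h : ℂ) * fderiv ℝ f y (EuclideanSpace.single j 1) := by
      ext y; rw [dh_apply]; rfl
    rw [dh_apply, h0, partialDeriv]
    have hd : DifferentiableAt ℝ (fderiv ℝ f) x :=
      ((f.smooth 2).fderiv_right (m := 1) (by norm_num)).differentiable (by norm_num) x
    have h1 : HasFDerivAt (fun y => fderiv ℝ f y (EuclideanSpace.single j 1))
        ((fderiv ℝ (fderiv ℝ f) x).flip (EuclideanSpace.single j 1)) x := by
      simpa using hd.hasFDerivAt.clm_apply (hasFDerivAt_const (EuclideanSpace.single j (1:ℝ)) x)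
    rw [(h1.const_mul (h : ℂ)).fderiv]
    simp
  rw [key, key]
  congr 2
  have hs : IsSymmSndFDerivAt ℝ f x :=
    (f.smooth 2).contDiffAt.isSymmSndFDerivAt (by simp)
  exact hs.eq _ _

theorem differentiable_of_hasTemperateGrowth {a : RSpace n → ℂ} (ha : a.HasTemperateGrowth) :
    Differentiable ℝ a := ha.1.differentiable (by norm_num)

theorem dh_mulS (h : ℝ) (j : Fin n) {a : RSpace n → ℂ} (ha : a.HasTemperateGrowth)
    {b : RSpace n → ℂ} (hb : b.HasTemperateGrowth) (hab : ∀ x, b x = h * partialDeriv j a x)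
    (g : Sch n) : dh h j (mulS a g) = mulS a (dh h j g) + mulS b g := by
  ext x
  rw [dh_apply, add_apply, mulS_apply ha, mulS_apply hb, dh_apply,
    show (⇑(mulS a g)) = fun y => a y * g y from funext fun y => mulS_apply ha g y,
    partialDeriv_mul j (differentiable_of_hasTemperateGrowth ha x) g.differentiableAt, hab]
  ring

/-- The semiclassical one-jet `(g, h ∇ g)`. -/
def jet (h : ℝ) : Sch n →ₗ[ℂ] Jet n :=
  jetOf fun i => i.elim toL2 fun j => toL2 ∘ₗ dh h j

@[simp] theorem jet_none (h : ℝ) (g : Sch n) : jet h g none = toL2 g := rfl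

@[simp] theorem jet_some (h : ℝ) (g : Sch n) (j : Fin n) :
    jet h g (some j) = toL2 (dh h j g) := rfl

theorem starJ_jet (h : ℝ) (g : Sch n) : starJ (jet h g) = jet h (conjS g) := by
  ext1 i
  cases i with
  | none => exact (toL2_conjS g).symm
  | some j =>
    change star (toL2 (dh h j g)) = toL2 (dh h j (conjS g))
    rw [dh_conjS, toL2_conjS]

/-- The graph of the weak semiclassical gradient: the tuples `(r, h ∇ r)` for `r ∈ H¹(ℝⁿ)`. -/
def h1Space (n : ℕ) (h : ℝ) : Submodule ℂ (Jet n) :=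
  ⨅ p : Sch n × Fin n, LinearMap.ker
    ((pair (toL2 (dh h p.2 p.1))).comp (PiLp.proj 2 (fun _ : Option (Fin n) => L2 n) none)
      + (pair (toL2 p.1)).comp (PiLp.proj 2 (fun _ : Option (Fin n) => L2 n) (some p.2))
        : Jet n →L[ℂ] ℂ).toLinearMap

theorem mem_h1Space {h : ℝ} {R : Jet n} : R ∈ h1Space n h ↔ ∀ (g : Sch n) (j : Fin n),
    pair (toL2 (dh h j g)) (R none) = -pair (toL2 g) (R (some j)) := by
  simp [h1Space, Submodule.mem_iInf, add_eq_zero_iff_eq_neg]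

theorem isClosed_h1Space (h : ℝ) : IsClosed (h1Space n h : Set (Jet n)) := by
  rw [h1Space, Submodule.coe_iInf]
  exact isClosed_iInter fun p => ContinuousLinearMap.isClosed_ker _

instance (h : ℝ) : CompleteSpace (h1Space n h) := (isClosed_h1Space h).completeSpace_coe

theorem jet_mem_h1Space (h : ℝ) (g : Sch n) : jet h g ∈ h1Space n h := by
  rw [mem_h1Space]
  intro φ j
  exact pair_dh h j φ g

/-! ### The convexified weight and the Carleman estimate. -/

/-- The factor `1 + h κ (α · x)` by which the convexification changes the gradient of the
weight `α · x`. -/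
def convexFactor (h κ : ℝ) (α : RSpace n) (x : RSpace n) : ℂ := ((1 + h * κ * ⟪α, x⟫_ℝ : ℝ) : ℂ)

/-- The components of `h ∇ ((α + i β) · x / h + κ (α · x)² / 2)`. -/
def phaseGrad (h κ : ℝ) (α β : RSpace n) (j : Fin n) (x : RSpace n) : ℂ :=
  α j * convexFactor h κ α x + Complex.I * β j

theorem hasTemperateGrowth_convexFactor (h κ : ℝ) (α : RSpace n) :
    (convexFactor h κ α).HasTemperateGrowth := by
  unfold convexFactor
  fun_prop

theorem hasTemperateGrowth_phaseGrad (h κ : ℝ) (α β : RSpace n) (j : Fin n) :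
    (phaseGrad h κ α β j).HasTemperateGrowth := by
  unfold phaseGrad
  have := hasTemperateGrowth_convexFactor h κ α
  fun_prop

theorem partialDeriv_convexFactor (h κ : ℝ) (α : RSpace n) (j : Fin n) (x : RSpace n) :
    partialDeriv j (convexFactor h κ α) x = ((h * κ * α j : ℝ) : ℂ) := by
  have h1 : HasFDerivAt (fun x : RSpace n => (1 + h * κ * ⟪α, x⟫_ℝ : ℝ))
      ((h * κ) • (innerSL ℝ α)) x :=
    (((innerSL ℝ α).hasFDerivAt).const_mul (h * κ)).const_add 1
  have h2 : HasFDerivAt (convexFactor h κ α)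
      (Complex.ofRealCLM.comp ((h * κ) • (innerSL ℝ α))) x :=
    Complex.ofRealCLM.hasFDerivAt.comp x h1
  rw [partialDeriv, h2.fderiv]
  simp [EuclideanSpace.inner_single_right]

theorem differentiable_convexFactor (h κ : ℝ) (α : RSpace n) :
    Differentiable ℝ (convexFactor h κ α) :=
  differentiable_of_hasTemperateGrowth (hasTemperateGrowth_convexFactor h κ α)

theorem partialDeriv_phaseGrad (h κ : ℝ) (α β : RSpace n) (i j : Fin n) (x : RSpace n) :
    partialDeriv i (phaseGrad h κ α β j) x = ((h * κ * α j * α i : ℝ) : ℂ) := by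
  have h1 : HasFDerivAt (phaseGrad h κ α β j)
      ((α j : ℂ) • fderiv ℝ (convexFactor h κ α) x) x :=
    ((differentiable_convexFactor h κ α x).hasFDerivAt.const_mul (α j : ℂ)).add_const _
  have h2 := partialDeriv_convexFactor h κ α i x
  rw [partialDeriv] at h2 ⊢
  rw [h1.fderiv, smul_apply, h2]
  push_cast
  rw [smul_eq_mul]
  ring

/-- The conjugated derivative `h ∂_j - η_j`. -/
def conjDeriv (h κ : ℝ) (α β : RSpace n) (j : Fin n) : Sch n →ₗ[ℂ] Sch n :=
  dh h j - mulS (phaseGrad h κ α β j)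

/-- The conjugated Laplacian `-∑ (h ∂_j - η_j)²`. -/
def conjLap (h κ : ℝ) (α β : RSpace n) : Sch n →ₗ[ℂ] Sch n :=
  -∑ j, conjDeriv h κ α β j ∘ₗ conjDeriv h κ α β j

theorem norm_toL2_le_mul {f g : Sch n} {c : ℝ} (h : ∀ x, ‖f x‖ ≤ c * ‖g x‖) :
    ‖toL2 f‖ ≤ c * ‖toL2 g‖ := by
  refine Lp.norm_le_mul_norm_of_ae_le_mul ?_
  filter_upwards [coeFn_toL2 f, coeFn_toL2 g] with x h1 h2
  rw [h1, h2]
  exact h x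

theorem mulS_phaseGrad (h κ : ℝ) (α β : RSpace n) (j : Fin n) (g : Sch n) :
    mulS (phaseGrad h κ α β j) g
      = (α j : ℂ) • mulS (convexFactor h κ α) g + (Complex.I * β j) • g := by
  ext x
  rw [mulS_apply (hasTemperateGrowth_phaseGrad h κ α β j), add_apply, smul_apply, smul_apply,
    mulS_apply (hasTemperateGrowth_convexFactor h κ α), phaseGrad]
  simp only [smul_eq_mul]
  ring

theorem sum_sq_eq_norm_sq (α : RSpace n) : ∑ j, α j ^ 2 = ‖α‖ ^ 2 := by
  rw [EuclideanSpace.norm_sq_eq]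
  simp

/-- Here `c = h²κ`, `A = |α|²`, `G = ‖g‖`, `m = ‖M g‖`, `s = ‖S g‖`, `N = ‖P g‖`, `t = ‖T g‖²`, `w =
‖W g‖²`, and `u`, `d` are the sums of `‖U_j g‖²` and `‖h∂_j g‖²`. The commutator term bounds `c G²`
and the identity bounds `s` by `N`; the gradient then follows from the quadratic form of `S`. -/
theorem carleman_arithmetic {c A G m s N w t u d : ℝ} (hc : 0 < c) (hc1 : c ≤ 1)
    (hA : 1 / 4 ≤ A) (hA' : A ≤ 4) (hG : 0 ≤ G) (hm : 0 ≤ m) (hs : 0 ≤ s) (hN : 0 ≤ N)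
    (hw : 0 ≤ w) (ht : 0 ≤ t) (hid : N ^ 2 = s ^ 2 + t + 4 * c * (w + A ^ 2 * m ^ 2))
    (hu : u ≤ A * m ^ 2 + G * s) (hGm : G ≤ 2 * m) (hmG : m ≤ 3 / 2 * G)
    (hd : d ≤ 2 * u + 8 * G ^ 2) : c * (G ^ 2 + d) ≤ (21 * N) ^ 2 := by
  have hAm : 0 ≤ A ^ 2 * m ^ 2 := by positivity
  have hcw : 0 ≤ 4 * c * w := by positivity
  have hcA : 0 ≤ 4 * c * (A ^ 2 * m ^ 2) := by positivity
  have hsN : s ≤ N := by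
    refine abs_le_of_sq_le_sq' ?_ hN |>.2
    linarith
  have hcG : c * G ^ 2 ≤ 16 * N ^ 2 := by
    have h1 : 4 * c * (A ^ 2 * m ^ 2) ≤ N ^ 2 := by linarith [sq_nonneg s]
    have h2 : G ^ 2 ≤ 4 * m ^ 2 := by nlinarith
    have h3 : (1 / 16 : ℝ) ≤ A ^ 2 := by nlinarith
    have h4 : 1 / 16 * (G ^ 2 / 4) ≤ A ^ 2 * m ^ 2 :=
      mul_le_mul h3 (by linarith) (by positivity) (by positivity)
    linarith [mul_le_mul_of_nonneg_left h4 hc.le]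
  have hsc1 : √c ≤ 1 := Real.sqrt_le_one.mpr hc1
  have hcc : √c ^ 2 = c := Real.sq_sqrt hc.le
  have hcG' : √c * G ≤ 4 * N := by
    refine abs_le_of_sq_le_sq' ?_ (by positivity) |>.2
    rw [mul_pow, hcc]
    linarith
  have h1 : u ≤ 9 * G ^ 2 + G * s := by
    have h5 : A * m ^ 2 ≤ 4 * (3 / 2 * G) ^ 2 :=
      mul_le_mul hA' (by gcongr) (by positivity) (by norm_num)
    linarith
  have h2 : c * (G * s) ≤ 4 * N ^ 2 := by
    calc c * (G * s) = √c * ((√c * G) * s) := by rw [← hcc, Real.sqrt_sq (Real.sqrt_nonneg c)]; ring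
      _ ≤ 1 * ((4 * N) * N) := by gcongr
      _ = 4 * N ^ 2 := by ring
  have h3 : c * (G ^ 2 + d) ≤ c * (G ^ 2 + (2 * (9 * G ^ 2 + G * s) + 8 * G ^ 2)) := by
    gcongr
    linarith
  -- The total is `27 c G² + 2 c G s ≤ (27·16 + 2·4) N² = 440 N²`, just below `21² N²`.
  linarith [sq_nonneg N]

/-- The Carleman estimate with a convexified linear weight. -/
theorem carleman_estimate {h κ R : ℝ} (hh : 0 < h) (hκ : 0 < κ) (hhκ : h ^ 2 * κ ≤ 1)
    (hR : h * κ * (2 * R) ≤ 1 / 2) {α β : RSpace n} (hα : 1 / 2 ≤ ‖α‖) (hα' : ‖α‖ ≤ 2)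
    (hβ : ‖β‖ ≤ 2) (g : Sch n) (hg : ∀ x, R < ‖x‖ → g x = 0) :
    h * √κ * ‖jet h g‖ ≤ 21 * ‖toL2 (conjLap h κ α β g)‖ := by
  set M : Sch n →ₗ[ℂ] Sch n := mulS (convexFactor h κ α) with hMdef
  -- The conjugated derivative splits as `U_j - α_j M`, with `U_j` antisymmetric and `M`
  -- multiplication by a real function. No relation between `α` and `β` is needed, so `ζ·ζ = 0`
  -- plays no role in the estimate.
  let U : Fin n → Sch n →ₗ[ℂ] Sch n := fun j => dh h j - (Complex.I * β j) • LinearMap.id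
  have hUf : ∀ j f, U j f = dh h j f - (Complex.I * β j) • f := fun j f => rfl
  have hMf : ∀ f x, M f x = convexFactor h κ α x * f x :=
    fun f x => mulS_apply (hasTemperateGrowth_convexFactor h κ α) f x
  set c : ℝ := h ^ 2 * κ with hc
  have hcpos : 0 < c := by positivity
  have hU : ∀ j f g, ⟪toL2 (U j f), toL2 g⟫_ℂ = -⟪toL2 f, toL2 (U j g)⟫_ℂ := by
    intro j f g
    rw [hUf, hUf, map_sub, map_sub, inner_sub_left, inner_sub_right, inner_dh, map_smul, map_smul,
      inner_smul_left, inner_smul_right]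
    simp
    ring
  have hM : ∀ f g, ⟪toL2 (M f), toL2 g⟫_ℂ = ⟪toL2 f, toL2 (M g)⟫_ℂ := by
    intro f g
    rw [inner_toL2, inner_toL2, pair_toL2, pair_toL2]
    congr 1
    ext x
    rw [conjS_apply, conjS_apply, hMf, hMf, map_mul, convexFactor, Complex.conj_ofReal]
    ring
  have hUU : ∀ i j f, U i (U j f) = U j (U i f) := by
    intro i j f
    simp only [hUf, map_sub, map_smul, dh_comm h i j]
    module
  have hdM : ∀ j f, dh h j (M f) = M (dh h j f) + ((c * α j : ℝ) : ℂ) • f := by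
    intro j f
    rw [hMdef, dh_mulS h j (hasTemperateGrowth_convexFactor h κ α)
      (b := fun _ => ((c * α j : ℝ) : ℂ)) (Function.HasTemperateGrowth.const _) ?_]
    · congr 1
      ext x
      rw [mulS_apply (Function.HasTemperateGrowth.const _), smul_apply, smul_eq_mul]
    · intro x
      rw [partialDeriv_convexFactor, hc]
      push_cast
      ring
  have hUM : ∀ j f, U j (M f) = M (U j f) + ((c * α j : ℝ) : ℂ) • f := by
    intro j f
    rw [hUf, hUf, hdM, map_sub, map_smul]
    abel
  have hY : ∀ j f, conjDeriv h κ α β j f = U j f - (α j : ℂ) • M f := by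
    intro j f
    rw [conjDeriv, LinearMap.sub_apply, mulS_phaseGrad, hUf]
    abel
  set A : ℝ := ∑ j, α j ^ 2 with hA
  have hAn : A = ‖α‖ ^ 2 := sum_sq_eq_norm_sq α
  have hQ : conjLap h κ α β g
      = -((∑ j, U j (U j g) + (A : ℂ) • M (M g))
        - (∑ j, (α j : ℂ) • U j (M g) + M (∑ j, (α j : ℂ) • U j g))) := by
    rw [conjLap, LinearMap.neg_apply]
    congr 1
    rw [hA, Complex.ofReal_sum, Finset.sum_smul, map_sum, ← Finset.sum_add_distrib,
      ← Finset.sum_add_distrib, ← Finset.sum_sub_distrib, LinearMap.sum_apply]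
    refine Finset.sum_congr rfl fun j _ => ?_
    rw [LinearMap.comp_apply, hY, hY]
    simp only [map_sub, map_smul]
    push_cast
    module
  have hid := norm_sq_sub_of_commutator toL2 U M c α hU hM hUU hUM g
  -- The commutator controls only `g` and the derivative along `α`. The other derivatives come from
  -- the quadratic form of `S`, at the price of `‖g‖ ‖S g‖`.
  have hell := sum_norm_sq_eq_of_antisymm toL2 U M A hU hM g
  rw [← hA] at hid
  rw [← norm_neg, ← map_neg, ← hQ] at hid
  have hAlow : 1 / 4 ≤ A := by
    rw [hAn]
    linarith [pow_le_pow_left₀ (by norm_num) hα 2]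
  have hAup : A ≤ 4 := by
    rw [hAn]
    linarith [pow_le_pow_left₀ (norm_nonneg α) hα' 2]
  -- On the ball that carries `g` the factor lies between `1/2` and `3/2`, so `‖M g‖` and `‖g‖` are
  -- comparable.
  have hfac : ∀ x : RSpace n, ‖x‖ ≤ R → |h * κ * ⟪α, x⟫_ℝ| ≤ 1 / 2 := by
    intro x hx
    have h1 : |⟪α, x⟫_ℝ| ≤ 2 * R := (abs_real_inner_le_norm α x).trans
      (mul_le_mul hα' hx (norm_nonneg x) (by norm_num))
    rw [abs_mul, abs_of_pos (mul_pos hh hκ)]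
    exact (mul_le_mul_of_nonneg_left h1 (by positivity)).trans hR
  have hMlow : ‖toL2 g‖ ≤ 2 * ‖toL2 (M g)‖ := by
    refine norm_toL2_le_mul fun x => ?_
    rw [hMf, norm_mul]
    rcases le_or_gt ‖x‖ R with hx | hx
    · have h1 := abs_le.mp (hfac x hx)
      have h2 : 1 / 2 ≤ ‖convexFactor h κ α x‖ := by
        rw [convexFactor, Complex.norm_real, Real.norm_eq_abs]
        exact le_trans (by linarith) (le_abs_self _)
      linarith [mul_le_mul_of_nonneg_right h2 (norm_nonneg (g x))]
    · simp [hg x hx]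
  have hMup : ‖toL2 (M g)‖ ≤ 3 / 2 * ‖toL2 g‖ := by
    refine norm_toL2_le_mul fun x => ?_
    rw [hMf, norm_mul]
    rcases le_or_gt ‖x‖ R with hx | hx
    · have h1 := abs_le.mp (hfac x hx)
      have h2 : ‖convexFactor h κ α x‖ ≤ 3 / 2 := by
        rw [convexFactor, Complex.norm_real, Real.norm_eq_abs, abs_le]
        constructor <;> linarith
      exact mul_le_mul_of_nonneg_right h2 (norm_nonneg (g x))
    · simp [hg x hx]
  have hu : ∑ j, ‖toL2 (U j g)‖ ^ 2 ≤ A * ‖toL2 (M g)‖ ^ 2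
      + ‖toL2 g‖ * ‖toL2 (∑ j, U j (U j g) + (A : ℂ) • M (M g))‖ := by
    rw [hell]
    have h2 := Complex.abs_re_le_norm ⟪toL2 g, toL2 (∑ j, U j (U j g) + (A : ℂ) • M (M g))⟫_ℂ
    have h3 := norm_inner_le_norm (𝕜 := ℂ) (toL2 g) (toL2 (∑ j, U j (U j g) + (A : ℂ) • M (M g)))
    have h4 := (abs_le.mp (h2.trans h3)).1
    linarith
  have hdb : ∑ j, ‖toL2 (dh h j g)‖ ^ 2 ≤ 2 * ∑ j, ‖toL2 (U j g)‖ ^ 2 + 8 * ‖toL2 g‖ ^ 2 := by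
    generalize hGdef : ‖toL2 g‖ = G
    have hG0 : 0 ≤ G := hGdef ▸ norm_nonneg _
    have h1 : ∀ j, ‖toL2 (dh h j g)‖ ^ 2 ≤ 2 * ‖toL2 (U j g)‖ ^ 2 + 2 * (β j ^ 2 * G ^ 2) := by
      intro j
      have h2 : toL2 (dh h j g) = toL2 (U j g) + (Complex.I * β j) • toL2 g := by
        rw [hUf, map_sub, map_smul]; abel
      have h3 : ‖(Complex.I * (β j : ℂ)) • toL2 g‖ = |β j| * G := by
        rw [norm_smul]; simp [hGdef]
      have h4 : ‖toL2 (dh h j g)‖ ≤ ‖toL2 (U j g)‖ + |β j| * G := by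
        rw [h2, ← h3]; exact norm_add_le _ _
      have h5 : β j ^ 2 * G ^ 2 = (|β j| * G) ^ 2 := by rw [mul_pow, sq_abs]
      rw [h5]
      linarith [sq_nonneg (‖toL2 (U j g)‖ - |β j| * G), pow_le_pow_left₀ (norm_nonneg _) h4 2]
    refine (Finset.sum_le_sum fun j _ => h1 j).trans ?_
    rw [Finset.sum_add_distrib, ← Finset.mul_sum, ← Finset.mul_sum, ← Finset.sum_mul,
      sum_sq_eq_norm_sq]
    have : ‖β‖ ^ 2 * G ^ 2 ≤ 4 * G ^ 2 := by
      gcongr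
      linarith [pow_le_pow_left₀ (norm_nonneg β) hβ 2]
    linarith
  have hfin := carleman_arithmetic hcpos hhκ hAlow hAup (norm_nonneg _) (norm_nonneg _)
    (norm_nonneg _) (norm_nonneg _) (sq_nonneg _) (sq_nonneg _) hid hu hMlow hMup hdb
  refine abs_le_of_sq_le_sq' ?_ (by positivity) |>.2
  rw [mul_pow, mul_pow, Real.sq_sqrt hκ.le, norm_sq_jet]
  exact hfin

/-! ### Duality between `H¹` and `H⁻¹`, and elliptic regularity. -/

/-- The operator `1 - h² Δ` on Schwartz functions. -/
def helmS (h : ℝ) : Sch n →ₗ[ℂ] Sch n := LinearMap.id - ∑ j, dh h j ∘ₗ dh h j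

theorem helmS_apply (h : ℝ) (g : Sch n) : helmS h g = g - ∑ j, dh h j (dh h j g) := by
  simp [helmS]

-- The multiplier `(1 + |2πhξ|²)⁻¹` has temperate growth, hence preserves Schwartz functions, and it
-- inverts the symbol. Testing against all `(1 - h²Δ)φ` is therefore testing against every Schwartz
-- function.
open Laplacian FourierTransform in
theorem helmS_surjective (h : ℝ) : Function.Surjective (helmS (n := n) h) := by
  intro φ
  let a : RSpace n → ℝ := fun ξ => (1 + ‖(2 * Real.pi * h) • ξ‖ ^ 2) ^ (-1 : ℝ)
  have ha : a.HasTemperateGrowth :=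
    (Function.hasTemperateGrowth_one_add_norm_sq_rpow (H := RSpace n) (-1)).comp
      (f := fun ξ : RSpace n => (2 * Real.pi * h) • ξ) (by fun_prop)
  have hb : (fun ξ : RSpace n => ‖ξ‖ ^ 2).HasTemperateGrowth := by fun_prop
  refine ⟨SchwartzMap.fourierMultiplierCLM ℂ a φ, ?_⟩
  have hlap : ∀ g : Sch n, ∑ j, dh h j (dh h j g) = ((h : ℂ) ^ 2) • (Δ g : Sch n) := by
    intro g
    rw [SchwartzMap.laplacian_eq_sum (EuclideanSpace.basisFun (Fin n) ℝ), Finset.smul_sum]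
    refine Finset.sum_congr rfl fun j _ => ?_
    simp [dh, smul_smul, sq]
    rw [← Complex.ofReal_mul]
    rfl
  rw [helmS_apply, hlap, SchwartzMap.laplacian_eq_fourierMultiplierCLM,
    SchwartzMap.fourierMultiplierCLM_fourierMultiplierCLM_apply hb ha,
    SchwartzMap.fourierMultiplierCLM_apply, SchwartzMap.fourierMultiplierCLM_apply]
  have h1 : SchwartzMap.smulLeftCLM ℂ a (𝓕 φ)
      + ((2 * Real.pi * h) ^ 2 : ℝ) • SchwartzMap.smulLeftCLM ℂ ((fun ξ => ‖ξ‖ ^ 2) * a) (𝓕 φ)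
      = 𝓕 φ := by
    ext ξ
    rw [add_apply, smul_apply, SchwartzMap.smulLeftCLM_apply_apply ha,
      SchwartzMap.smulLeftCLM_apply_apply (hb.mul ha), smul_smul, ← add_smul]
    have h2 : a ξ + (2 * Real.pi * h) ^ 2 * ((fun ξ : RSpace n => ‖ξ‖ ^ 2) * a) ξ = 1 := by
      simp only [a, Pi.mul_apply, Real.rpow_neg_one, norm_smul, mul_pow, Real.norm_eq_abs, sq_abs]
      field_simp
    rw [h2, one_smul]
  calc _ = 𝓕⁻ (SchwartzMap.smulLeftCLM ℂ a (𝓕 φ)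
      + ((2 * Real.pi * h) ^ 2 : ℝ) • SchwartzMap.smulLeftCLM ℂ ((fun ξ => ‖ξ‖ ^ 2) * a) (𝓕 φ)) := by
        rw [FourierTransform.fourierInv_add, FourierTransform.fourierInv_smul]
        ext x
        simp only [sub_apply, add_apply, smul_apply, neg_smul, neg_apply, Complex.real_smul,
          smul_eq_mul]
        push_cast
        ring
    _ = φ := by rw [h1, FourierTransform.fourierInv_fourier_eq]

theorem eq_of_pair_toL2_eq {u v : L2 n} (h : ∀ φ : Sch n, pair u (toL2 φ) = pair v (toL2 φ)) :
    u = v := by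
  have hd : DenseRange (SchwartzMap.toLpCLM ℂ (E := RSpace n) ℂ 2 volume) :=
    SchwartzMap.denseRange_toLpCLM (by norm_num)
  have h1 : pair u = pair v := by
    ext1 f
    exact congrFun (hd.equalizer (pair u).continuous (pair v).continuous (funext h)) f
  have h2 : ‖pair (u - v)‖ = 0 := by rw [map_sub, h1, sub_self, norm_zero]
  rw [norm_pair, norm_eq_zero, sub_eq_zero] at h2
  exact h2

/-- A linear family of tuples `C g`, as functionals on `H¹(ℝⁿ)`. -/
def dualMap {V : Type*} [AddCommGroup V] [Module ℂ V] (h : ℝ) (C : V →ₗ[ℂ] Jet n) :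
    V →ₗ[ℂ] StrongDual ℂ (h1Space n h) where
  toFun g := (pairJ (C g)).comp (h1Space n h).subtypeL
  map_add' f g := by ext; simp
  map_smul' c g := by ext; simp

theorem dualMap_apply {V : Type*} [AddCommGroup V] [Module ℂ V] (h : ℝ) (C : V →ₗ[ℂ] Jet n)
    (g : V) (R : h1Space n h) : dualMap h C g R = pairJ (C g) R := rfl

/-- The conjugate of a jet is again the jet of a Schwartz function, so it is an admissible test
element, and it produces the square of the norm. In other words, the `H⁻¹` norm of `(1 - h²Δ) g`
dominates the `H¹` norm of `g`. -/
theorem norm_jet_le_norm_dualMap (h : ℝ) (g : Sch n) : ‖jet h g‖ ≤ ‖dualMap h (jet h) g‖ := by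
  have h1 := (dualMap h (jet h) g).le_opNorm
    ⟨starJ (jet h g), by rw [starJ_jet]; exact jet_mem_h1Space h _⟩
  rw [dualMap_apply, pairJ_starJ] at h1
  have h2 : ‖((‖jet h g‖ ^ 2 : ℝ) : ℂ)‖ = ‖jet h g‖ * ‖jet h g‖ := by simp [sq]
  rw [h2] at h1
  change _ ≤ _ * ‖starJ (jet h g)‖ at h1
  rw [norm_starJ] at h1
  rcases eq_or_lt_of_le (norm_nonneg (jet h g)) with h0 | h0
  · rw [← h0]; exact norm_nonneg (dualMap h (jet h) g)
  · exact le_of_mul_le_mul_right h1 h0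

/-- A square integrable function `w` with `(1 - h² Δ) w ∈ H⁻¹(ℝⁿ)` lies in `H¹(ℝⁿ)`. -/
theorem exists_h1Space_of_helmS {h L : ℝ} (hL : 0 ≤ L) (w : L2 n)
    (hw : ∀ φ : Sch n, ‖pair w (toL2 (helmS h φ))‖ ≤ L * ‖jet h φ‖) :
    ∃ R ∈ h1Space n h, R none = w ∧ ‖R‖ ≤ L := by
  obtain ⟨R, hR, hRL⟩ := exists_apply_eq_of_norm_le (dualMap h (jet h))
    ((pair w).toLinearMap ∘ₗ toL2 ∘ₗ helmS h) hL
    (fun φ => (hw φ).trans (mul_le_mul_of_nonneg_left (norm_jet_le_norm_dualMap h φ) hL))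
  refine ⟨R, R.2, ?_, hRL⟩
  -- `R` solves `(1 - h²Δ) R = (1 - h²Δ) w` weakly; surjectivity of `helmS` on Schwartz functions,
  -- which are dense in `L²`, turns this into `R = w`.
  refine eq_of_pair_toL2_eq fun ψ => ?_
  obtain ⟨φ, rfl⟩ := helmS_surjective h ψ
  have h1 := hR φ
  rw [dualMap_apply, pairJ_apply'] at h1
  simp only [jet_none, jet_some] at h1
  change _ = pair w (toL2 (helmS h φ)) at h1
  rw [← h1, helmS_apply, map_sub, map_sum, pair_comm, map_sub, map_sum, sub_apply,
    sub_eq_add_neg, sum_apply, ← Finset.sum_neg_distrib]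
  congr 1
  refine Finset.sum_congr rfl fun j _ => ?_
  rw [mem_h1Space.mp R.2 (dh h j φ) j, neg_neg]

/-! ### Bounded multipliers, supports, and commutators with a cut-off. -/

/-- Multiplication by a bounded function on `L²`. -/
def mulB {a : RSpace n → ℂ} (ha : MemLp a ∞ volume) : L2 n →L[ℂ] L2 n :=
  (ContinuousLinearMap.mul ℂ ℂ).holderL volume ∞ 2 2 (ha.toLp a)

theorem coeFn_mulB {a : RSpace n → ℂ} (ha : MemLp a ∞ volume) (f : L2 n) :
    mulB ha f =ᵐ[volume] fun x => a x * f x := by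
  have h1 := (ContinuousLinearMap.mul ℂ ℂ).coeFn_holder (r := 2) (ha.toLp a) f
  filter_upwards [h1, ha.coeFn_toLp] with x h2 h3
  change ((ContinuousLinearMap.mul ℂ ℂ).holder 2 (ha.toLp a) f : L2 n) x = _
  rw [h2, h3]
  rfl

theorem norm_mulB_le {a : RSpace n → ℂ} (ha : MemLp a ∞ volume) {c : ℝ}
    (hc : ∀ᵐ x, ‖a x‖ ≤ c) (f : L2 n) : ‖mulB ha f‖ ≤ c * ‖f‖ := by
  refine Lp.norm_le_mul_norm_of_ae_le_mul ?_
  filter_upwards [coeFn_mulB ha f, hc] with x h1 h2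
  rw [h1, norm_mul]
  gcongr

theorem pair_mulB {a : RSpace n → ℂ} (ha : MemLp a ∞ volume) (f g : L2 n) :
    pair (mulB ha f) g = pair f (mulB ha g) := by
  rw [pair_apply, pair_apply]
  refine integral_congr_ae ?_
  filter_upwards [coeFn_mulB ha f, coeFn_mulB ha g] with x h1 h2
  rw [h1, h2]
  ring

theorem mulB_toL2 {a : RSpace n → ℂ} (ha : MemLp a ∞ volume) (ha' : a.HasTemperateGrowth)
    (g : Sch n) : mulB ha (toL2 g) = toL2 (mulS a g) := by
  refine Lp.ext ?_
  filter_upwards [coeFn_mulB ha (toL2 g), coeFn_toL2 g, coeFn_toL2 (mulS a g)] with x h1 h2 h3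
  rw [h1, h2, h3, mulS_apply ha']

/-- Schwartz functions that vanish outside the closed ball of radius `R`. -/
def suppS (n : ℕ) (R : ℝ) : Submodule ℂ (Sch n) where
  carrier := {g | ∀ x, R < ‖x‖ → g x = 0}
  add_mem' := by
    intro f g hf hg x hx
    rw [add_apply, hf x hx, hg x hx, add_zero]
  zero_mem' := fun _ _ => rfl
  smul_mem' := by
    intro c g hg x hx
    rw [smul_apply, hg x hx, smul_zero]

theorem partialDeriv_eq_zero_of_norm_lt {f : RSpace n → ℂ} {R : ℝ}
    (hf : ∀ x, R < ‖x‖ → f x = 0) (j : Fin n) (x : RSpace n) (hx : R < ‖x‖) :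
    partialDeriv j f x = 0 := by
  have h1 : f =ᶠ[𝓝 x] fun _ => 0 := by
    filter_upwards [(isOpen_lt continuous_const continuous_norm).mem_nhds hx] with y hy
    exact hf y hy
  rw [partialDeriv, h1.fderiv_eq]
  simp

theorem dh_mem_suppS {R h : ℝ} {g : Sch n} (hg : g ∈ suppS n R) (j : Fin n) :
    dh h j g ∈ suppS n R := by
  intro x hx
  rw [dh_apply, partialDeriv_eq_zero_of_norm_lt hg j x hx, mul_zero]

theorem mulS_mem_suppS {R : ℝ} {g : Sch n} (hg : g ∈ suppS n R) {a : RSpace n → ℂ}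
    (ha : a.HasTemperateGrowth) : mulS a g ∈ suppS n R := by
  intro x hx
  rw [mulS_apply ha, hg x hx, mul_zero]

theorem conjDeriv_mem_suppS {R h κ : ℝ} {α β : RSpace n} {g : Sch n} (hg : g ∈ suppS n R)
    (j : Fin n) : conjDeriv h κ α β j g ∈ suppS n R :=
  (suppS n R).sub_mem (dh_mem_suppS hg j) (mulS_mem_suppS hg (hasTemperateGrowth_phaseGrad _ _ _ _ _))

theorem conjLap_mem_suppS {R h κ : ℝ} {α β : RSpace n} {g : Sch n} (hg : g ∈ suppS n R) :
    conjLap h κ α β g ∈ suppS n R := by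
  rw [conjLap, LinearMap.neg_apply, LinearMap.sum_apply]
  exact (suppS n R).neg_mem ((suppS n R).sum_mem fun j _ =>
    conjDeriv_mem_suppS (conjDeriv_mem_suppS hg j) j)

theorem norm_coord_le (x : RSpace n) (j : Fin n) : |x j| ≤ ‖x‖ := by
  have := PiLp.norm_apply_le x j
  rwa [Real.norm_eq_abs] at this

theorem norm_phaseGrad_le {h κ R : ℝ} (hh : 0 < h) (hκ : 0 < κ)
    (hR : h * κ * (2 * R) ≤ 1 / 2) {α β : RSpace n} (hα : ‖α‖ ≤ 2) (hβ : ‖β‖ ≤ 2)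
    (j : Fin n) {x : RSpace n} (hx : ‖x‖ ≤ R) : ‖phaseGrad h κ α β j x‖ ≤ 5 := by
  have h1 : |⟪α, x⟫_ℝ| ≤ 2 * R := (abs_real_inner_le_norm α x).trans
    (mul_le_mul hα hx (norm_nonneg x) (by norm_num))
  have h2 : |h * κ * ⟪α, x⟫_ℝ| ≤ 1 / 2 := by
    rw [abs_mul, abs_of_pos (mul_pos hh hκ)]
    exact (mul_le_mul_of_nonneg_left h1 (by positivity)).trans hR
  have h3 : ‖convexFactor h κ α x‖ ≤ 3 / 2 := by
    rw [convexFactor, Complex.norm_real, Real.norm_eq_abs]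
    have := abs_le.mp h2
    rw [abs_le]
    constructor <;> linarith
  calc ‖phaseGrad h κ α β j x‖ ≤ ‖(α j : ℂ) * convexFactor h κ α x‖ + ‖Complex.I * β j‖ :=
        norm_add_le _ _
    _ = |α j| * ‖convexFactor h κ α x‖ + |β j| := by simp
    _ ≤ 2 * (3 / 2) + 2 :=
        add_le_add (mul_le_mul ((norm_coord_le α j).trans hα) h3 (norm_nonneg _) (by norm_num))
          ((norm_coord_le β j).trans hβ)
    _ = 5 := by norm_num

/-- The coefficient of `g` in the commutator of a cut-off `χ` with `(h ∂_j - η_j)²`. -/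
def cutoffCoeff₀ (h κ : ℝ) (α β : RSpace n) (χ : RSpace n → ℂ) (j : Fin n) (x : RSpace n) : ℂ :=
  h ^ 2 * partialDeriv j (partialDeriv j χ) x - ((h ^ 2 * κ * α j * α j : ℝ) : ℂ) * χ x
    - 2 * phaseGrad h κ α β j x * (h * partialDeriv j χ x) + phaseGrad h κ α β j x ^ 2 * χ x

/-- The coefficient of `h ∂_j g` in the commutator of a cut-off `χ` with `(h ∂_j - η_j)²`. -/
def cutoffCoeff₁ (h κ : ℝ) (α β : RSpace n) (χ : RSpace n → ℂ) (j : Fin n) (x : RSpace n) : ℂ :=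
  2 * (h * partialDeriv j χ x) - 2 * phaseGrad h κ α β j x * χ x

theorem contDiff_partialDeriv {f : RSpace n → ℂ} (hf : ContDiff ℝ ∞ f) (j : Fin n) :
    ContDiff ℝ ∞ (partialDeriv j f) :=
  (hf.fderiv_right (m := ∞) le_rfl).clm_apply contDiff_const

theorem hasCompactSupport_partialDeriv {f : RSpace n → ℂ} (hf : HasCompactSupport f) (j : Fin n) :
    HasCompactSupport (partialDeriv j f) :=
  hf.fderiv_apply ℝ _

section Cutoff

variable {χ : RSpace n → ℂ}

theorem hasTemperateGrowth_partialDeriv (hχ : ContDiff ℝ ∞ χ) (hχc : HasCompactSupport χ)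
    (j : Fin n) : (partialDeriv j χ).HasTemperateGrowth :=
  (hasCompactSupport_partialDeriv hχc j).hasTemperateGrowth (contDiff_partialDeriv hχ j)

theorem hasTemperateGrowth_cutoffCoeff₀ (hχ : ContDiff ℝ ∞ χ) (hχc : HasCompactSupport χ)
    (h κ : ℝ) (α β : RSpace n) (j : Fin n) :
    (cutoffCoeff₀ h κ α β χ j).HasTemperateGrowth := by
  unfold cutoffCoeff₀
  have h1 := hasTemperateGrowth_partialDeriv hχ hχc j
  have h2 := hasTemperateGrowth_partialDeriv (contDiff_partialDeriv hχ j)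
    (hasCompactSupport_partialDeriv hχc j) j
  have h3 := hχc.hasTemperateGrowth hχ
  have h4 := hasTemperateGrowth_phaseGrad h κ α β j
  fun_prop

theorem hasTemperateGrowth_cutoffCoeff₁ (hχ : ContDiff ℝ ∞ χ) (hχc : HasCompactSupport χ)
    (h κ : ℝ) (α β : RSpace n) (j : Fin n) :
    (cutoffCoeff₁ h κ α β χ j).HasTemperateGrowth := by
  unfold cutoffCoeff₁
  have h1 := hasTemperateGrowth_partialDeriv hχ hχc j
  have h3 := hχc.hasTemperateGrowth hχ
  have h4 := hasTemperateGrowth_phaseGrad h κ α β j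
  fun_prop

/-- `h²∂_j²` and `(h∂_j - η_j)²` have the same principal part, so exchanging them across `χ` leaves
terms of first order only. The cut-off matters because `η_j` grows linearly. -/
theorem mulS_dh_dh (hχ : ContDiff ℝ ∞ χ) (hχc : HasCompactSupport χ)
    (h κ : ℝ) (α β : RSpace n) (j : Fin n) (φ : Sch n) :
    mulS χ (dh h j (dh h j φ)) = conjDeriv h κ α β j (conjDeriv h κ α β j (mulS χ φ))
      - mulS (cutoffCoeff₀ h κ α β χ j) φ - mulS (cutoffCoeff₁ h κ α β χ j) (dh h j φ) := by
  have h1 := hasTemperateGrowth_partialDeriv hχ hχc j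
  have h2 := hasTemperateGrowth_partialDeriv (contDiff_partialDeriv hχ j)
    (hasCompactSupport_partialDeriv hχc j) j
  have h3 := hχc.hasTemperateGrowth hχ
  have h4 := hasTemperateGrowth_phaseGrad h κ α β j
  have h1' : (fun x => (h : ℂ) * partialDeriv j χ x).HasTemperateGrowth := by fun_prop
  have h2' : (fun x => (h : ℂ) * (h * partialDeriv j (partialDeriv j χ) x)).HasTemperateGrowth := by
    fun_prop
  have h5 : (fun _ : RSpace n => ((h ^ 2 * κ * α j * α j : ℝ) : ℂ)).HasTemperateGrowth := by
    fun_prop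
  have d1 := fun g : Sch n => dh_mulS h j h3 h1' (fun x => rfl) g
  have d2 := fun g : Sch n => dh_mulS h j h1' h2' (fun x => by
    have : partialDeriv j (fun x => (h : ℂ) * partialDeriv j χ x) x
        = h * partialDeriv j (partialDeriv j χ) x := by
      have hd := ((contDiff_partialDeriv hχ j).differentiable (by norm_num) x).hasFDerivAt
      rw [partialDeriv, (hd.const_mul (h : ℂ)).fderiv]
      rfl
    rw [this]) g
  have d3 := fun g : Sch n => dh_mulS h j h4 h5 (fun x => by
    rw [partialDeriv_phaseGrad]; push_cast; ring) g
  have hY : ∀ f, conjDeriv h κ α β j f = dh h j f - mulS (phaseGrad h κ α β j) f := fun f => rfl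
  simp only [hY, map_sub, d1, map_add, d2, d3]
  ext x
  simp only [add_apply, sub_apply, mulS_apply h3, mulS_apply h1', mulS_apply h2', mulS_apply h4,
    mulS_apply h5, mulS_apply (hasTemperateGrowth_cutoffCoeff₀ hχ hχc h κ α β j),
    mulS_apply (hasTemperateGrowth_cutoffCoeff₁ hχ hχc h κ α β j), cutoffCoeff₀, cutoffCoeff₁]
  ring

end Cutoff

/-- A smooth cut-off function for the ball of radius `R`. -/
structure IsCutoff (χ : RSpace n → ℂ) (R k : ℝ) : Prop where
  smooth : ContDiff ℝ ∞ χ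
  hasCompactSupport : HasCompactSupport χ
  eq_one : ∀ x, ‖x‖ ≤ R → χ x = 1
  eq_zero : ∀ x, R + 1 < ‖x‖ → χ x = 0
  norm_le : ∀ x, ‖χ x‖ ≤ 1
  norm_deriv_le : ∀ j x, ‖partialDeriv j χ x‖ ≤ k
  norm_deriv_deriv_le : ∀ j x, ‖partialDeriv j (partialDeriv j χ) x‖ ≤ k

theorem exists_isCutoff (n : ℕ) {R : ℝ} (hR : 0 < R) :
    ∃ (χ : RSpace n → ℂ) (k : ℝ), 0 ≤ k ∧ IsCutoff χ R k := by
  let b : ContDiffBump (0 : RSpace n) := ⟨R, R + 1, hR, by linarith⟩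
  let χ : RSpace n → ℂ := fun x => (b x : ℂ)
  have hs : ContDiff ℝ ∞ χ := Complex.ofRealCLM.contDiff.comp b.contDiff
  have hc : HasCompactSupport χ :=
    b.hasCompactSupport.comp_left (g := fun t : ℝ => (t : ℂ)) (by simp)
  have hb1 : ∀ j, ∃ k, ∀ x, ‖partialDeriv j χ x‖ ≤ k := fun j =>
    (contDiff_partialDeriv hs j).continuous.bounded_above_of_compact_support
      (hasCompactSupport_partialDeriv hc j)
  have hb2 : ∀ j, ∃ k, ∀ x, ‖partialDeriv j (partialDeriv j χ) x‖ ≤ k := fun j =>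
    (contDiff_partialDeriv (contDiff_partialDeriv hs j) j).continuous.bounded_above_of_compact_support
      (hasCompactSupport_partialDeriv (hasCompactSupport_partialDeriv hc j) j)
  choose k1 hk1 using hb1
  choose k2 hk2 using hb2
  have hle1 : ∀ j, k1 j ≤ ∑ i, (|k1 i| + |k2 i|) := fun j =>
    (le_abs_self _).trans ((le_add_of_nonneg_right (abs_nonneg (k2 j))).trans
      (Finset.single_le_sum (f := fun i => |k1 i| + |k2 i|) (fun i _ => by positivity)
        (Finset.mem_univ j)))
  have hle2 : ∀ j, k2 j ≤ ∑ i, (|k1 i| + |k2 i|) := fun j =>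
    (le_abs_self _).trans ((le_add_of_nonneg_left (abs_nonneg (k1 j))).trans
      (Finset.single_le_sum (f := fun i => |k1 i| + |k2 i|) (fun i _ => by positivity)
        (Finset.mem_univ j)))
  refine ⟨χ, ∑ i, (|k1 i| + |k2 i|), by positivity, hs, hc, ?_, ?_, ?_, ?_, ?_⟩
  · intro x hx
    simp only [χ]
    rw [b.one_of_mem_closedBall (by simpa using hx), Complex.ofReal_one]
  · intro x hx
    simp only [χ]
    rw [b.zero_of_le_dist (by simpa using hx.le), Complex.ofReal_zero]
  · intro x
    simp only [χ, Complex.norm_real, Real.norm_eq_abs, abs_of_nonneg b.nonneg]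
    exact b.le_one
  · exact fun j x => (hk1 j x).trans (hle1 j)
  · exact fun j x => (hk2 j x).trans (hle2 j)

/-- The standing assumptions on the parameters of the convexified weight. -/
structure IsAdmissible (h κ R : ℝ) (α β : RSpace n) : Prop where
  h_pos : 0 < h
  h_le : h ≤ 1
  κ_pos : 0 < κ
  hκ_le : h ^ 2 * κ ≤ 1
  hκR_le : h * κ * (2 * R) ≤ 1 / 2
  le_α : 1 / 2 ≤ ‖α‖
  α_le : ‖α‖ ≤ 2
  β_le : ‖β‖ ≤ 2

theorem IsAdmissible.mul_sqrt_le {h κ R : ℝ} {α β : RSpace n} (H : IsAdmissible h κ R α β) :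
    h * √κ ≤ 1 := by
  refine abs_le_of_sq_le_sq' ?_ (by norm_num) |>.2
  rw [mul_pow, Real.sq_sqrt H.κ_pos.le, one_pow]
  exact H.hκ_le

theorem IsAdmissible.mul_sqrt_pos {h κ R : ℝ} {α β : RSpace n} (H : IsAdmissible h κ R α β) :
    0 < h * √κ := mul_pos H.h_pos (Real.sqrt_pos.mpr H.κ_pos)

section Estimates

variable {h κ R k : ℝ} {α β : RSpace n} {χ : RSpace n → ℂ}

theorem norm_cutoffCoeff₀_le (H : IsAdmissible h κ (R + 1) α β) (hk : 0 ≤ k)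
    (hχ : IsCutoff χ R k) (j : Fin n) (x : RSpace n) :
    ‖cutoffCoeff₀ h κ α β χ j x‖ ≤ 11 * k + 29 := by
  rcases le_or_gt ‖x‖ (R + 1) with hx | hx
  · have h0 := H.h_pos
    have h1 := norm_phaseGrad_le H.h_pos H.κ_pos H.hκR_le H.α_le H.β_le j hx
    have t1 : ‖(h : ℂ) ^ 2 * partialDeriv j (partialDeriv j χ) x‖ ≤ k := by
      rw [norm_mul, norm_pow, Complex.norm_real, Real.norm_eq_abs, abs_of_pos h0]
      have := hχ.norm_deriv_deriv_le j x
      calc h ^ 2 * _ ≤ 1 * k := mul_le_mul (pow_le_one₀ h0.le H.h_le) this (norm_nonneg _) (by norm_num)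
        _ = k := one_mul k
    have t2 : ‖((h ^ 2 * κ * α j * α j : ℝ) : ℂ) * χ x‖ ≤ 4 := by
      rw [norm_mul, Complex.norm_real, Real.norm_eq_abs]
      have ha : |α j| ≤ 2 := (norm_coord_le α j).trans H.α_le
      have : |h ^ 2 * κ * α j * α j| ≤ 1 * 2 * 2 := by
        rw [abs_mul, abs_mul, abs_of_nonneg (by have := H.κ_pos; positivity : 0 ≤ h ^ 2 * κ)]
        gcongr
        exact H.hκ_le
      calc _ ≤ (1 * 2 * 2) * 1 := mul_le_mul this (hχ.norm_le x) (norm_nonneg _) (by norm_num)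
        _ = 4 := by norm_num
    have t3 : ‖2 * phaseGrad h κ α β j x * (h * partialDeriv j χ x)‖ ≤ 2 * 5 * (1 * k) := by
      rw [norm_mul, norm_mul, norm_mul, Complex.norm_real, Real.norm_eq_abs, abs_of_pos h0]
      rw [Complex.norm_ofNat]
      have := hχ.norm_deriv_le j x
      have := H.h_le
      gcongr
    have t4 : ‖phaseGrad h κ α β j x ^ 2 * χ x‖ ≤ 5 ^ 2 * 1 := by
      rw [norm_mul, norm_pow]
      have := hχ.norm_le x
      gcongr
    have := norm_add_le ((h : ℂ) ^ 2 * partialDeriv j (partialDeriv j χ) x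
      - ((h ^ 2 * κ * α j * α j : ℝ) : ℂ) * χ x
      - 2 * phaseGrad h κ α β j x * (h * partialDeriv j χ x)) (phaseGrad h κ α β j x ^ 2 * χ x)
    have := norm_sub_le ((h : ℂ) ^ 2 * partialDeriv j (partialDeriv j χ) x
      - ((h ^ 2 * κ * α j * α j : ℝ) : ℂ) * χ x)
      (2 * phaseGrad h κ α β j x * (h * partialDeriv j χ x))
    have := norm_sub_le ((h : ℂ) ^ 2 * partialDeriv j (partialDeriv j χ) x)
      (((h ^ 2 * κ * α j * α j : ℝ) : ℂ) * χ x)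
    rw [cutoffCoeff₀]
    linarith
  · have h1 := partialDeriv_eq_zero_of_norm_lt hχ.eq_zero j
    have h2 := partialDeriv_eq_zero_of_norm_lt h1 j
    rw [cutoffCoeff₀, h1 x hx, h2 x hx, hχ.eq_zero x hx]
    simp only [mul_zero, sub_zero, add_zero, norm_zero]
    positivity

theorem norm_cutoffCoeff₁_le (H : IsAdmissible h κ (R + 1) α β) (hk : 0 ≤ k)
    (hχ : IsCutoff χ R k) (j : Fin n) (x : RSpace n) :
    ‖cutoffCoeff₁ h κ α β χ j x‖ ≤ 2 * k + 10 := by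
  rcases le_or_gt ‖x‖ (R + 1) with hx | hx
  · have h0 := H.h_pos
    have h1 := norm_phaseGrad_le H.h_pos H.κ_pos H.hκR_le H.α_le H.β_le j hx
    have t1 : ‖2 * ((h : ℂ) * partialDeriv j χ x)‖ ≤ 2 * (1 * k) := by
      rw [norm_mul, norm_mul, Complex.norm_real, Real.norm_eq_abs, abs_of_pos h0,
        Complex.norm_ofNat]
      have := hχ.norm_deriv_le j x
      have := H.h_le
      gcongr
    have t2 : ‖2 * phaseGrad h κ α β j x * χ x‖ ≤ 2 * 5 * 1 := by
      rw [norm_mul, norm_mul, Complex.norm_ofNat]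
      have := hχ.norm_le x
      gcongr
    have := norm_sub_le (2 * ((h : ℂ) * partialDeriv j χ x)) (2 * phaseGrad h κ α β j x * χ x)
    rw [cutoffCoeff₁]
    linarith
  · have h1 := partialDeriv_eq_zero_of_norm_lt hχ.eq_zero j
    rw [cutoffCoeff₁, h1 x hx, hχ.eq_zero x hx]
    simp only [mul_zero, sub_zero, norm_zero]
    positivity

theorem norm_toL2_mulS_le {a : RSpace n → ℂ} (ha : a.HasTemperateGrowth) {c : ℝ}
    (hc : ∀ x, ‖a x‖ ≤ c) (g : Sch n) : ‖toL2 (mulS a g)‖ ≤ c * ‖toL2 g‖ := by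
  refine norm_toL2_le_mul fun x => ?_
  rw [mulS_apply ha, norm_mul]
  exact mul_le_mul_of_nonneg_right (hc x) (norm_nonneg _)

theorem norm_toL2_le_jet (h : ℝ) (g : Sch n) : ‖toL2 g‖ ≤ ‖jet h g‖ := norm_jet_none_le (jet h g)

theorem norm_toL2_dh_le_jet (h : ℝ) (g : Sch n) (j : Fin n) : ‖toL2 (dh h j g)‖ ≤ ‖jet h g‖ :=
  norm_jet_some_le (jet h g) j

/-- Modulo operators bounded from `H¹` to `L²` uniformly in `h`, the conjugated Laplacian acts on
cut-off functions like `1 - h²Δ`. This allows elliptic regularity to be applied to solutions of the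
conjugated equation. -/
theorem norm_toL2_cutoff_commutator_le (H : IsAdmissible h κ (R + 1) α β) (hk : 0 ≤ k)
    (hχ : IsCutoff χ R k) (φ : Sch n) :
    ‖toL2 (mulS χ (helmS h φ) - conjLap h κ α β (mulS χ φ))‖
      ≤ (1 + n * (13 * k + 39)) * ‖jet h φ‖ := by
  have hid : mulS χ (helmS h φ) - conjLap h κ α β (mulS χ φ)
      = mulS χ φ + ∑ j, (mulS (cutoffCoeff₀ h κ α β χ j) φ
        + mulS (cutoffCoeff₁ h κ α β χ j) (dh h j φ)) := by
    rw [helmS_apply, map_sub, map_sum, conjLap, LinearMap.neg_apply, LinearMap.sum_apply,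
      sub_neg_eq_add, sub_add, ← Finset.sum_sub_distrib, sub_eq_add_neg, ← Finset.sum_neg_distrib]
    congr 1
    refine Finset.sum_congr rfl fun j _ => ?_
    rw [mulS_dh_dh hχ.smooth hχ.hasCompactSupport h κ α β j φ, LinearMap.comp_apply]
    abel
  rw [hid, map_add, map_sum, add_mul, one_mul]
  refine (norm_add_le _ _).trans (add_le_add ?_ ?_)
  · refine (norm_toL2_mulS_le (hχ.hasCompactSupport.hasTemperateGrowth hχ.smooth) hχ.norm_le φ).trans ?_
    rw [one_mul]
    exact norm_toL2_le_jet h φ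
  · refine (norm_sum_le _ _).trans ?_
    have : ∀ j ∈ Finset.univ, ‖toL2 (mulS (cutoffCoeff₀ h κ α β χ j) φ
        + mulS (cutoffCoeff₁ h κ α β χ j) (dh h j φ))‖ ≤ (13 * k + 39) * ‖jet h φ‖ := by
      intro j _
      rw [map_add]
      refine (norm_add_le _ _).trans ?_
      have h1 := norm_toL2_mulS_le
        (hasTemperateGrowth_cutoffCoeff₀ hχ.smooth hχ.hasCompactSupport h κ α β j)
        (norm_cutoffCoeff₀_le H hk hχ j) φ
      have h2 := norm_toL2_mulS_le
        (hasTemperateGrowth_cutoffCoeff₁ hχ.smooth hχ.hasCompactSupport h κ α β j)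
        (norm_cutoffCoeff₁_le H hk hχ j) (dh h j φ)
      have h3 := mul_le_mul_of_nonneg_left (norm_toL2_le_jet h φ) (by positivity : 0 ≤ 11 * k + 29)
      have h4 := mul_le_mul_of_nonneg_left (norm_toL2_dh_le_jet h φ j)
        (by positivity : 0 ≤ 2 * k + 10)
      linarith
    refine (Finset.sum_le_sum this).trans ?_
    simp [mul_assoc]

theorem norm_jet_mulS_cutoff_le (hh : 0 < h) (hh1 : h ≤ 1) (hk : 0 ≤ k) (hχ : IsCutoff χ R k)
    (φ : Sch n) : ‖jet h (mulS χ φ)‖ ≤ (1 + n * (1 + k)) * ‖jet h φ‖ := by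
  have hχt := hχ.hasCompactSupport.hasTemperateGrowth hχ.smooth
  refine (norm_jet_le_sum _).trans ?_
  rw [add_mul, one_mul]
  refine add_le_add ?_ ?_
  · refine (norm_toL2_mulS_le hχt hχ.norm_le φ).trans ?_
    rw [one_mul]
    exact norm_toL2_le_jet h φ
  · have : ∀ j ∈ Finset.univ, ‖jet h (mulS χ φ) (some j)‖ ≤ (1 + k) * ‖jet h φ‖ := by
      intro j _
      have h1 := hasTemperateGrowth_partialDeriv hχ.smooth hχ.hasCompactSupport j
      have h1' : (fun x => (h : ℂ) * partialDeriv j χ x).HasTemperateGrowth := by fun_prop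
      rw [jet_some, dh_mulS h j hχt h1' (fun _ => rfl), map_add]
      refine (norm_add_le _ _).trans ?_
      have h2 := norm_toL2_mulS_le hχt hχ.norm_le (dh h j φ)
      have h3 := norm_toL2_mulS_le h1' (c := k) (fun x => by
        rw [norm_mul, Complex.norm_real, Real.norm_eq_abs, abs_of_pos hh]
        calc h * _ ≤ 1 * k := mul_le_mul hh1 (hχ.norm_deriv_le j x) (norm_nonneg _) (by norm_num)
          _ = k := one_mul k) φ
      have h4 := norm_toL2_dh_le_jet h φ j
      have h5 := mul_le_mul_of_nonneg_left (norm_toL2_le_jet h φ) hk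
      linarith
    refine (Finset.sum_le_sum this).trans ?_
    simp [mul_assoc]

end Estimates

/-! ### The estimate in `H⁻¹` and solvability in `H¹`. -/

/-- The coefficients of the principal part `∑ (P_j + η_j r) (h ∂_j g - η_j g)` of the weak form. -/
def principalJet (h κ : ℝ) (α β : RSpace n) : Sch n →ₗ[ℂ] Jet n :=
  jetOf fun i => i.elim
    (toL2 ∘ₗ ∑ j, mulS (phaseGrad h κ α β j) ∘ₗ conjDeriv h κ α β j)
    fun j => toL2 ∘ₗ conjDeriv h κ α β j

/-- The derivative is moved from the `H¹` function to the Schwartz function `conjDeriv h κ α β j g`.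
Thus the functional given by `principalJet` is `P g` viewed in `H⁻¹`. -/
theorem pairJ_principalJet {h κ : ℝ} {α β : RSpace n} (g : Sch n) {R : Jet n}
    (hR : R ∈ h1Space n h) :
    pairJ (principalJet h κ α β g) R = pair (toL2 (conjLap h κ α β g)) (R none) := by
  have h1 : ∀ j, pair (toL2 (conjDeriv h κ α β j g)) (R (some j))
      = -pair (toL2 (dh h j (conjDeriv h κ α β j g))) (R none) := by
    intro j
    rw [mem_h1Space.mp hR, neg_neg]
  have h2 : toL2 (conjLap h κ α β g) = ∑ j, (toL2 (mulS (phaseGrad h κ α β j)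
      (conjDeriv h κ α β j g)) - toL2 (dh h j (conjDeriv h κ α β j g))) := by
    rw [conjLap, LinearMap.neg_apply, LinearMap.sum_apply, map_neg, map_sum,
      ← Finset.sum_neg_distrib]
    refine Finset.sum_congr rfl fun j _ => ?_
    rw [← map_sub, ← map_neg]
    congr 1
    rw [LinearMap.comp_apply]
    nth_rewrite 1 [conjDeriv]
    rw [LinearMap.sub_apply, neg_sub]
  rw [pairJ_apply', h2, map_sum, sum_apply]
  simp only [principalJet, jetOf_apply, Option.elim, LinearMap.comp_apply, LinearMap.sum_apply,
    map_sum, sum_apply, h1, map_sub, sub_apply]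
  rw [Finset.sum_neg_distrib, ← sub_eq_add_neg, ← Finset.sum_sub_distrib]

/-- The right side is the semiclassical `H¹` inner product with `g₀`, so `ρ` is an `L²` solution, in
the ball, of the transposed equation with source `(1 - h²Δ)` applied to the conjugate of `g₀`. The
Carleman estimate is the a priori bound behind it. -/
theorem exists_pair_conjLap_eq {h κ R : ℝ} {α β : RSpace n} (H : IsAdmissible h κ R α β)
    (g₀ : Sch n) : ∃ ρ : L2 n, (∀ g ∈ suppS n R, pair ρ (toL2 (conjLap h κ α β g))
      = pairJ (starJ (jet h g₀)) (jet h g)) ∧ ‖ρ‖ ≤ 21 / (h * √κ) * ‖jet h g₀‖ := by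
  have hpos := H.mul_sqrt_pos
  let T : suppS n R →ₗ[ℂ] StrongDual ℂ (L2 n) :=
    pair.toLinearMap ∘ₗ toL2 ∘ₗ conjLap h κ α β ∘ₗ (suppS n R).subtype
  let ℓ : suppS n R →ₗ[ℂ] ℂ :=
    (pairJ (starJ (jet h g₀))).toLinearMap ∘ₗ jet h ∘ₗ (suppS n R).subtype
  obtain ⟨ρ, hρ, hρn⟩ := exists_apply_eq_of_norm_le T ℓ
    (C := 21 / (h * √κ) * ‖jet h g₀‖) (by positivity) (fun g => by
      have h1 : ‖ℓ g‖ ≤ ‖jet h g₀‖ * ‖jet h (g : Sch n)‖ := by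
        rw [← norm_starJ (jet h g₀)]
        exact norm_pairJ_le _ _
      have h2 : ‖T g‖ = ‖toL2 (conjLap h κ α β g)‖ := norm_pair _
      have h3 := carleman_estimate H.h_pos H.κ_pos H.hκ_le H.hκR_le H.le_α H.α_le H.β_le g g.2
      have h4 : ‖jet h (g : Sch n)‖ ≤ 21 / (h * √κ) * ‖toL2 (conjLap h κ α β g)‖ := by
        rw [div_mul_eq_mul_div, le_div_iff₀ hpos, mul_comm]
        exact h3
      rw [h2]
      calc ‖ℓ g‖ ≤ ‖jet h g₀‖ * ‖jet h (g : Sch n)‖ := h1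
        _ ≤ ‖jet h g₀‖ * (21 / (h * √κ) * ‖toL2 (conjLap h κ α β g)‖) := by gcongr
        _ = _ := by ring)
  refine ⟨ρ, fun g hg => ?_, hρn⟩
  have := hρ ⟨g, hg⟩
  rw [pair_comm]
  exact this

/-- A solution in `L²` of the transposed equation, cut off, lies in `H¹`. -/
theorem exists_h1Space_eq_mulB {h κ R k J : ℝ} {α β : RSpace n} {χ : RSpace n → ℂ}
    (H : IsAdmissible h κ (R + 1) α β) (hk : 0 ≤ k) (hχ : IsCutoff χ R k)
    (hχB : MemLp χ ∞ (volume : Measure (RSpace n))) {F : Jet n} (hJ : ‖F‖ = J) {ρ : L2 n}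
    (hρ : ∀ g ∈ suppS n (R + 1), pair ρ (toL2 (conjLap h κ α β g)) = pairJ F (jet h g))
    (hρn : ‖ρ‖ ≤ 21 / (h * √κ) * J) :
    ∃ r ∈ h1Space n h, r none = mulB hχB ρ
      ∧ ‖r‖ ≤ (22 + n * (274 * k + 820)) / (h * √κ) * J := by
  have hpos := H.mul_sqrt_pos
  have hχt := hχ.hasCompactSupport.hasTemperateGrowth hχ.smooth
  have hJ0 : 0 ≤ J := hJ ▸ norm_nonneg _
  refine exists_h1Space_of_helmS (by positivity) _ fun φ => ?_
  -- The first term is the equation of `ρ` tested with `χφ`; the second is the first order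
  -- commutator. Their constants add up as `22 = 1 + 21`, `274 = 1 + 21·13` and `820 = 1 + 21·39`.
  have h1 : pair (mulB hχB ρ) (toL2 (helmS h φ))
      = pair ρ (toL2 (conjLap h κ α β (mulS χ φ)))
        + pair ρ (toL2 (mulS χ (helmS h φ) - conjLap h κ α β (mulS χ φ))) := by
    rw [pair_mulB, mulB_toL2 hχB hχt, ← map_add, ← map_add]
    congr 2
    abel
  have hmem : mulS χ φ ∈ suppS n (R + 1) := fun x hx => by
    rw [mulS_apply hχt, hχ.eq_zero x hx, zero_mul]
  rw [h1, hρ _ hmem]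
  have h2 : ‖pairJ F (jet h (mulS χ φ))‖ ≤ J * ((1 + n * (1 + k)) * ‖jet h φ‖) := by
    refine (norm_pairJ_le _ _).trans ?_
    rw [hJ]
    exact mul_le_mul_of_nonneg_left (norm_jet_mulS_cutoff_le H.h_pos H.h_le hk hχ φ) hJ0
  have h3 : ‖pair ρ (toL2 (mulS χ (helmS h φ) - conjLap h κ α β (mulS χ φ)))‖
      ≤ (21 / (h * √κ) * J) * ((1 + n * (13 * k + 39)) * ‖jet h φ‖) :=
    (norm_pair_le _ _).trans (mul_le_mul hρn (norm_toL2_cutoff_commutator_le H hk hχ φ)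
      (norm_nonneg _) (by positivity))
  refine (norm_add_le _ _).trans ((add_le_add h2 h3).trans ?_)
  generalize ‖jet h φ‖ = N at *
  have hN : 0 ≤ J * ((1 + n * (1 + k)) * N) := (norm_nonneg _).trans h2
  have h4 : J * ((1 + n * (1 + k)) * N) ≤ 1 / (h * √κ) * (J * ((1 + n * (1 + k)) * N)) := by
    refine le_mul_of_one_le_left hN ?_
    rw [le_div_iff₀ hpos, one_mul]
    exact H.mul_sqrt_le
  refine (add_le_add h4 le_rfl).trans (le_of_eq ?_)
  ring

/-- The a priori estimate in `H⁻¹` for the conjugated Laplacian. -/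
theorem norm_jet_le_principal {h κ R k : ℝ} {α β : RSpace n} {χ : RSpace n → ℂ}
    (H : IsAdmissible h κ (R + 1) α β) (hk : 0 ≤ k) (hχ : IsCutoff χ R k) {g : Sch n}
    (hg : g ∈ suppS n R) :
    h * √κ * ‖jet h g‖ ≤ (22 + n * (274 * k + 820)) * ‖dualMap h (principalJet h κ α β) g‖ := by
  have hpos := H.mul_sqrt_pos
  have hχt := hχ.hasCompactSupport.hasTemperateGrowth hχ.smooth
  have hχB : MemLp χ ∞ (volume : Measure (RSpace n)) :=
    memLp_top_of_bound hχ.smooth.continuous.aestronglyMeasurable 1 (.of_forall hχ.norm_le)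
  obtain ⟨ρ, hρ, hρn⟩ := exists_pair_conjLap_eq H g
  obtain ⟨R', hR', hR'0, hR'n⟩ := exists_h1Space_eq_mulB H hk hχ hχB (norm_starJ _) hρ hρn
  have hχg : mulS χ (conjLap h κ α β g) = conjLap h κ α β g := by
    ext x
    rw [mulS_apply hχt]
    rcases le_or_gt ‖x‖ R with hx | hx
    · rw [hχ.eq_one x hx, one_mul]
    · rw [conjLap_mem_suppS hg x hx, mul_zero]
  have hg' : g ∈ suppS n (R + 1) := fun x hx => hg x (by linarith)
  -- The element `χρ` of `H¹` may be tested against `P g`, and `χ` disappears because it equals `1`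
  -- where `P g` lives. Comparing with the bound on `‖χρ‖_{H¹}` and dividing by `‖jet h g‖` gives
  -- the estimate.
  have hpair : dualMap h (principalJet h κ α β) g ⟨R', hR'⟩ = ((‖jet h g‖ ^ 2 : ℝ) : ℂ) := by
    rw [dualMap_apply, pairJ_principalJet g hR', hR'0, pair_comm, pair_mulB,
      mulB_toL2 hχB hχt, hχg, hρ g hg', pairJ_eq_inner]
    have : starJ (starJ (jet h g)) = jet h g := by
      ext1 i
      simp [starJ]
    rw [this, inner_self_eq_norm_sq_to_K]
    push_cast
    rfl
  have hfin := (dualMap h (principalJet h κ α β) g).le_opNorm ⟨R', hR'⟩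
  rw [hpair, Complex.norm_real, Real.norm_eq_abs, abs_of_nonneg (by positivity)] at hfin
  change _ ≤ _ * ‖R'‖ at hfin
  have hD0 : 0 ≤ ‖dualMap h (principalJet h κ α β) g‖ :=
    ContinuousLinearMap.opNorm_nonneg _
  have hJ0 : 0 ≤ ‖jet h g‖ := norm_nonneg _
  generalize ‖dualMap h (principalJet h κ α β) g‖ = D at *
  generalize ‖jet h g‖ = J at *
  have hK : 0 ≤ 22 + n * (274 * k + 820) := by positivity
  generalize 22 + n * (274 * k + 820) = K at *
  have h5 : J ^ 2 ≤ D * (K / (h * √κ) * J) := hfin.trans (mul_le_mul_of_nonneg_left hR'n hD0)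
  rcases eq_or_lt_of_le hJ0 with h0 | h0
  · rw [← h0, mul_zero]
    positivity
  · have h6 : J ≤ D * (K / (h * √κ)) := by
      refine le_of_mul_le_mul_right ?_ h0
      calc J * J = J ^ 2 := (sq J).symm
        _ ≤ _ := h5
        _ = _ := by ring
    calc h * √κ * J ≤ h * √κ * (D * (K / (h * √κ))) := by gcongr
      _ = K * D := by
        generalize h * √κ = q at *
        field_simp

/-- The coefficients of the first order part of the weak form (divided by `h`). -/
def lowerJet (h κ : ℝ) (α β : RSpace n) {A : Fin n → RSpace n → ℂ} {V : RSpace n → ℂ}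
    (hA : ∀ j, MemLp (A j) ∞ volume) (hV : MemLp V ∞ volume) : Sch n →ₗ[ℂ] Jet n :=
  jetOf fun i => i.elim
    ((∑ j, (mulB (hA j)).toLinearMap ∘ₗ toL2 ∘ₗ (Complex.I • conjDeriv h κ α β j
      - Complex.I • mulS (phaseGrad h κ α β j)))
      + (h : ℂ) • (mulB hV).toLinearMap ∘ₗ toL2)
    fun j => (mulB (hA j)).toLinearMap ∘ₗ toL2 ∘ₗ (-Complex.I • LinearMap.id)

theorem norm_lowerJet_le {h κ R a b : ℝ} {α β : RSpace n} (H : IsAdmissible h κ R α β)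
    {A : Fin n → RSpace n → ℂ} {V : RSpace n → ℂ} (hA : ∀ j, MemLp (A j) ∞ volume)
    (hV : MemLp V ∞ volume) (ha : 0 ≤ a) (hAa : ∀ j, ∀ᵐ x, ‖A j x‖ ≤ a) (hb : 0 ≤ b)
    (hVb : ∀ᵐ x, ‖V x‖ ≤ b) {g : Sch n} (hg : g ∈ suppS n R) :
    ‖lowerJet h κ α β hA hV g‖ ≤ (12 * n * a + b) * ‖jet h g‖ := by
  have hη : ∀ j, ‖toL2 (mulS (phaseGrad h κ α β j) g)‖ ≤ 5 * ‖jet h g‖ := by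
    intro j
    refine (norm_toL2_le_mul (g := g) (c := 5) fun x => ?_).trans
      (mul_le_mul_of_nonneg_left (norm_toL2_le_jet h g) (by norm_num))
    rw [mulS_apply (hasTemperateGrowth_phaseGrad h κ α β j), norm_mul]
    rcases le_or_gt ‖x‖ R with hx | hx
    · gcongr
      exact norm_phaseGrad_le H.h_pos H.κ_pos H.hκR_le H.α_le H.β_le j hx
    · simp [hg x hx]
  have hY : ∀ j, ‖toL2 (conjDeriv h κ α β j g)‖ ≤ 6 * ‖jet h g‖ := by
    intro j
    rw [conjDeriv, LinearMap.sub_apply, map_sub]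
    refine (norm_sub_le _ _).trans ?_
    linarith [hη j, norm_toL2_dh_le_jet h g j]
  have h0 : ∀ j, ‖mulB (hA j) (toL2 ((Complex.I • conjDeriv h κ α β j
      - Complex.I • mulS (phaseGrad h κ α β j)) g))‖ ≤ a * (11 * ‖jet h g‖) := by
    intro j
    refine (norm_mulB_le (hA j) (hAa j) _).trans (mul_le_mul_of_nonneg_left ?_ ha)
    rw [LinearMap.sub_apply, LinearMap.smul_apply, LinearMap.smul_apply, map_sub, map_smul,
      map_smul]
    refine (norm_sub_le _ _).trans ?_
    rw [norm_smul, norm_smul, Complex.norm_I, one_mul, one_mul]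
    linarith [hη j, hY j]
  have h1 : ‖lowerJet h κ α β hA hV g none‖ ≤ n * (a * (11 * ‖jet h g‖)) + b * ‖jet h g‖ := by
    simp only [lowerJet, jetOf_apply, Option.elim, LinearMap.add_apply, LinearMap.sum_apply,
      LinearMap.comp_apply, LinearMap.smul_apply]
    refine (norm_add_le _ _).trans (add_le_add ((norm_sum_le _ _).trans ?_) ?_)
    · refine (Finset.sum_le_sum fun j _ => h0 j).trans ?_
      simp
    · rw [norm_smul, Complex.norm_real, Real.norm_eq_abs, abs_of_pos H.h_pos]
      have h2 := norm_mulB_le hV hVb (toL2 g)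
      have h3 := mul_le_mul_of_nonneg_left (norm_toL2_le_jet h g) hb
      calc h * _ ≤ 1 * (b * ‖jet h g‖) :=
            mul_le_mul H.h_le (h2.trans h3) (norm_nonneg _) (by norm_num)
        _ = _ := one_mul _
  have h2 : ∀ j, ‖lowerJet h κ α β hA hV g (some j)‖ ≤ a * ‖jet h g‖ := by
    intro j
    simp only [lowerJet, jetOf_apply, Option.elim, LinearMap.comp_apply, LinearMap.smul_apply,
      LinearMap.id_apply]
    refine (norm_mulB_le (hA j) (hAa j) _).trans (mul_le_mul_of_nonneg_left ?_ ha)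
    rw [map_smul, norm_smul, norm_neg, Complex.norm_I, one_mul]
    exact norm_toL2_le_jet h g
  refine (norm_jet_le_sum _).trans ?_
  have h3 : ∑ j, ‖lowerJet h κ α β hA hV g (some j)‖ ≤ n * (a * ‖jet h g‖) := by
    refine (Finset.sum_le_sum fun j _ => h2 j).trans ?_
    simp
  linarith

/-- A first order perturbation costs a multiple of `h`, to be compared with the factor `h√κ` of the
Carleman estimate. -/
theorem norm_dualMap_le_add {V : Type*} [AddCommGroup V] [Module ℂ V] (h : ℝ) (hh : 0 ≤ h)
    (C W : V →ₗ[ℂ] Jet n) (g : V) :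
    ‖dualMap h C g‖ ≤ ‖dualMap h (C + (h : ℂ) • W) g‖ + h * ‖W g‖ := by
  refine ContinuousLinearMap.opNorm_le_bound _
    (add_nonneg (ContinuousLinearMap.opNorm_nonneg _) (by positivity)) fun r => ?_
  have h1 : dualMap h C g r = dualMap h (C + (h : ℂ) • W) g r - (h : ℂ) * pairJ (W g) r := by
    rw [dualMap_apply, dualMap_apply, LinearMap.add_apply, LinearMap.smul_apply, map_add,
      map_smul, add_apply, smul_apply, smul_eq_mul, add_sub_cancel_right]
  have h2 : ‖(h : ℂ) * pairJ (W g) (r : Jet n)‖ ≤ h * (‖W g‖ * ‖(r : Jet n)‖) := by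
    rw [norm_mul, Complex.norm_real, Real.norm_eq_abs, abs_of_nonneg hh]
    exact mul_le_mul_of_nonneg_left (norm_pairJ_le _ _) hh
  have h3 := (dualMap h (C + (h : ℂ) • W) g).le_opNorm r
  rw [h1]
  refine (norm_sub_le _ _).trans ((add_le_add h3 h2).trans (le_of_eq ?_))
  rw [add_mul, mul_assoc]
  rfl

/-- Solvability of the conjugated magnetic Schrödinger equation in `H¹`. -/
theorem exists_h1Space_pairJ_eq (n : ℕ) {R a b : ℝ} (hR : 0 < R) (ha : 0 ≤ a) (hb : 0 ≤ b) :
    ∃ κ > 0, ∃ h₀ > 0, ∃ K : ℝ, 0 ≤ K ∧ ∀ (h : ℝ) (α β : RSpace n), 0 < h → h < h₀ →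
      1 / 2 ≤ ‖α‖ → ‖α‖ ≤ 2 → ‖β‖ ≤ 2 →
      IsAdmissible h κ (R + 1) α β ∧
      ∀ (A : Fin n → RSpace n → ℂ) (V : RSpace n → ℂ) (hA : ∀ j, MemLp (A j) ∞ volume)
        (hV : MemLp V ∞ volume), (∀ j, ∀ᵐ x, ‖A j x‖ ≤ a) → (∀ᵐ x, ‖V x‖ ≤ b) →
        ∀ P : Submodule ℂ (Sch n), P ≤ suppS n R → ∀ (ℓ : P →ₗ[ℂ] ℂ) (L : ℝ), 0 ≤ L →
          (∀ g : P, ‖ℓ g‖ ≤ L * ‖jet h (g : Sch n)‖) →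
          ∃ r ∈ h1Space n h, (∀ g : P, pairJ ((principalJet h κ α β
            + (h : ℂ) • lowerJet h κ α β hA hV) (g : Sch n)) r = ℓ g) ∧ ‖r‖ ≤ K / h * L := by
  obtain ⟨χ, k, hk, hχ⟩ := exists_isCutoff n hR
  set C₂ : ℝ := 22 + n * (274 * k + 820) with hC₂
  set C₃ : ℝ := 12 * n * a + b with hC₃
  have hC₂p : 0 < C₂ := by positivity
  have hC₃p : 0 ≤ C₃ := by positivity
  -- The lower order part contributes `h C₂ C₃ ‖jet h g‖`, which `h√κ ‖jet h g‖` with `√κ = 2 C₂ C₃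
  -- + 1` absorbs. Neither `κ` nor the constants depend on `h`.
  set κ : ℝ := (2 * C₂ * C₃ + 1) ^ 2 with hκ
  have hκp : 0 < κ := by positivity
  have hκs : √κ = 2 * C₂ * C₃ + 1 := Real.sqrt_sq (by positivity)
  -- The three bounds give `h ≤ 1`, `h²κ ≤ 1` and `hκ·2(R + 1) ≤ 1/2`. The radius is `R + 1` to
  -- leave room for the cut-off.
  refine ⟨κ, hκp, min 1 (min (1 / (κ + 1)) (1 / (4 * κ * (R + 1)))), by positivity, 2 * C₂,
    by positivity, fun h α β hh hh₀ hα hα' hβ => ?_⟩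
  have hh1 : h ≤ 1 := hh₀.le.trans (min_le_left _ _)
  have hh2 : h ≤ 1 / (κ + 1) := hh₀.le.trans ((min_le_right _ _).trans (min_le_left _ _))
  have hh3 : h ≤ 1 / (4 * κ * (R + 1)) := hh₀.le.trans ((min_le_right _ _).trans (min_le_right _ _))
  have H : IsAdmissible h κ (R + 1) α β := by
    refine ⟨hh, hh1, hκp, ?_, ?_, hα, hα', hβ⟩
    · rw [le_div_iff₀ (by positivity)] at hh2
      nlinarith
    · rw [le_div_iff₀ (by positivity)] at hh3
      linarith
  refine ⟨H, fun A V hA hV hAa hVb P hP ℓ L hL hℓ => ?_⟩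
  set C := principalJet h κ α β + (h : ℂ) • lowerJet h κ α β hA hV with hC
  have hap : ∀ g : P, ‖jet h (g : Sch n)‖ ≤ 2 * C₂ / h * ‖dualMap h C g‖ := by
    intro g
    have h1 := norm_jet_le_principal H hk hχ (hP g.2)
    have hg' : (g : Sch n) ∈ suppS n (R + 1) := fun x hx => hP g.2 x (by linarith)
    have h2 := norm_lowerJet_le H hA hV ha hAa hb hVb hg'
    rw [← hC₂] at h1
    rw [← hC₃] at h2
    have h3 : ‖dualMap h (principalJet h κ α β) g‖ ≤ ‖dualMap h C g‖ + h * (C₃ * ‖jet h (g : Sch n)‖) := by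
      refine (norm_dualMap_le_add h hh.le _ (lowerJet h κ α β hA hV) _).trans ?_
      exact add_le_add le_rfl (mul_le_mul_of_nonneg_left h2 hh.le)
    have h5 : h * √κ * ‖jet h (g : Sch n)‖
        ≤ C₂ * (‖dualMap h C g‖ + h * (C₃ * ‖jet h (g : Sch n)‖)) :=
      h1.trans (mul_le_mul_of_nonneg_left h3 hC₂p.le)
    rw [hκs] at h5
    rw [div_mul_eq_mul_div, le_div_iff₀ hh]
    have h6 : 0 ≤ h * (C₂ * C₃ * ‖jet h (g : Sch n)‖) := by positivity
    have h8 : 0 ≤ C₂ * ‖dualMap h C (g : Sch n)‖ :=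
      mul_nonneg hC₂p.le (ContinuousLinearMap.opNorm_nonneg _)
    linarith
  obtain ⟨r, hr, hrn⟩ := exists_apply_eq_of_norm_le (dualMap h C ∘ₗ P.subtype) ℓ
    (C := 2 * C₂ / h * L) (by positivity) (fun g => by
      calc ‖ℓ g‖ ≤ L * ‖jet h (g : Sch n)‖ := hℓ g
        _ ≤ L * (2 * C₂ / h * ‖dualMap h C g‖) := mul_le_mul_of_nonneg_left (hap g) hL
        _ = _ := by rw [LinearMap.comp_apply, Submodule.subtype_apply]; ring)
  exact ⟨r, r.2, hr, hrn⟩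

/-! ### Convolution and mollification. -/

/-- The convolution `∫ g(t) F(x - t) dt` of complex valued functions. -/
def conv (g F : RSpace n → ℂ) : RSpace n → ℂ :=
  convolution g F (ContinuousLinearMap.mul ℝ ℂ) volume

theorem conv_apply (g F : RSpace n → ℂ) (x : RSpace n) : conv g F x = ∫ t, g t * F (x - t) := rfl

theorem contDiff_conv {g F : RSpace n → ℂ} (hg : ContDiff ℝ ∞ g) (hgc : HasCompactSupport g)
    (hF : Continuous F) : ContDiff ℝ ∞ (conv g F) :=
  hgc.contDiff_convolution_left _ hg hF.locallyIntegrable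

theorem partialDeriv_conv {g F : RSpace n → ℂ} (hg : ContDiff ℝ ∞ g) (hgc : HasCompactSupport g)
    (hF : Continuous F) (j : Fin n) : partialDeriv j (conv g F) = conv (partialDeriv j g) F := by
  ext x
  have h1 := hgc.hasFDerivAt_convolution_left (ContinuousLinearMap.mul ℝ ℂ)
    (hg.of_le (by norm_num)) (hF.locallyIntegrable (μ := volume)) x
  rw [partialDeriv, conv, h1.fderiv, convolution, ContinuousLinearMap.integral_apply]
  · rfl
  · exact (hgc.fderiv ℝ).convolutionExists_left _ (hg.continuous_fderiv (by norm_num))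
      hF.locallyIntegrable x

theorem norm_conv_le {g F : RSpace n → ℂ} (hg : Continuous g) (hgc : HasCompactSupport g) {M : ℝ}
    (hF : ∀ x, ‖F x‖ ≤ M) (x : RSpace n) : ‖conv g F x‖ ≤ M * ∫ t, ‖g t‖ := by
  rw [conv_apply, ← integral_const_mul]
  refine norm_integral_le_of_norm_le ((hg.integrable_of_hasCompactSupport hgc).norm.const_mul M)
    (.of_forall fun t => ?_)
  rw [norm_mul, mul_comm]
  exact mul_le_mul_of_nonneg_right (hF _) (norm_nonneg _)

/-- The iterated partial derivative along a list of coordinates. -/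
def listDeriv (l : List (Fin n)) (f : RSpace n → ℂ) : RSpace n → ℂ := l.foldr partialDeriv f

@[simp] theorem listDeriv_nil (f : RSpace n → ℂ) : listDeriv [] f = f := rfl

@[simp] theorem listDeriv_cons (j : Fin n) (l : List (Fin n)) (f : RSpace n → ℂ) :
    listDeriv (j :: l) f = partialDeriv j (listDeriv l f) := rfl

theorem contDiff_listDeriv {f : RSpace n → ℂ} (hf : ContDiff ℝ ∞ f) (l : List (Fin n)) :
    ContDiff ℝ ∞ (listDeriv l f) := by
  induction l with
  | nil => exact hf
  | cons j l ih => exact contDiff_partialDeriv ih j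

theorem hasCompactSupport_listDeriv {f : RSpace n → ℂ} (hf : HasCompactSupport f)
    (l : List (Fin n)) : HasCompactSupport (listDeriv l f) := by
  induction l with
  | nil => exact hf
  | cons j l ih => exact hasCompactSupport_partialDeriv ih j

/-- Lists of coordinates suit induction; their length is the order of the derivative, hence the
power of the mollification scale. -/
theorem multiDeriv_eq_listDeriv (α : Fin n → ℕ) :
    ∃ l : List (Fin n), l.length = ∑ j, α j ∧ ∀ f, multiDeriv α f = listDeriv l f := by
  refine ⟨(List.finRange n).flatMap fun j => List.replicate (α j) j, ?_, fun f => ?_⟩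
  · rw [List.length_flatMap]
    simp [Fin.sum_univ_def]
  · rw [multiDeriv, listDeriv]
    induction List.finRange n with
    | nil => rfl
    | cons j l ih =>
      rw [List.flatMap_cons, List.foldr_append, List.foldr_cons, ih]
      generalize List.foldr partialDeriv f _ = g
      induction α j with
      | zero => rfl
      | succ m ihm => rw [Function.iterate_succ_apply', List.replicate_succ, List.foldr_cons, ihm]

theorem listDeriv_conv {g F : RSpace n → ℂ} (hg : ContDiff ℝ ∞ g) (hgc : HasCompactSupport g)
    (hF : Continuous F) (l : List (Fin n)) : listDeriv l (conv g F) = conv (listDeriv l g) F := by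
  induction l with
  | nil => rfl
  | cons j l ih =>
    rw [listDeriv_cons, ih, partialDeriv_conv (contDiff_listDeriv hg l)
      (hasCompactSupport_listDeriv hgc l) hF, listDeriv_cons]

theorem partialDeriv_comp_smul (j : Fin n) (f : RSpace n → ℂ) (c : ℝ) :
    partialDeriv j (fun x => f (c • x)) = fun x => c • partialDeriv j f (c • x) := by
  ext x
  rw [partialDeriv, fderiv_comp_smul]
  rfl

theorem partialDeriv_const_smul (j : Fin n) {f : RSpace n → ℂ} (hf : Differentiable ℝ f) (c : ℝ) :
    partialDeriv j (fun x => c • f x) = fun x => c • partialDeriv j f x := by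
  ext x
  rw [partialDeriv, fderiv_fun_const_smul (hf x)]
  rfl

theorem listDeriv_comp_smul {f : RSpace n → ℂ} (hf : ContDiff ℝ ∞ f) (c : ℝ) (l : List (Fin n)) :
    listDeriv l (fun x => f (c • x)) = fun x => c ^ l.length • listDeriv l f (c • x) := by
  induction l with
  | nil => simp
  | cons j l ih =>
    have h1 := contDiff_listDeriv hf l
    rw [listDeriv_cons, ih, partialDeriv_const_smul j (f := fun x => listDeriv l f (c • x))
      ((h1.differentiable (by norm_num)).comp (differentiable_id.const_smul c)),
      partialDeriv_comp_smul]
    ext x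
    rw [listDeriv_cons, smul_smul, List.length_cons, pow_succ]

/-- A fixed smooth bump function of integral one, supported in the unit ball. -/
def bump (n : ℕ) (x : RSpace n) : ℂ :=
  (((⟨1 / 2, 1, by norm_num, by norm_num⟩ : ContDiffBump (0 : RSpace n)).normed volume x : ℝ) : ℂ)

theorem contDiff_bump : ContDiff ℝ ∞ (bump n) :=
  Complex.ofRealCLM.contDiff.comp (ContDiffBump.contDiff_normed _)

theorem hasCompactSupport_bump : HasCompactSupport (bump n) :=
  (ContDiffBump.hasCompactSupport_normed _).comp_left (g := fun t : ℝ => (t : ℂ)) (by simp)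

theorem integral_bump : ∫ x, bump n x = 1 := by
  unfold bump
  rw [integral_complex_ofReal, ContDiffBump.integral_normed, Complex.ofReal_one]

theorem bump_eq_zero {x : RSpace n} (hx : 1 ≤ ‖x‖) : bump n x = 0 := by
  unfold bump
  rw [Complex.ofReal_eq_zero, ← Function.notMem_support, ContDiffBump.support_normed_eq]
  simpa using hx

/-- The mollification of `F` at scale `δ`. -/
def mollify (δ : ℝ) (F : RSpace n → ℂ) (x : RSpace n) : ℂ :=
  conv (bump n) (fun y => F (δ • y)) (δ⁻¹ • x)

theorem contDiff_mollify (δ : ℝ) {F : RSpace n → ℂ} (hF : Continuous F) :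
    ContDiff ℝ ∞ (mollify δ F) :=
  (contDiff_conv contDiff_bump hasCompactSupport_bump (hF.comp (continuous_const_smul δ))).comp
    (contDiff_const_smul δ⁻¹)

/-- The rescaled form of `mollify` puts every derivative on the fixed bump and releases one factor
`δ⁻¹` for each; only the sup norm of `F` enters. -/
theorem norm_listDeriv_mollify_le {δ M : ℝ} (hδ : 0 < δ) {F : RSpace n → ℂ} (hF : Continuous F)
    (hM : ∀ x, ‖F x‖ ≤ M) (l : List (Fin n)) (x : RSpace n) :
    ‖listDeriv l (mollify δ F) x‖ ≤ (M * ∫ t, ‖listDeriv l (bump n) t‖) * δ⁻¹ ^ l.length := by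
  have hF' : Continuous fun y => F (δ • y) := hF.comp (continuous_const_smul δ)
  have h1 : mollify δ F = fun x => conv (bump n) (fun y => F (δ • y)) (δ⁻¹ • x) := rfl
  rw [h1, listDeriv_comp_smul (contDiff_conv contDiff_bump hasCompactSupport_bump hF'),
    listDeriv_conv contDiff_bump hasCompactSupport_bump hF', norm_smul, norm_pow, norm_inv,
    Real.norm_eq_abs, abs_of_pos hδ, mul_comm]
  gcongr
  exact norm_conv_le (contDiff_listDeriv contDiff_bump l).continuous
    (hasCompactSupport_listDeriv hasCompactSupport_bump l) (fun y => hM _) _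

theorem norm_mollify_sub_le {δ ε : ℝ} (hδ : 0 < δ) {F : RSpace n → ℂ} (hF : Continuous F)
    (hε : ∀ x y, ‖x - y‖ ≤ δ → ‖F x - F y‖ ≤ ε) (x : RSpace n) :
    ‖mollify δ F x - F x‖ ≤ ε * ∫ t, ‖bump n t‖ := by
  have hb : Continuous (bump n) := contDiff_bump.continuous
  have hF' : Continuous fun t : RSpace n => F (δ • (δ⁻¹ • x - t)) := by fun_prop
  have hi1 : Integrable fun t : RSpace n => bump n t * F (δ • (δ⁻¹ • x - t)) :=
    (hb.mul hF').integrable_of_hasCompactSupport hasCompactSupport_bump.mul_right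
  have hi2 : Integrable fun t : RSpace n => bump n t * F x :=
    (hb.mul continuous_const).integrable_of_hasCompactSupport hasCompactSupport_bump.mul_right
  have h1 : mollify δ F x - F x
      = ∫ t, (bump n t * F (δ • (δ⁻¹ • x - t)) - bump n t * F x) := by
    rw [integral_sub hi1 hi2, integral_mul_const, integral_bump, one_mul]
    rfl
  rw [h1, ← integral_const_mul]
  refine norm_integral_le_of_norm_le
    ((hb.integrable_of_hasCompactSupport hasCompactSupport_bump).norm.const_mul ε)
    (.of_forall fun t => ?_)
  rw [← mul_sub, norm_mul, mul_comm]
  rcases le_or_gt 1 ‖t‖ with ht | ht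
  · rw [bump_eq_zero ht, norm_zero, mul_zero, mul_zero]
  · refine mul_le_mul_of_nonneg_right (hε _ _ ?_) (norm_nonneg _)
    have : δ • (δ⁻¹ • x - t) - x = -(δ • t) := by
      rw [smul_sub, smul_smul, mul_inv_cancel₀ hδ.ne', one_smul]
      abel
    rw [this, norm_neg, norm_smul, Real.norm_eq_abs, abs_of_pos hδ]
    nlinarith

theorem tendstoUniformly_mollify {F : RSpace n → ℂ} (hF : UniformContinuous F) :
    TendstoUniformly (fun δ => mollify δ F) F (𝓝[>] (0 : ℝ)) := by
  rw [Metric.tendstoUniformly_iff]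
  intro ε hε
  set I := ∫ t, ‖bump n t‖
  have hI : 0 ≤ I := by positivity
  obtain ⟨d, hd, hd'⟩ := Metric.uniformContinuous_iff.mp hF (ε / (I + 1)) (by positivity)
  filter_upwards [Ioo_mem_nhdsGT hd] with δ hδ x
  rw [dist_comm, dist_eq_norm]
  refine (norm_mollify_sub_le hδ.1 hF.continuous (ε := ε / (I + 1)) (fun x y hxy => ?_) x).trans_lt ?_
  · rw [← dist_eq_norm]
    exact (hd' (by rw [dist_eq_norm]; exact hxy.trans_lt hδ.2)).le
  · rw [div_mul_eq_mul_div, div_lt_iff₀ (by positivity)]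
    nlinarith

/-! ### The Cauchy kernel and the Cauchy–Pompeiu formula. -/

/-- The Cauchy kernel `1 / (y₁ + i y₂)` on the plane. -/
def cauchyKernel (y : ℝ × ℝ) : ℂ := ((y.1 : ℂ) + Complex.I * (y.2 : ℂ))⁻¹

theorem measurable_cauchyKernel : Measurable cauchyKernel := by
  unfold cauchyKernel
  fun_prop

theorem norm_cauchyKernel_le (y : ℝ × ℝ) : ‖cauchyKernel y‖ ≤ ‖y‖⁻¹ := by
  rcases eq_or_ne y 0 with rfl | hy
  · simp [cauchyKernel]
  · rw [cauchyKernel, norm_inv]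
    refine inv_anti₀ (norm_pos_iff.mpr hy) ?_
    rw [Prod.norm_def, Real.norm_eq_abs, Real.norm_eq_abs]
    have h1 := Complex.abs_re_le_norm ((y.1 : ℂ) + Complex.I * (y.2 : ℂ))
    have h2 := Complex.abs_im_le_norm ((y.1 : ℂ) + Complex.I * (y.2 : ℂ))
    simp only [Complex.add_re, Complex.ofReal_re, Complex.mul_re, Complex.I_re, zero_mul,
      Complex.I_im, Complex.ofReal_im, mul_zero, sub_zero, add_zero, Complex.add_im,
      Complex.mul_im, one_mul, zero_add] at h1 h2
    exact max_le h1 h2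

/-- The majorant `‖y‖⁻¹` is radial, and in dimension two the radial measure `r dr` cancels its
singularity. -/
theorem integrableOn_cauchyKernel (R : ℝ) :
    IntegrableOn cauchyKernel (Metric.closedBall 0 R) := by
  have h1 : IntegrableOn (fun y : ℝ × ℝ => ‖y‖⁻¹) (Metric.closedBall 0 R) := by
    rw [← integrable_indicator_iff Metric.isClosed_closedBall.measurableSet]
    have h2 : (Metric.closedBall (0 : ℝ × ℝ) R).indicator (fun y : ℝ × ℝ => ‖y‖⁻¹)
        = fun y => (fun r : ℝ => (Set.Iic R).indicator (fun r => r⁻¹) r) ‖y‖ := by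
      ext y
      simp [Set.indicator]
    rw [h2, integrable_fun_norm_addHaar (volume : Measure (ℝ × ℝ))
      (f := fun r : ℝ => (Set.Iic R).indicator (fun r => r⁻¹) r)]
    have h3 : IntegrableOn (fun _ : ℝ => (1 : ℝ)) (Set.Ioc 0 R) := by simp
    rw [← integrable_indicator_iff measurableSet_Ioc] at h3
    refine (h3.integrableOn (s := Set.Ioi 0)).congr_fun (fun r hr => ?_) measurableSet_Ioi
    have hr' : (0 : ℝ) < r := hr
    by_cases hrR : r ≤ R
    · simp [Set.indicator, hr', hrR, hr'.ne']
    · simp [Set.indicator, hrR]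
  refine Integrable.mono' h1 measurable_cauchyKernel.aestronglyMeasurable
    (.of_forall norm_cauchyKernel_le)

/-- The Cauchy transform at a point, of functions supported in balls of a fixed radius. -/
theorem exists_norm_integral_cauchyKernel_le (R : ℝ) : ∃ C : ℝ, 0 ≤ C ∧
    ∀ (y₀ : ℝ × ℝ) (u : ℝ × ℝ → ℂ) (M : ℝ), Continuous u → 0 ≤ M →
      (∀ y, R < ‖y - y₀‖ → u y = 0) → (∀ y, ‖u y‖ ≤ M) →
      Integrable (fun y => u y * cauchyKernel y) ∧ ‖∫ y, u y * cauchyKernel y‖ ≤ C * M := by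
  set k₁ : ℝ × ℝ → ℝ := (Metric.closedBall (0 : ℝ × ℝ) 1).indicator fun y => ‖cauchyKernel y‖
  have hk₁ : Integrable k₁ := (integrable_indicator_iff Metric.isClosed_closedBall.measurableSet).mpr
    (integrableOn_cauchyKernel 1).norm
  set V : ℝ := volume.real (Metric.closedBall (0 : ℝ × ℝ) R)
  refine ⟨(∫ y, k₁ y) + V, add_nonneg (integral_nonneg fun y =>
    Set.indicator_nonneg (fun _ _ => norm_nonneg _) y) measureReal_nonneg,
    fun y₀ u M hu hM hsupp hbd => ?_⟩
  set k₂ : ℝ × ℝ → ℝ := (Metric.closedBall y₀ R).indicator fun _ => 1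
  have hk₂ : Integrable k₂ := (integrable_indicator_iff
    Metric.isClosed_closedBall.measurableSet).mpr (integrableOn_const measure_closedBall_lt_top.ne (by simp))
  have hV : ∫ y, k₂ y = V := by
    rw [integral_indicator Metric.isClosed_closedBall.measurableSet]
    simp only [integral_const, smul_eq_mul, mul_one, MeasurableSet.univ, measureReal_restrict_apply,
      Set.univ_inter]
    rw [measureReal_def, Measure.addHaar_closedBall_center]
    rfl
  -- In the unit ball the kernel is its own majorant. Outside it is at most `1`, and only the volume
  -- of the support counts, which does not depend on the centre `y₀`.
  have hle : ∀ y, ‖u y * cauchyKernel y‖ ≤ M * (k₁ y + k₂ y) := by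
    intro y
    rw [norm_mul]
    have h1 : 0 ≤ k₁ y := Set.indicator_nonneg (fun _ _ => norm_nonneg _) y
    have h2 : 0 ≤ k₂ y := Set.indicator_nonneg (fun _ _ => zero_le_one) y
    by_cases hy : R < ‖y - y₀‖
    · rw [hsupp y hy, norm_zero, zero_mul]
      positivity
    · have h3 : k₂ y = 1 := Set.indicator_of_mem (by simpa [dist_eq_norm] using hy) _
      refine mul_le_mul (hbd y) ?_ (norm_nonneg _) hM
      by_cases hy1 : ‖y‖ ≤ 1
      · have h4 : k₁ y = ‖cauchyKernel y‖ := Set.indicator_of_mem (by simpa using hy1) _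
        linarith
      · have h5 : ‖cauchyKernel y‖ ≤ 1 := (norm_cauchyKernel_le y).trans
          (inv_le_one_of_one_le₀ (not_le.mp hy1).le)
        linarith
  have hint : Integrable fun y => M * (k₁ y + k₂ y) := (hk₁.add hk₂).const_mul M
  refine ⟨hint.mono' (hu.aestronglyMeasurable.mul measurable_cauchyKernel.aestronglyMeasurable)
    (.of_forall hle), (norm_integral_le_of_norm_le hint (.of_forall hle)).trans (le_of_eq ?_)⟩
  rw [integral_const_mul, integral_add hk₁ hk₂, hV, mul_comm]

section CauchyPompeiu

variable {G : ℝ × ℝ → ℂ}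

theorem hasDerivAt_comp_polar_radius (hG : ContDiff ℝ 1 G) (r θ : ℝ) :
    HasDerivAt (fun r => G (r * Real.cos θ, r * Real.sin θ))
      (Real.cos θ * fderiv ℝ G (r * Real.cos θ, r * Real.sin θ) (1, 0)
        + Real.sin θ * fderiv ℝ G (r * Real.cos θ, r * Real.sin θ) (0, 1)) r := by
  have h1 : HasDerivAt (fun r : ℝ => (r * Real.cos θ, r * Real.sin θ))
      (Real.cos θ, Real.sin θ) r := by
    simpa using ((hasDerivAt_id r).mul_const (Real.cos θ)).prodMk
      ((hasDerivAt_id r).mul_const (Real.sin θ))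
  have h2 := ((hG.differentiable (by norm_num) _).hasFDerivAt).comp_hasDerivAt r h1
  have h3 : ((Real.cos θ, Real.sin θ) : ℝ × ℝ)
      = Real.cos θ • ((1, 0) : ℝ × ℝ) + Real.sin θ • ((0, 1) : ℝ × ℝ) := by simp
  rw [h3, map_add, map_smul, map_smul, Complex.real_smul, Complex.real_smul] at h2
  exact h2

theorem hasDerivAt_comp_polar_angle (hG : ContDiff ℝ 1 G) (r θ : ℝ) :
    HasDerivAt (fun θ => G (r * Real.cos θ, r * Real.sin θ))
      (r * (Real.cos θ * fderiv ℝ G (r * Real.cos θ, r * Real.sin θ) (0, 1)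
        - Real.sin θ * fderiv ℝ G (r * Real.cos θ, r * Real.sin θ) (1, 0))) θ := by
  have h1 : HasDerivAt (fun θ : ℝ => (r * Real.cos θ, r * Real.sin θ))
      (r * -Real.sin θ, r * Real.cos θ) θ :=
    ((Real.hasDerivAt_cos θ).const_mul r).prodMk ((Real.hasDerivAt_sin θ).const_mul r)
  have h2 := ((hG.differentiable (by norm_num) _).hasFDerivAt).comp_hasDerivAt θ h1
  have h3 : ((r * -Real.sin θ, r * Real.cos θ) : ℝ × ℝ)
      = (r * -Real.sin θ) • ((1, 0) : ℝ × ℝ) + (r * Real.cos θ) • ((0, 1) : ℝ × ℝ) := by simp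
  rw [h3, map_add, map_smul, map_smul, Complex.real_smul, Complex.real_smul] at h2
  refine h2.congr_deriv ?_
  push_cast
  ring

/-- The Cauchy–Pompeiu formula for compactly supported functions on the plane. -/
theorem integral_dbar_mul_cauchyKernel (hG : ContDiff ℝ 1 G) (hGc : HasCompactSupport G) :
    ∫ y, (fderiv ℝ G y (1, 0) + Complex.I * fderiv ℝ G y (0, 1)) * cauchyKernel y
      = -(2 * Real.pi) * G 0 := by
  obtain ⟨R, hR⟩ : ∃ R, ∀ y, R < ‖y‖ → G y = 0 := by
    obtain ⟨R, hR⟩ := hGc.isCompact.isBounded.subset_closedBall 0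
    exact ⟨R, fun y hy => image_eq_zero_of_notMem_tsupport fun h => by
      have := hR h
      rw [mem_closedBall_zero_iff] at this
      linarith⟩
  have hR' : ∀ y v, R < ‖y‖ → fderiv ℝ G y v = 0 := by
    intro y v hy
    have h1 : G =ᶠ[𝓝 y] fun _ => 0 := by
      filter_upwards [(isOpen_lt continuous_const continuous_norm).mem_nhds hy] with z hz
      exact hR z hz
    rw [h1.fderiv_eq]
    simp
  -- The norm on `ℝ × ℝ` is the maximum norm; `|cos θ| + |sin θ| ≥ 1` makes it at least `|r|/2`.
  have hpolar : ∀ r θ : ℝ, 2 * R < |r| → R < ‖((r * Real.cos θ, r * Real.sin θ) : ℝ × ℝ)‖ := by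
    intro r θ hr
    rw [Prod.norm_def, Real.norm_eq_abs, Real.norm_eq_abs, abs_mul, abs_mul, lt_max_iff]
    by_contra! hcon
    have h1 := Real.cos_sq_add_sin_sq θ
    have h3 : |r| ≤ |r| * |Real.cos θ| + |r| * |Real.sin θ| := by
      rw [← mul_add]
      refine le_mul_of_one_le_right (abs_nonneg r) ?_
      have c1 := Real.abs_cos_le_one θ
      have s1 := Real.abs_sin_le_one θ
      have c0 := abs_nonneg (Real.cos θ)
      have s0 := abs_nonneg (Real.sin θ)
      rw [← sq_abs (Real.cos θ), ← sq_abs (Real.sin θ)] at h1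
      nlinarith
    linarith
  -- In polar coordinates `r (∂₁G + i∂₂G)/(r e^{iθ}) = ∂_r G + (i/r) ∂_θ G`; these are `g₁` and
  -- `g₂`. Since `∂_θ G` carries a factor `r`, the function `g₂` is continuous up to `r = 0`.
  set g₁ : ℝ × ℝ → ℂ := fun p =>
    Real.cos p.2 * fderiv ℝ G (p.1 * Real.cos p.2, p.1 * Real.sin p.2) (1, 0)
      + Real.sin p.2 * fderiv ℝ G (p.1 * Real.cos p.2, p.1 * Real.sin p.2) (0, 1) with hg₁
  set g₂ : ℝ × ℝ → ℂ := fun p =>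
    Complex.I * (Real.cos p.2 * fderiv ℝ G (p.1 * Real.cos p.2, p.1 * Real.sin p.2) (0, 1)
      - Real.sin p.2 * fderiv ℝ G (p.1 * Real.cos p.2, p.1 * Real.sin p.2) (1, 0)) with hg₂
  have hfc : ∀ v : ℝ × ℝ, Continuous fun p : ℝ × ℝ =>
      fderiv ℝ G (p.1 * Real.cos p.2, p.1 * Real.sin p.2) v := by
    intro v
    have h1 : Continuous (fderiv ℝ G) := hG.continuous_fderiv (by norm_num)
    have h2 : Continuous fun p : ℝ × ℝ => (p.1 * Real.cos p.2, p.1 * Real.sin p.2) := by fun_prop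
    exact (h1.comp h2).clm_apply continuous_const
  have hc1 : Continuous g₁ := by
    have := hfc (1, 0)
    have := hfc (0, 1)
    fun_prop
  have hc2 : Continuous g₂ := by
    have := hfc (1, 0)
    have := hfc (0, 1)
    fun_prop
  have hint : ∀ g : ℝ × ℝ → ℂ, Continuous g → (∀ p : ℝ × ℝ, 2 * R < |p.1| → g p = 0) →
      IntegrableOn g (Set.Ioi 0 ×ˢ Set.Ioo (-Real.pi) Real.pi) := by
    intro g hg hg0
    have h1 : IntegrableOn g (Set.Icc 0 (2 * R) ×ˢ Set.Icc (-Real.pi) Real.pi) :=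
      hg.continuousOn.integrableOn_compact (isCompact_Icc.prod isCompact_Icc)
    refine h1.of_forall_sdiff_eq_zero (measurableSet_Ioi.prod measurableSet_Ioo) fun p hp => ?_
    refine hg0 p ?_
    by_contra! hcon
    have hp1 : 0 < p.1 := hp.1.1
    refine hp.2 ⟨⟨hp1.le, (le_abs_self _).trans hcon⟩, hp.1.2.1.le, hp.1.2.2.le⟩
  have hi1 := hint g₁ hc1 fun p hp => by
    simp only [hg₁]
    rw [hR' _ _ (hpolar _ _ hp), hR' _ _ (hpolar _ _ hp)]
    ring
  have hi2 := hint g₂ hc2 fun p hp => by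
    simp only [hg₂]
    rw [hR' _ _ (hpolar _ _ hp), hR' _ _ (hpolar _ _ hp)]
    ring
  rw [← integral_comp_polarCoord_symm, polarCoord_target]
  have hsum : ∫ p in Set.Ioi (0 : ℝ) ×ˢ Set.Ioo (-Real.pi) Real.pi,
      p.1 • ((fderiv ℝ G (polarCoord.symm p) (1, 0)
        + Complex.I * fderiv ℝ G (polarCoord.symm p) (0, 1)) * cauchyKernel (polarCoord.symm p))
      = ∫ p in Set.Ioi (0 : ℝ) ×ˢ Set.Ioo (-Real.pi) Real.pi, (g₁ p + g₂ p) := by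
    refine setIntegral_congr_fun (measurableSet_Ioi.prod measurableSet_Ioo) fun p hp => ?_
    have hp1 : (0 : ℝ) < p.1 := hp.1
    have hp1' : (p.1 : ℂ) ≠ 0 := Complex.ofReal_ne_zero.mpr hp1.ne'
    have hcs : (Real.cos p.2 : ℂ) ^ 2 + (Real.sin p.2 : ℂ) ^ 2 = 1 := by
      exact_mod_cast Real.cos_sq_add_sin_sq p.2
    have hk : cauchyKernel (p.1 * Real.cos p.2, p.1 * Real.sin p.2)
        = (p.1 : ℂ)⁻¹ * (Real.cos p.2 - Complex.I * Real.sin p.2) := by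
      rw [cauchyKernel]
      refine inv_eq_of_mul_eq_one_left ?_
      simp only [Complex.ofReal_mul]
      field_simp
      linear_combination hcs - (Real.sin p.2 : ℂ) ^ 2 * Complex.I_sq
    simp only [polarCoord_symm_apply, hk, hg₁, hg₂, Complex.real_smul]
    field_simp
    linear_combination -(Real.sin p.2 : ℂ)
      * fderiv ℝ G (p.1 * Real.cos p.2, p.1 * Real.sin p.2) (0, 1) * Complex.I_sq
  rw [hsum, integral_add hi1 hi2]
  -- For fixed `r` the integrand is the `θ`-derivative of a `2π`-periodic function.
  have e2 : ∫ p in Set.Ioi (0 : ℝ) ×ˢ Set.Ioo (-Real.pi) Real.pi, g₂ p = 0 := by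
    rw [Measure.volume_eq_prod, setIntegral_prod _ hi2]
    refine setIntegral_eq_zero_of_forall_eq_zero fun r hr => ?_
    have hr' : (r : ℂ) ≠ 0 := Complex.ofReal_ne_zero.mpr (ne_of_gt hr)
    rw [← integral_Ioc_eq_integral_Ioo, ← intervalIntegral.integral_of_le (by linarith [Real.pi_pos])]
    have hd : ∀ θ ∈ Set.uIcc (-Real.pi) Real.pi,
        HasDerivAt (fun θ => Complex.I / r * G (r * Real.cos θ, r * Real.sin θ)) (g₂ (r, θ)) θ := by
      intro θ _
      refine ((hasDerivAt_comp_polar_angle hG r θ).const_mul (Complex.I / (r : ℂ))).congr_deriv ?_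
      change _ = Complex.I * _
      field_simp
    rw [intervalIntegral.integral_eq_sub_of_hasDerivAt hd
      ((hc2.comp (by fun_prop : Continuous fun θ : ℝ => (r, θ))).intervalIntegrable _ _)]
    simp
  have e1 : ∫ p in Set.Ioi (0 : ℝ) ×ˢ Set.Ioo (-Real.pi) Real.pi, g₁ p
      = -(2 * Real.pi) * G 0 := by
    rw [IntegrableOn, Measure.volume_eq_prod, ← Measure.prod_restrict] at hi1
    rw [Measure.volume_eq_prod, ← Measure.prod_restrict, integral_prod_symm _ hi1]
    -- Along each ray only the value at the origin survives; the angular integration contributes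
    -- `2π`.
    have hin : ∀ θ : ℝ, ∫ r in Set.Ioi (0 : ℝ), g₁ (r, θ) = -G 0 := by
      intro θ
      have h1 : ContDiff ℝ 1 fun r => G (r * Real.cos θ, r * Real.sin θ) :=
        hG.comp (by fun_prop)
      have h2 : HasCompactSupport fun r => G (r * Real.cos θ, r * Real.sin θ) := by
        refine HasCompactSupport.intro (isCompact_Icc (a := -(2 * R)) (b := 2 * R)) fun r hr => ?_
        refine hR _ (hpolar r θ ?_)
        rw [Set.mem_Icc, ← abs_le] at hr
        exact not_le.mp hr
      have h3 := h2.integral_Ioi_deriv_eq h1 0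
      have h4 : (deriv fun r => G (r * Real.cos θ, r * Real.sin θ)) = fun r => g₁ (r, θ) :=
        funext fun r => (hasDerivAt_comp_polar_radius hG r θ).deriv
      rw [h4] at h3
      rw [h3, zero_mul, zero_mul]
      rfl
    simp only [hin]
    rw [setIntegral_const, measureReal_def, Real.volume_Ioo, ENNReal.toReal_ofReal
      (by linarith [Real.pi_pos]), Complex.real_smul]
    push_cast
    ring
  rw [e1, e2, add_zero]

end CauchyPompeiu

/-! ### The operator `N_ζ⁻¹` and the transport equation. -/

/-- The real and imaginary parts of `ζ` are orthonormal. -/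
structure IsUnitFrame (ζ : CSpace n) : Prop where
  norm_re : ‖reVec ζ‖ = 1
  norm_im : ‖imVec ζ‖ = 1
  inner_eq : ⟪reVec ζ, imVec ζ⟫_ℝ = 0

/-- The linear parametrization `y ↦ y₁ Re ζ + y₂ Im ζ` of the plane spanned by `ζ`. -/
def planeVec (ζ : CSpace n) (y : ℝ × ℝ) : RSpace n := y.1 • reVec ζ + y.2 • imVec ζ

/-- The coordinates of the orthogonal projection to the plane spanned by `ζ`. -/
def planeCoord (ζ : CSpace n) (x : RSpace n) : ℝ × ℝ := (⟪reVec ζ, x⟫_ℝ, ⟪imVec ζ, x⟫_ℝ)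

theorem continuous_planeVec (ζ : CSpace n) : Continuous (planeVec ζ) := by
  unfold planeVec
  fun_prop

theorem planeVec_smul (ζ : CSpace n) (c : ℝ) (y : ℝ × ℝ) :
    planeVec ζ (c • y) = c • planeVec ζ y := by
  simp [planeVec, smul_add, mul_smul]

theorem invNKernel_eq (ζ : CSpace n) (f : RSpace n → ℂ) (x : RSpace n) :
    invNKernel ζ f x = fun y => f (x - planeVec ζ y) * cauchyKernel y := by
  ext y
  rw [invNKernel, div_eq_mul_inv, planeVec, sub_sub]
  rfl

theorem invN_eq (ζ : CSpace n) (f : RSpace n → ℂ) (x : RSpace n) :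
    invN ζ f x = (2 * (Real.pi : ℂ))⁻¹ * ∫ y, f (x - planeVec ζ y) * cauchyKernel y := by
  rw [invN, invNKernel_eq, one_div]

namespace IsUnitFrame

variable {ζ : CSpace n}

theorem planeCoord_planeVec (hζ : IsUnitFrame ζ) (y : ℝ × ℝ) : planeCoord ζ (planeVec ζ y) = y := by
  have h1 : ⟪reVec ζ, reVec ζ⟫_ℝ = 1 := by rw [real_inner_self_eq_norm_sq, hζ.norm_re]; norm_num
  have h2 : ⟪imVec ζ, imVec ζ⟫_ℝ = 1 := by rw [real_inner_self_eq_norm_sq, hζ.norm_im]; norm_num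
  have h3 : ⟪imVec ζ, reVec ζ⟫_ℝ = 0 := by rw [real_inner_comm]; exact hζ.inner_eq
  simp only [planeCoord, planeVec, inner_add_right, inner_smul_right, h1, h2, h3, hζ.inner_eq]
  simp

theorem norm_planeCoord_le (hζ : IsUnitFrame ζ) (x : RSpace n) : ‖planeCoord ζ x‖ ≤ ‖x‖ := by
  rw [Prod.norm_def]
  refine max_le ((norm_inner_le_norm _ _).trans ?_) ((norm_inner_le_norm _ _).trans ?_)
  · rw [hζ.norm_re, one_mul]
  · rw [hζ.norm_im, one_mul]

/-- If `f` lives in the ball of radius `R`, then `y ↦ f (x - planeVec ζ y)` lives in a ball of the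
same radius about `planeCoord ζ x`. This makes the bounds on the transform uniform in `x`. -/
theorem norm_sub_planeCoord_le (hζ : IsUnitFrame ζ) (x : RSpace n) (y : ℝ × ℝ) :
    ‖y - planeCoord ζ x‖ ≤ ‖x - planeVec ζ y‖ := by
  have h1 : planeCoord ζ (x - planeVec ζ y) = planeCoord ζ x - y := by
    conv_rhs => rw [← hζ.planeCoord_planeVec y]
    simp only [planeCoord, inner_sub_right]
    rfl
  rw [norm_sub_rev, ← h1]
  exact hζ.norm_planeCoord_le _

theorem norm_le_norm_planeVec (hζ : IsUnitFrame ζ) (y : ℝ × ℝ) : ‖y‖ ≤ ‖planeVec ζ y‖ := by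
  conv_lhs => rw [← hζ.planeCoord_planeVec y]
  exact hζ.norm_planeCoord_le _

end IsUnitFrame

theorem exists_norm_invN_le (n : ℕ) (R : ℝ) : ∃ C : ℝ, 0 ≤ C ∧
    ∀ ζ : CSpace n, IsUnitFrame ζ → ∀ (f : RSpace n → ℂ) (M : ℝ), Continuous f → 0 ≤ M →
      (∀ z, R < ‖z‖ → f z = 0) → (∀ z, ‖f z‖ ≤ M) → ∀ x,
        Integrable (invNKernel ζ f x) ∧ ‖invN ζ f x‖ ≤ C * M := by
  obtain ⟨C, hC, h⟩ := exists_norm_integral_cauchyKernel_le R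
  refine ⟨‖(2 * (Real.pi : ℂ))⁻¹‖ * C, by positivity, fun ζ hζ f M hf hM hs hb x => ?_⟩
  obtain ⟨h1, h2⟩ := h (planeCoord ζ x) (fun y => f (x - planeVec ζ y)) M
    (hf.comp (continuous_const.sub (continuous_planeVec ζ))) hM
    (fun y hy => hs _ (hy.trans_le (hζ.norm_sub_planeCoord_le x y))) (fun y => hb _)
  rw [invNKernel_eq, invN_eq, norm_mul, mul_assoc]
  exact ⟨h1, mul_le_mul_of_nonneg_left h2 (norm_nonneg _)⟩

theorem exists_forall_norm_lt_eq_zero {f : RSpace n → ℂ} (hf : HasCompactSupport f) :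
    ∃ R : ℝ, 0 ≤ R ∧ ∀ z, R < ‖z‖ → f z = 0 := by
  obtain ⟨R, hR⟩ := hf.isCompact.isBounded.subset_closedBall 0
  refine ⟨max R 0, le_max_right _ _, fun y hy => image_eq_zero_of_notMem_tsupport fun h => ?_⟩
  have := hR h
  rw [mem_closedBall_zero_iff] at this
  exact absurd hy (not_lt.mpr (this.trans (le_max_left _ _)))

section invN

variable {ζ : CSpace n} {f : RSpace n → ℂ}

theorem integrable_invNKernel (hζ : IsUnitFrame ζ) (hf : Continuous f) (hfc : HasCompactSupport f)
    (x : RSpace n) : Integrable (invNKernel ζ f x) := by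
  obtain ⟨R, -, hR⟩ := exists_forall_norm_lt_eq_zero hfc
  obtain ⟨C, hC, h⟩ := exists_norm_invN_le n R
  obtain ⟨M, hM⟩ := hfc.exists_bound_of_continuous hf
  exact (h ζ hζ f M hf ((norm_nonneg _).trans (hM 0)) hR hM x).1

theorem exists_norm_invN_le_of_hasCompactSupport (hζ : IsUnitFrame ζ) (hf : Continuous f)
    (hfc : HasCompactSupport f) : ∃ M : ℝ, ∀ x, ‖invN ζ f x‖ ≤ M := by
  obtain ⟨R, -, hR⟩ := exists_forall_norm_lt_eq_zero hfc
  obtain ⟨C, hC, h⟩ := exists_norm_invN_le n R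
  obtain ⟨M, hM⟩ := hfc.exists_bound_of_continuous hf
  exact ⟨C * M, fun x => (h ζ hζ f M hf ((norm_nonneg _).trans (hM 0)) hR hM x).2⟩

/-- By linearity and translation invariance a difference of two values is the transform of `f(· + x
- x') - f`, which is uniformly small and supported in a ball enlarged by `1`. -/
theorem uniformContinuous_invN (hζ : IsUnitFrame ζ) (hf : Continuous f)
    (hfc : HasCompactSupport f) : UniformContinuous (invN ζ f) := by
  obtain ⟨R, -, hR⟩ := exists_forall_norm_lt_eq_zero hfc
  obtain ⟨C, hC, h⟩ := exists_norm_invN_le n (R + 1)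
  have hu := hfc.uniformContinuous_of_continuous hf
  rw [Metric.uniformContinuous_iff] at hu ⊢
  intro ε hε
  obtain ⟨δ, hδ, hδ'⟩ := hu (ε / (C + 1)) (by positivity)
  refine ⟨min δ 1, by positivity, fun x x' hxx => ?_⟩
  rw [dist_eq_norm] at hxx
  set g : RSpace n → ℂ := fun z => f (z + (x - x')) - f z
  have hg : Continuous g := by fun_prop
  have hgs : ∀ z, R + 1 < ‖z‖ → g z = 0 := by
    intro z hz
    have h1 : ‖z‖ ≤ ‖z + (x - x')‖ + ‖x - x'‖ := by
      simpa using norm_sub_le (z + (x - x')) (x - x')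
    have h2 := hxx.trans_le (min_le_right _ _)
    simp only [g]
    rw [hR _ (by linarith), hR z (by linarith), sub_zero]
  have hgb : ∀ z, ‖g z‖ ≤ ε / (C + 1) := fun z => by
    rw [← dist_eq_norm]
    refine (hδ' ?_).le
    rw [dist_eq_norm, add_sub_cancel_left]
    exact hxx.trans_le (min_le_left _ _)
  have h3 := (h ζ hζ g _ hg (by positivity) hgs hgb x').2
  have h4 : invN ζ g x' = invN ζ f x - invN ζ f x' := by
    have i1 := integrable_invNKernel hζ hf hfc x
    have i2 := integrable_invNKernel hζ hf hfc x'
    rw [invNKernel_eq] at i1 i2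
    rw [invN_eq, invN_eq, invN_eq, ← mul_sub, ← integral_sub i1 i2]
    congr 2
    ext y
    rw [← sub_mul]
    simp only [g]
    congr 3
    abel_nf
  rw [dist_eq_norm, ← h4]
  refine h3.trans_lt ?_
  rw [mul_div_assoc', div_lt_iff₀ (by positivity)]
  nlinarith

theorem cauchyKernel_smul (c : ℝ) (y : ℝ × ℝ) :
    cauchyKernel (c • y) = (c : ℂ)⁻¹ * cauchyKernel y := by
  rw [cauchyKernel, cauchyKernel, ← mul_inv]
  congr 1
  simp
  ring

/-- The plane contributes `δ⁻²`, the kernel, homogeneous of degree `-1`, contributes `δ`. -/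
theorem invN_comp_smul {δ : ℝ} (hδ : 0 < δ) (ζ : CSpace n) (f : RSpace n → ℂ) (x : RSpace n) :
    invN ζ (fun z => f (δ • z)) x = (δ : ℂ)⁻¹ * invN ζ f (δ • x) := by
  have hδ' : (δ : ℂ) ≠ 0 := Complex.ofReal_ne_zero.mpr hδ.ne'
  have h1 := Measure.integral_comp_smul (volume : Measure (ℝ × ℝ))
    (fun y => f (δ • x - planeVec ζ y) * cauchyKernel y) δ
  simp only [planeVec_smul, ← smul_sub, cauchyKernel_smul] at h1
  rw [invN_eq, invN_eq]
  have h2 : ∀ y, f (δ • (x - planeVec ζ y)) * cauchyKernel y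
      = (δ : ℂ) * (f (δ • (x - planeVec ζ y)) * ((δ : ℂ)⁻¹ * cauchyKernel y)) := by
    intro y
    field_simp
  simp only [h2]
  rw [integral_const_mul, h1, Module.finrank_prod, Module.finrank_self, abs_of_pos (by positivity),
    Complex.real_smul]
  push_cast
  field_simp

/-- The first order operator `ζ · ∇`. -/
def dirDeriv (ζ : CSpace n) (g : RSpace n → ℂ) (x : RSpace n) : ℂ := ∑ j, ζ j * partialDeriv j g x

theorem dirDeriv_eq (ζ : CSpace n) (g : RSpace n → ℂ) (x : RSpace n) :
    dirDeriv ζ g x = fderiv ℝ g x (reVec ζ) + Complex.I * fderiv ℝ g x (imVec ζ) := by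
  have h1 : ∀ v : RSpace n, fderiv ℝ g x v = ∑ j, (v j : ℂ) * partialDeriv j g x := by
    intro v
    have h2 : v = ∑ j, v j • EuclideanSpace.single j (1 : ℝ) := by
      ext i
      simp [Finset.sum_apply, Pi.single_apply]
    conv_lhs => rw [h2]
    rw [map_sum]
    refine Finset.sum_congr rfl fun j _ => ?_
    rw [map_smul, Complex.real_smul]
    rfl
  rw [h1, h1, dirDeriv, Finset.mul_sum, ← Finset.sum_add_distrib]
  refine Finset.sum_congr rfl fun j _ => ?_
  conv_lhs => rw [← Complex.re_add_im (ζ j)]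
  simp only [reVec, imVec]
  ring

theorem integrable_mul_cauchyKernel {H : RSpace n × (ℝ × ℝ) → ℂ} (hH : Continuous H) {T : ℝ}
    (h1 : ∀ p, T < ‖p.1‖ → H p = 0) (h2 : ∀ p, T < ‖p.2‖ → H p = 0) :
    Integrable fun p => H p * cauchyKernel p.2 := by
  have hc : HasCompactSupport H := by
    refine HasCompactSupport.intro ((isCompact_closedBall (0 : RSpace n) T).prod
      (isCompact_closedBall (0 : ℝ × ℝ) T)) fun p hp => ?_
    by_contra! hne
    refine hp ⟨?_, ?_⟩
    · rw [mem_closedBall_zero_iff]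
      exact not_lt.mp fun h => hne (h1 p h)
    · rw [mem_closedBall_zero_iff]
      exact not_lt.mp fun h => hne (h2 p h)
  obtain ⟨M, hM⟩ := hc.exists_bound_of_continuous hH
  have hM0 : 0 ≤ M := (norm_nonneg _).trans (hM 0)
  have i1 : Integrable ((Metric.closedBall (0 : RSpace n) T).indicator fun _ => (1 : ℝ)) :=
    (integrable_indicator_iff Metric.isClosed_closedBall.measurableSet).mpr
      (integrableOn_const measure_closedBall_lt_top.ne (by simp))
  have i2 : Integrable ((Metric.closedBall (0 : ℝ × ℝ) T).indicator fun y => ‖cauchyKernel y‖) :=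
    (integrable_indicator_iff Metric.isClosed_closedBall.measurableSet).mpr
      (integrableOn_cauchyKernel T).norm
  refine ((i1.mul_prod i2).const_mul M).mono' (hH.aestronglyMeasurable.mul
    (measurable_cauchyKernel.comp measurable_snd).aestronglyMeasurable) (.of_forall fun p => ?_)
  have n1 : 0 ≤ (Metric.closedBall (0 : RSpace n) T).indicator (fun _ => (1 : ℝ)) p.1 :=
    Set.indicator_nonneg (fun _ _ => zero_le_one) _
  have n2 : 0 ≤ (Metric.closedBall (0 : ℝ × ℝ) T).indicator (fun y => ‖cauchyKernel y‖) p.2 :=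
    Set.indicator_nonneg (fun _ _ => norm_nonneg _) _
  by_cases hp1 : T < ‖p.1‖
  · rw [h1 p hp1, zero_mul, norm_zero]
    positivity
  by_cases hp2 : T < ‖p.2‖
  · rw [h2 p hp2, zero_mul, norm_zero]
    positivity
  rw [Set.indicator_of_mem (by simpa using hp1), Set.indicator_of_mem (by simpa using hp2),
    one_mul, norm_mul]
  exact mul_le_mul_of_nonneg_right (hM p) (norm_nonneg _)

/-- On the plane through `s` the operator `ζ·∇` is `∂₁ + i∂₂`, and Cauchy–Pompeiu applies. The minus
sign in `s - planeVec ζ y` turns `-2π` into `2π`. -/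
theorem integral_dirDeriv_mul_cauchyKernel (hζ : IsUnitFrame ζ) {g : RSpace n → ℂ}
    (hg : ContDiff ℝ ∞ g) (hgc : HasCompactSupport g) (s : RSpace n) :
    ∫ y, dirDeriv ζ g (s - planeVec ζ y) * cauchyKernel y = 2 * Real.pi * g s := by
  obtain ⟨R, -, hR⟩ := exists_forall_norm_lt_eq_zero hgc
  set G : ℝ × ℝ → ℂ := fun y => g (s - planeVec ζ y)
  have hL : ContDiff ℝ 1 fun y : ℝ × ℝ => s - planeVec ζ y := by
    unfold planeVec
    fun_prop
  have hG : ContDiff ℝ 1 G := (hg.of_le (by norm_num)).comp hL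
  have hGc : HasCompactSupport G := by
    refine HasCompactSupport.intro (isCompact_closedBall (planeCoord ζ s) R) fun y hy => hR _ ?_
    rw [Metric.mem_closedBall, not_le, dist_eq_norm] at hy
    exact hy.trans_le (hζ.norm_sub_planeCoord_le s y)
  have hd : ∀ y v, fderiv ℝ G y v = -fderiv ℝ g (s - planeVec ζ y) (planeVec ζ v) := by
    intro y v
    have h1 : HasFDerivAt (fun y : ℝ × ℝ => s - planeVec ζ y)
        (-((ContinuousLinearMap.fst ℝ ℝ ℝ).smulRight (reVec ζ)
          + (ContinuousLinearMap.snd ℝ ℝ ℝ).smulRight (imVec ζ))) y := by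
      have h2 := (((ContinuousLinearMap.fst ℝ ℝ ℝ).smulRight (reVec ζ)
          + (ContinuousLinearMap.snd ℝ ℝ ℝ).smulRight (imVec ζ)).hasFDerivAt (x := y)).const_sub s
      exact h2
    have h3 := ((hg.differentiable (by norm_num) (s - planeVec ζ y)).hasFDerivAt).comp y h1
    have h4 : fderiv ℝ G y = _ := h3.fderiv
    rw [h4]
    simp [planeVec]
  have h5 := integral_dbar_mul_cauchyKernel hG hGc
  have h6 : G 0 = g s := by simp [G, planeVec]
  rw [h6] at h5
  rw [← neg_inj, ← integral_neg, ← neg_mul, ← h5]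
  congr 1
  ext y
  rw [hd, hd, dirDeriv_eq]
  simp only [planeVec, one_smul, zero_smul, add_zero, zero_add]
  ring

theorem continuous_dirDeriv {g : RSpace n → ℂ} (hg : ContDiff ℝ ∞ g) :
    Continuous (dirDeriv ζ g) := by
  have : ∀ j : Fin n, Continuous (partialDeriv j g) := fun j => (contDiff_partialDeriv hg j).continuous
  unfold dirDeriv
  fun_prop

theorem hasCompactSupport_dirDeriv {g : RSpace n → ℂ} (hgc : HasCompactSupport g) :
    HasCompactSupport (dirDeriv ζ g) := by
  obtain ⟨R, -, hR⟩ := exists_forall_norm_lt_eq_zero hgc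
  refine HasCompactSupport.intro (isCompact_closedBall (0 : RSpace n) R) fun x hx => ?_
  rw [mem_closedBall_zero_iff, not_le] at hx
  refine Finset.sum_eq_zero fun j _ => ?_
  rw [partialDeriv_eq_zero_of_norm_lt hR j _ hx, mul_zero]

/-- This is `ζ·∇ N_ζ⁻¹ f = f` in weak form. As `f` is only continuous, the derivative stays on `g`:
Fubini and a translation along the plane bring the kernel next to `g`, where Cauchy–Pompeiu is
available. -/
theorem conv_dirDeriv_invN (hζ : IsUnitFrame ζ) (hf : Continuous f) (hfc : HasCompactSupport f)
    {g : RSpace n → ℂ} (hg : ContDiff ℝ ∞ g) (hgc : HasCompactSupport g) :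
    conv (dirDeriv ζ g) (invN ζ f) = conv g f := by
  ext x
  obtain ⟨S, hS0, hS⟩ := exists_forall_norm_lt_eq_zero (hasCompactSupport_dirDeriv (ζ := ζ) hgc)
  obtain ⟨R, hR0, hR⟩ := exists_forall_norm_lt_eq_zero hfc
  have hD : Continuous (dirDeriv ζ g) := continuous_dirDeriv hg
  have hP := continuous_planeVec ζ
  have hP1 : ∀ y, ‖y‖ ≤ ‖planeVec ζ y‖ := hζ.norm_le_norm_planeVec
  have hpi : (2 * (Real.pi : ℂ)) ≠ 0 := by
    simp [Real.pi_ne_zero]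
  have i1 : Integrable fun p : RSpace n × (ℝ × ℝ) =>
      (dirDeriv ζ g p.1 * f (x - p.1 - planeVec ζ p.2)) * cauchyKernel p.2 := by
    refine integrable_mul_cauchyKernel (T := ‖x‖ + S + R) (by fun_prop) (fun p hp => ?_)
      (fun p hp => ?_)
    · rw [hS _ (by linarith [norm_nonneg x]), zero_mul]
    · by_cases h : S < ‖p.1‖
      · rw [hS _ h, zero_mul]
      · rw [hR, mul_zero]
        have h1 := norm_sub_le (x - p.1) (x - p.1 - planeVec ζ p.2)
        rw [sub_sub_cancel] at h1
        have h2 := norm_sub_le x p.1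
        linarith [hP1 p.2]
  have i2 : Integrable fun p : RSpace n × (ℝ × ℝ) =>
      (dirDeriv ζ g (p.1 - planeVec ζ p.2) * f (x - p.1)) * cauchyKernel p.2 := by
    refine integrable_mul_cauchyKernel (T := ‖x‖ + S + R) (by fun_prop) (fun p hp => ?_)
      (fun p hp => ?_)
    · rw [hR, mul_zero]
      have h1 := norm_sub_le x (x - p.1)
      rw [sub_sub_cancel] at h1
      linarith
    · by_cases h : R < ‖x - p.1‖
      · rw [hR _ h, mul_zero]
      · rw [hS, zero_mul]
        have h1 := norm_sub_le x (x - p.1)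
        rw [sub_sub_cancel] at h1
        have h2 := norm_sub_le p.1 (p.1 - planeVec ζ p.2)
        rw [sub_sub_cancel] at h2
        linarith [hP1 p.2]
  have e1 : conv (dirDeriv ζ g) (invN ζ f) x = (2 * (Real.pi : ℂ))⁻¹ * ∫ t, ∫ y : ℝ × ℝ,
      (dirDeriv ζ g t * f (x - t - planeVec ζ y)) * cauchyKernel y := by
    rw [conv_apply, ← integral_const_mul]
    congr 1
    ext t
    rw [invN_eq, ← integral_const_mul, ← integral_const_mul, ← integral_const_mul]
    congr 1
    ext y
    ring
  have e2 : ∀ y : ℝ × ℝ, ∫ t, (dirDeriv ζ g t * f (x - t - planeVec ζ y)) * cauchyKernel y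
      = ∫ s, (dirDeriv ζ g (s - planeVec ζ y) * f (x - s)) * cauchyKernel y := by
    intro y
    rw [← integral_sub_right_eq_self _ (planeVec ζ y)]
    congr 1
    ext s
    congr 3
    abel
  have e3 : ∀ s, ∫ y : ℝ × ℝ, (dirDeriv ζ g (s - planeVec ζ y) * f (x - s)) * cauchyKernel y
      = 2 * Real.pi * (g s * f (x - s)) := by
    intro s
    rw [← mul_assoc, ← integral_dirDeriv_mul_cauchyKernel hζ hg hgc s, ← integral_mul_const]
    congr 1
    ext y
    ring
  rw [e1, integral_integral_swap i1]
  simp only [e2]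
  rw [← integral_integral_swap i2]
  simp only [e3]
  rw [integral_const_mul, ← mul_assoc, inv_mul_cancel₀ hpi, one_mul, conv_apply]

/-- The mollified phase solves the transport equation with the mollified source, without error. The
factor `δ⁻¹` from the chain rule cancels the `δ` from the homogeneity of `invN`. -/
theorem dirDeriv_mollify_invN (hζ : IsUnitFrame ζ) (hf : Continuous f) (hfc : HasCompactSupport f)
    {δ : ℝ} (hδ : 0 < δ) : dirDeriv ζ (mollify δ (invN ζ f)) = mollify δ f := by
  have hδ' : (δ : ℂ) ≠ 0 := Complex.ofReal_ne_zero.mpr hδ.ne'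
  set fδ : RSpace n → ℂ := fun z => f (δ • z)
  have hfδ : Continuous fδ := hf.comp (continuous_const_smul δ)
  have hfδc : HasCompactSupport fδ :=
    hfc.comp_homeomorph (Homeomorph.smulOfNeZero δ hδ.ne')
  have hu := (uniformContinuous_invN hζ hfδ hfδc).continuous
  have h1 : (fun y => invN ζ f (δ • y)) = fun y => (δ : ℂ) * invN ζ fδ y := by
    ext y
    rw [invN_comp_smul hδ, ← mul_assoc, mul_inv_cancel₀ hδ', one_mul]
  have h2 : mollify δ (invN ζ f) = fun x => conv (bump n) (fun y => invN ζ f (δ • y)) (δ⁻¹ • x) := rfl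
  ext x
  rw [dirDeriv]
  have h3 : ∀ j, partialDeriv j (mollify δ (invN ζ f)) x
      = conv (partialDeriv j (bump n)) (invN ζ fδ) (δ⁻¹ • x) := by
    intro j
    rw [h2, partialDeriv_comp_smul, h1, partialDeriv_conv (F := fun y => (δ : ℂ) * invN ζ fδ y) contDiff_bump
      hasCompactSupport_bump (continuous_const.mul hu)]
    simp only [conv_apply]
    rw [Complex.real_smul, ← integral_const_mul]
    congr 1
    ext t
    push_cast
    field_simp
  simp only [h3]
  have h4 := congrFun (conv_dirDeriv_invN hζ hfδ hfδc contDiff_bump hasCompactSupport_bump) (δ⁻¹ • x)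
  have h5 : conv (dirDeriv ζ (bump n)) (invN ζ fδ) (δ⁻¹ • x)
      = ∑ j, ζ j * conv (partialDeriv j (bump n)) (invN ζ fδ) (δ⁻¹ • x) := by
    simp only [conv_apply, dirDeriv, Finset.sum_mul]
    rw [integral_finsetSum]
    · refine Finset.sum_congr rfl fun j _ => ?_
      rw [← integral_const_mul]
      congr 1
      ext t
      ring
    · intro j _
      have hb := (contDiff_partialDeriv contDiff_bump j : ContDiff ℝ ∞ (partialDeriv j (bump n)))
      have hbc := hasCompactSupport_partialDeriv (hasCompactSupport_bump (n := n)) j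
      have hc1 := hb.continuous
      refine Continuous.integrable_of_hasCompactSupport (by fun_prop) ?_
      exact (hbc.mul_left (f := fun _ => ζ j)).mul_right
  rw [← h5, h4]
  rfl

end invN

/-! ### The bilinear form and the defect of the amplitude. -/

/-- The integrand of the bilinear form of the conjugated magnetic Schrödinger operator, as a
function of the values and semiclassical gradients of the two arguments. The vector `η` is the
semiclassical gradient of the phase. -/
def formDensity (h : ℝ) (η A : Fin n → ℂ) (V r : ℂ) (dr : Fin n → ℂ) (g : ℂ) (dg : Fin n → ℂ) : ℂ :=
  (∑ j, ((dr j + r * η j) * (dg j - g * η j) - Complex.I * h * A j * (dr j + r * η j) * g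
    + Complex.I * h * A j * r * (dg j - g * η j))) + (h : ℂ) ^ 2 * V * r * g

/-- The function `F` is integrable with integral `z`. -/
def HasIntegral (F : RSpace n → ℂ) (z : ℂ) : Prop := Integrable F ∧ ∫ x, F x = z

namespace HasIntegral

theorem add {F G : RSpace n → ℂ} {z w : ℂ} (hF : HasIntegral F z) (hG : HasIntegral G w) :
    HasIntegral (fun x => F x + G x) (z + w) :=
  ⟨hF.1.add hG.1, by rw [integral_add hF.1 hG.1, hF.2, hG.2]⟩

theorem sum {F : Fin n → RSpace n → ℂ} {z : Fin n → ℂ} (hF : ∀ j, HasIntegral (F j) (z j)) :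
    HasIntegral (fun x => ∑ j, F j x) (∑ j, z j) :=
  ⟨integrable_finsetSum _ fun j _ => (hF j).1, by
    rw [integral_finsetSum _ fun j _ => (hF j).1]
    exact Finset.sum_congr rfl fun j _ => (hF j).2⟩

theorem const_mul {F : RSpace n → ℂ} {z : ℂ} (hF : HasIntegral F z) (c : ℂ) :
    HasIntegral (fun x => c * F x) (c * z) :=
  ⟨hF.1.const_mul c, by rw [integral_const_mul, hF.2]⟩

theorem congr {F G : RSpace n → ℂ} {z : ℂ} (hF : HasIntegral F z) (h : F =ᵐ[volume] G) :
    HasIntegral G z :=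
  ⟨hF.1.congr h, by rw [← integral_congr_ae h, hF.2]⟩

theorem congr' {F G : RSpace n → ℂ} {z w : ℂ} (hF : HasIntegral F z) (h : ∀ x, G x = F x)
    (hw : w = z) : HasIntegral G w := by
  rw [hw, funext h]
  exact hF

end HasIntegral

theorem hasIntegral_pair (f g : L2 n) : HasIntegral (fun x => f x * g x) (pair f g) :=
  ⟨(Lp.memLp f).integrable_mul (Lp.memLp g), (pair_apply f g).symm⟩

theorem hasIntegral_pair_toL2 (f : Sch n) (R : L2 n) :
    HasIntegral (fun x => f x * R x) (pair (toL2 f) R) :=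
  (hasIntegral_pair _ R).congr (by filter_upwards [coeFn_toL2 f] with x hx; rw [hx])

theorem hasIntegral_pair_mulB {a : RSpace n → ℂ} (ha : MemLp a ∞ volume) (f : Sch n) (R : L2 n) :
    HasIntegral (fun x => a x * f x * R x) (pair (mulB ha (toL2 f)) R) :=
  (hasIntegral_pair _ R).congr (by
    filter_upwards [coeFn_toL2 f, coeFn_mulB ha (toL2 f)] with x hx hx'; rw [hx', hx])

theorem mulS_phaseGrad_apply (h κ : ℝ) (α β : RSpace n) (j : Fin n) (g : Sch n) (x : RSpace n) :
    mulS (phaseGrad h κ α β j) g x = phaseGrad h κ α β j x * g x :=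
  mulS_apply (hasTemperateGrowth_phaseGrad h κ α β j) g x

theorem conjDeriv_apply (h κ : ℝ) (α β : RSpace n) (j : Fin n) (g : Sch n) (x : RSpace n) :
    conjDeriv h κ α β j g x = h * partialDeriv j g x - phaseGrad h κ α β j x * g x := by
  rw [conjDeriv, LinearMap.sub_apply, sub_apply, dh_apply, mulS_phaseGrad_apply]

theorem principalJet_none (h κ : ℝ) (α β : RSpace n) (g : Sch n) :
    principalJet h κ α β g none
      = ∑ j, toL2 (mulS (phaseGrad h κ α β j) (conjDeriv h κ α β j g)) := by
  rw [← map_sum]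
  refine congrArg toL2 ?_
  rw [LinearMap.sum_apply]
  rfl

theorem lowerJet_none {h κ : ℝ} {α β : RSpace n} {A : Fin n → RSpace n → ℂ}
    {V : RSpace n → ℂ} (hA : ∀ j, MemLp (A j) ∞ volume) (hV : MemLp V ∞ volume) (g : Sch n) :
    lowerJet h κ α β hA hV g none = (∑ j, mulB (hA j) (toL2 (Complex.I • conjDeriv h κ α β j g
      - Complex.I • mulS (phaseGrad h κ α β j) g))) + (h : ℂ) • mulB hV (toL2 g) := by
  rw [lowerJet, jetOf_apply, Option.elim_none, LinearMap.add_apply, LinearMap.sum_apply]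
  rfl

/-- No integration by parts occurs, so `R` may be any tuple, not necessarily a function with its
gradient; truncated jets rely on this. -/
theorem hasIntegral_formDensity {h κ : ℝ} {α β : RSpace n} {A : Fin n → RSpace n → ℂ}
    {V : RSpace n → ℂ} (hA : ∀ j, MemLp (A j) ∞ volume) (hV : MemLp V ∞ volume) (g : Sch n)
    (R : Jet n) :
    HasIntegral (fun x => formDensity h (fun j => phaseGrad h κ α β j x) (fun j => A j x) (V x)
      (R none x) (fun j => R (some j) x) (g x) (fun j => h * partialDeriv j g x))
      (pairJ ((principalJet h κ α β + (h : ℂ) • lowerJet h κ α β hA hV) g) R) := by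
  have h1 := ((HasIntegral.sum fun j => hasIntegral_pair_toL2 (mulS (phaseGrad h κ α β j)
      (conjDeriv h κ α β j g)) (R none)).add
    (HasIntegral.sum fun j => hasIntegral_pair_toL2 (conjDeriv h κ α β j g) (R (some j)))).add
    ((((HasIntegral.sum fun j => hasIntegral_pair_mulB (hA j) (Complex.I • conjDeriv h κ α β j g
      - Complex.I • mulS (phaseGrad h κ α β j) g) (R none)).add
      ((hasIntegral_pair_mulB hV g (R none)).const_mul h)).add
      (HasIntegral.sum fun j => hasIntegral_pair_mulB (hA j) (-Complex.I • g)
        (R (some j)))).const_mul h)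
  refine h1.congr' ?_ ?_
  · intro x
    simp only [formDensity, mulS_phaseGrad_apply, conjDeriv_apply, sub_apply, smul_apply,
      smul_eq_mul, mul_add, Finset.mul_sum]
    rw [← Finset.sum_add_distrib, show ∀ X S c T : ℂ, X + (S + c + T) = (X + S + T) + c from
      fun _ _ _ _ => by ring, ← Finset.sum_add_distrib, ← Finset.sum_add_distrib]
    congr 1
    · refine Finset.sum_congr rfl fun j _ => ?_
      ring
    · ring
  · have e1 : (principalJet h κ α β + (h : ℂ) • lowerJet h κ α β hA hV) g
        = principalJet h κ α β g + (h : ℂ) • lowerJet h κ α β hA hV g := rfl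
    have e2 : ∀ F G : Jet n, pairJ (F + (h : ℂ) • G) R = pairJ F R + (h : ℂ) * pairJ G R := by
      intro F G
      rw [map_add, map_smul]
      rfl
    have e3 : ∀ (F : Fin n → L2 n) (G : L2 n), pair (∑ j, F j) G = ∑ j, pair (F j) G := by
      intro F G
      rw [map_sum, sum_apply]
    have e4 : ∀ F G H : L2 n, pair (F + (h : ℂ) • G) H = pair F H + (h : ℂ) * pair G H := by
      intro F G H
      rw [map_add, map_smul]
      rfl
    have e5 : ∀ F G : Jet n, pairJ (F + (h : ℂ) • G) R
        = (pair (F none) (R none) + ∑ j, pair (F (some j)) (R (some j)))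
          + (h : ℂ) * (pair (G none) (R none) + ∑ j, pair (G (some j)) (R (some j))) := by
      intro F G
      rw [e2, pairJ_apply', pairJ_apply']
    have p0 := (congrArg (fun F => pair F (R none)) (principalJet_none h κ α β g)).trans (e3 _ _)
    have l0 := (congrArg (fun F => pair F (R none)) (lowerJet_none (h := h) (κ := κ) (α := α)
      (β := β) hA hV g)).trans ((e4 _ _ _).trans (congrArg (· + _) (e3 _ _)))
    rw [e1]
    exact (e5 _ _).trans (congrArg₂ (· + ·) (congrArg₂ (· + ·) p0 rfl)
      (congrArg ((h : ℂ) * ·) (congrArg₂ (· + ·) l0 rfl)))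

/-- Conjugation of the form by an exponential weight `w` shifts the phase gradient. -/
theorem formDensity_weight {h : ℝ} {ζ τ η A : Fin n → ℂ} {V a v w : ℂ} {da dv : Fin n → ℂ}
    (hw : w ≠ 0) (hη : ∀ j, η j = ζ j + τ j) :
    formDensity h η A V (w⁻¹ * a) (fun j => w⁻¹ * (da j - τ j * a)) (w * v)
      (fun j => w * (dv j + τ j * v)) = formDensity h ζ A V a da v dv := by
  have h1 : ∀ j, w⁻¹ * (da j - τ j * a) + w⁻¹ * a * η j = w⁻¹ * (da j + a * ζ j) := by
    intro j
    rw [hη]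
    ring
  have h2 : ∀ j, w * (dv j + τ j * v) - w * v * η j = w * (dv j - v * ζ j) := by
    intro j
    rw [hη]
    ring
  simp only [formDensity, h1, h2]
  congr 1
  · refine Finset.sum_congr rfl fun j _ => ?_
    field_simp
  · field_simp

theorem formDensity_add_left {h : ℝ} {η A : Fin n → ℂ} {V r s g : ℂ} {dr ds dg : Fin n → ℂ} :
    formDensity h η A V (r + s) (fun j => dr j + ds j) g dg
      = formDensity h η A V r dr g dg + formDensity h η A V s ds g dg := by
  simp only [formDensity]
  rw [add_add_add_comm, ← Finset.sum_add_distrib]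
  congr 1
  · refine Finset.sum_congr rfl fun j _ => ?_
    ring
  · ring

/-- The bilinear form on an amplitude `a` with logarithmic gradient `p` that solves a transport
equation, modulo the divergence of `a (p + ζ + i h b) v`. -/
theorem formDensity_sub_divergence {h : ℝ} {ζ₀ ζ₁ ζ A b p t db : Fin n → ℂ} {V a v : ℂ}
    {dv : Fin n → ℂ} (hζ : ∀ j, ζ j = ζ₀ j + ζ₁ j) (hζζ : ∑ j, ζ j * ζ j = 0)
    (hp : ∑ j, ζ₀ j * p j = -Complex.I * h * ∑ j, ζ₀ j * b j) :
    formDensity h ζ A V a (fun j => a * p j) v dv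
      - ∑ j, (a * (p j + ζ j + Complex.I * h * b j) * dv j
        + v * (a * (p j * (p j + ζ j + Complex.I * h * b j) + t j + Complex.I * h * db j)))
      = (∑ j, (Complex.I * h * a * (A j - b j) * dv j
        + a * v * (-(p j) ^ 2 - t j - 2 * ζ₁ j * p j - Complex.I * h * A j * p j
          - 2 * Complex.I * h * (A j - b j) * ζ₀ j - 2 * Complex.I * h * A j * ζ₁ j
          - Complex.I * h * (p j * b j + db j)))) + (h : ℂ) ^ 2 * V * a * v := by
  have h1 : (∑ j, ζ₀ j * p j) + Complex.I * h * ∑ j, ζ₀ j * b j = 0 := by rw [hp]; ring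
  rw [Finset.mul_sum, ← Finset.sum_add_distrib] at h1
  -- A multiple of `ζ·ζ` (order one) plus a multiple of the transport equation (order `h`): adding
  -- this vanishing sum makes the identity hold term by term in `j`.
  have h2 : ∑ j, (-(a * v) * (ζ j * ζ j)
      + -(2 * a * v) * (ζ₀ j * p j + Complex.I * h * (ζ₀ j * b j))) = 0 := by
    rw [Finset.sum_add_distrib, ← Finset.mul_sum, ← Finset.mul_sum, hζζ, h1]
    ring
  rw [formDensity, add_sub_right_comm, ← Finset.sum_sub_distrib]
  congr 1
  rw [← sub_eq_zero, ← Finset.sum_sub_distrib, ← h2]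
  refine Finset.sum_congr rfl fun j _ => ?_
  rw [hζ j]
  ring

/-- In use `p = h∂Φ`, `t = h²∂²Φ`, `db = h∂b` and `s = h^{1-σ}`, while `e` measures `A - b`. The
factor `5` counts the contributions of type `h s`. -/
theorem norm_remainder_coefficient_le {h s e C : ℝ} (hh : 0 ≤ h) (hs : 0 ≤ s) (he : 0 ≤ e)
    (hC : 1 ≤ C) {p t z₁ A b z₀ db : ℂ} (hp : ‖p‖ ≤ C * s) (ht : ‖t‖ ≤ C * s ^ 2)
    (hz₁ : ‖z₁‖ ≤ C * h) (hA : ‖A‖ ≤ C) (hb : ‖b‖ ≤ C) (hAb : ‖A - b‖ ≤ e) (hz₀ : ‖z₀‖ ≤ C)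
    (hdb : ‖db‖ ≤ C * s) :
    ‖-p ^ 2 - t - 2 * z₁ * p - Complex.I * h * A * p - 2 * Complex.I * h * (A - b) * z₀
      - 2 * Complex.I * h * A * z₁ - Complex.I * h * (p * b + db)‖
      ≤ 5 * C ^ 2 * (s ^ 2 + h * s + h * e + h ^ 2) := by
  have hC0 : 0 ≤ C := by linarith
  have n1 : ‖-p ^ 2‖ ≤ C ^ 2 * s ^ 2 := by
    rw [norm_neg, norm_pow, ← mul_pow]
    exact pow_le_pow_left₀ (norm_nonneg _) hp 2
  have n2 : ‖t‖ ≤ C ^ 2 * s ^ 2 := ht.trans (by gcongr; nlinarith)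
  have hI : ‖Complex.I * (h : ℂ)‖ = h := by simp [abs_of_nonneg hh]
  have n3 : ‖2 * z₁ * p‖ ≤ 2 * C ^ 2 * (h * s) := by
    rw [norm_mul, norm_mul, Complex.norm_two]
    calc 2 * ‖z₁‖ * ‖p‖ ≤ 2 * (C * h) * (C * s) := by gcongr
      _ = _ := by ring
  have n4 : ‖Complex.I * h * A * p‖ ≤ C ^ 2 * (h * s) := by
    rw [norm_mul, norm_mul, hI]
    calc h * ‖A‖ * ‖p‖ ≤ h * C * (C * s) := by gcongr
      _ = _ := by ring
  have n5 : ‖2 * Complex.I * h * (A - b) * z₀‖ ≤ 2 * C ^ 2 * (h * e) := by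
    rw [mul_assoc 2, norm_mul, norm_mul, norm_mul, hI, Complex.norm_two]
    calc 2 * h * ‖A - b‖ * ‖z₀‖ ≤ 2 * h * e * C := by gcongr
      _ = 2 * C * (h * e) := by ring
      _ ≤ 2 * C ^ 2 * (h * e) := by gcongr; nlinarith
  have n6 : ‖2 * Complex.I * h * A * z₁‖ ≤ 2 * C ^ 2 * h ^ 2 := by
    rw [mul_assoc 2, norm_mul, norm_mul, norm_mul, hI, Complex.norm_two]
    calc 2 * h * ‖A‖ * ‖z₁‖ ≤ 2 * h * C * (C * h) := by gcongr
      _ = _ := by ring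
  have n7 : ‖Complex.I * h * (p * b + db)‖ ≤ 2 * C ^ 2 * (h * s) := by
    rw [norm_mul, hI]
    have : ‖p * b + db‖ ≤ C * s * C + C * s := by
      refine (norm_add_le _ _).trans (add_le_add ?_ hdb)
      rw [norm_mul]
      gcongr
    calc h * ‖p * b + db‖ ≤ h * (C * s * C + C * s) := by gcongr
      _ = C ^ 2 * (h * s) + C * (h * s) := by ring
      _ ≤ C ^ 2 * (h * s) + C ^ 2 * (h * s) := by gcongr; nlinarith
      _ = _ := by ring
  have q1 : 0 ≤ C ^ 2 * s ^ 2 := by positivity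
  have q2 : 0 ≤ C ^ 2 * (h * e) := by positivity
  have q3 : 0 ≤ C ^ 2 * h ^ 2 := by positivity
  have e1 := norm_sub_le (-p ^ 2) t
  have e2 := norm_sub_le (-p ^ 2 - t) (2 * z₁ * p)
  have e3 := norm_sub_le (-p ^ 2 - t - 2 * z₁ * p) (Complex.I * h * A * p)
  have e4 := norm_sub_le (-p ^ 2 - t - 2 * z₁ * p - Complex.I * h * A * p)
    (2 * Complex.I * h * (A - b) * z₀)
  have e5 := norm_sub_le (-p ^ 2 - t - 2 * z₁ * p - Complex.I * h * A * p
    - 2 * Complex.I * h * (A - b) * z₀) (2 * Complex.I * h * A * z₁)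
  have e6 := norm_sub_le (-p ^ 2 - t - 2 * z₁ * p - Complex.I * h * A * p
    - 2 * Complex.I * h * (A - b) * z₀ - 2 * Complex.I * h * A * z₁)
    (Complex.I * h * (p * b + db))
  linarith

theorem integral_partialDeriv_eq_zero {f : RSpace n → ℂ} (hf : ContDiff ℝ ∞ f)
    (hfc : HasCompactSupport f) (j : Fin n) : ∫ x, partialDeriv j f x = 0 := by
  have hc := (contDiff_partialDeriv hf j).continuous
  have i1 := hc.integrable_of_hasCompactSupport (μ := volume) (hasCompactSupport_partialDeriv hfc j)
  have i2 := hf.continuous.integrable_of_hasCompactSupport (μ := volume) hfc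
  have h1 := integral_mul_fderiv_eq_neg_fderiv_mul_of_integrable (μ := volume)
    (f := fun _ : RSpace n => (1 : ℂ)) (g := f) (v := EuclideanSpace.single j (1 : ℝ))
    (by simp) (by simp only [one_mul]; exact i1) (by simpa using i2) (by fun_prop)
    (fun x _ => hf.differentiable (by norm_num) x)
  simpa [partialDeriv] using h1

theorem partialDeriv_cexp {f : RSpace n → ℂ} (hf : ContDiff ℝ ∞ f) (j : Fin n) (x : RSpace n) :
    partialDeriv j (fun y => Complex.exp (f y)) x = Complex.exp (f x) * partialDeriv j f x := by
  have h1 := ((hf.differentiable (by norm_num) x).hasFDerivAt).cexp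
  rw [partialDeriv, h1.fderiv]
  rfl

theorem partialDeriv_add' {f g : RSpace n → ℂ} (hf : ContDiff ℝ ∞ f) (hg : ContDiff ℝ ∞ g)
    (j : Fin n) (x : RSpace n) :
    partialDeriv j (fun y => f y + g y) x = partialDeriv j f x + partialDeriv j g x := by
  have h1 := ((hf.differentiable (by norm_num) x).hasFDerivAt).add
    ((hg.differentiable (by norm_num) x).hasFDerivAt)
  rw [partialDeriv, show (fun y => f y + g y) = f + g from rfl, h1.fderiv]
  rfl

theorem partialDeriv_mul' {f g : RSpace n → ℂ} (hf : ContDiff ℝ ∞ f) (hg : ContDiff ℝ ∞ g)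
    (j : Fin n) (x : RSpace n) :
    partialDeriv j (fun y => f y * g y) x = f x * partialDeriv j g x + partialDeriv j f x * g x :=
  by
  have h1 := ((hf.differentiable (by norm_num) x).hasFDerivAt).mul
    ((hg.differentiable (by norm_num) x).hasFDerivAt)
  rw [partialDeriv, show (fun y => f y * g y) = f * g from rfl, h1.fderiv]
  simp [partialDeriv, mul_comm]

theorem partialDeriv_const (c : ℂ) (j : Fin n) (x : RSpace n) :
    partialDeriv j (fun _ => c) x = 0 := by
  simp [partialDeriv]

/-- The amplitude `e^Φ` is an approximate solution, in the weak sense. -/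
theorem norm_integral_formDensity_amplitude_le {h s e C : ℝ} (hh : 0 ≤ h) (hs : 0 ≤ s) (he : 0 ≤ e)
    (hC : 1 ≤ C) {ζ₀ ζ₁ ζ : Fin n → ℂ} (hζ : ∀ j, ζ j = ζ₀ j + ζ₁ j)
    (hζζ : ∑ j, ζ j * ζ j = 0) (hζ₀ : ∀ j, ‖ζ₀ j‖ ≤ C) (hζ₁ : ∀ j, ‖ζ₁ j‖ ≤ C * h)
    {A b : Fin n → RSpace n → ℂ} {V Φ v : RSpace n → ℂ} (hΦ : ContDiff ℝ ∞ Φ)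
    (hb : ∀ j, ContDiff ℝ ∞ (b j)) (hv : ContDiff ℝ ∞ v) (hvc : HasCompactSupport v)
    (hΦ₀ : ∀ x, ‖Complex.exp (Φ x)‖ ≤ C) (hΦ₁ : ∀ j x, ‖h * partialDeriv j Φ x‖ ≤ C * s)
    (hΦ₂ : ∀ j x, ‖(h : ℂ) ^ 2 * partialDeriv j (partialDeriv j Φ) x‖ ≤ C * s ^ 2)
    (hA : ∀ j x, ‖A j x‖ ≤ C) (hb₀ : ∀ j x, ‖b j x‖ ≤ C)
    (hb₁ : ∀ j x, ‖h * partialDeriv j (b j) x‖ ≤ C * s) (hAb : ∀ j x, ‖A j x - b j x‖ ≤ e)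
    (hV : ∀ᵐ x, ‖V x‖ ≤ C)
    (hp : ∀ x, ∑ j, ζ₀ j * partialDeriv j Φ x = -Complex.I * ∑ j, ζ₀ j * b j x)
    (hint : Integrable fun x => formDensity h ζ (fun j => A j x) (V x) (Complex.exp (Φ x))
      (fun j => h * partialDeriv j (fun y => Complex.exp (Φ y)) x) (v x)
      (fun j => h * partialDeriv j v x)) :
    ‖∫ x, formDensity h ζ (fun j => A j x) (V x) (Complex.exp (Φ x))
      (fun j => h * partialDeriv j (fun y => Complex.exp (Φ y)) x) (v x)
      (fun j => h * partialDeriv j v x)‖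
      ≤ 6 * (n + 1) * C ^ 3 * (s ^ 2 + h * s + h * e + h ^ 2)
        * ∫ x, (‖v x‖ + ∑ j, ‖h * partialDeriv j v x‖) := by
  set q := s ^ 2 + h * s + h * e + h ^ 2 with hq
  have hC0 : 0 ≤ C := by linarith
  have ha : ContDiff ℝ ∞ fun y => Complex.exp (Φ y) := hΦ.cexp
  have hΦj : ∀ j, ContDiff ℝ ∞ (partialDeriv j Φ) := contDiff_partialDeriv hΦ
  -- the vector field whose divergence is subtracted
  set W : Fin n → RSpace n → ℂ := fun j x =>
    Complex.exp (Φ x) * (h * partialDeriv j Φ x + (ζ j + Complex.I * h * b j x)) with hW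
  have hW1 : ∀ j, ContDiff ℝ ∞ fun x => h * partialDeriv j Φ x + (ζ j + Complex.I * h * b j x) :=
    fun j => (contDiff_const.mul (hΦj j)).add (contDiff_const.add (contDiff_const.mul (hb j)))
  have hWs : ∀ j, ContDiff ℝ ∞ (W j) := fun j => ha.mul (hW1 j)
  have hWv : ∀ j, ContDiff ℝ ∞ fun x => W j x * v x := fun j => (hWs j).mul hv
  have hWvc : ∀ j, HasCompactSupport fun x => W j x * v x := fun j => hvc.mul_left
  have hX : ∀ j x, h * partialDeriv j (fun x => W j x * v x) x
      = Complex.exp (Φ x) * (h * partialDeriv j Φ x + ζ j + Complex.I * h * b j x)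
          * (h * partialDeriv j v x)
        + v x * (Complex.exp (Φ x) * (h * partialDeriv j Φ x
          * (h * partialDeriv j Φ x + ζ j + Complex.I * h * b j x)
          + (h : ℂ) ^ 2 * partialDeriv j (partialDeriv j Φ) x
          + Complex.I * h * (h * partialDeriv j (b j) x))) := by
    intro j x
    rw [partialDeriv_mul' (hWs j) hv, hW, partialDeriv_mul' ha (hW1 j), partialDeriv_cexp hΦ,
      partialDeriv_add' (contDiff_const.mul (hΦj j)) (contDiff_const.add
        (contDiff_const.mul (hb j))), partialDeriv_mul' contDiff_const (hΦj j),
      partialDeriv_add' contDiff_const (contDiff_const.mul (hb j)),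
      partialDeriv_mul' contDiff_const (hb j), partialDeriv_const, partialDeriv_const,
      partialDeriv_const]
    ring
  have hXi : ∀ j, Integrable fun x => h * partialDeriv j (fun x => W j x * v x) x := fun j =>
    ((contDiff_partialDeriv (hWv j) j).continuous.integrable_of_hasCompactSupport
      (hasCompactSupport_partialDeriv (hWvc j) j)).const_mul _
  have hX0 : ∫ x, ∑ j, h * partialDeriv j (fun x => W j x * v x) x = 0 := by
    rw [integral_finsetSum _ fun j _ => hXi j]
    refine Finset.sum_eq_zero fun j _ => ?_
    rw [integral_const_mul, integral_partialDeriv_eq_zero (hWv j) (hWvc j), mul_zero]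
  -- Subtracting the divergence removes the gradient of `v` from every term except the one with `A -
  -- b`. The field contains the smooth `b` in place of `A`, which cannot be differentiated.
  have hsub := integral_sub hint (integrable_finsetSum Finset.univ fun j _ => hXi j)
  rw [hX0, sub_zero] at hsub
  rw [← hsub, ← integral_const_mul]
  have hvi : Integrable fun x => ‖v x‖ + ∑ j, ‖h * partialDeriv j v x‖ :=
    (hv.continuous.integrable_of_hasCompactSupport hvc).norm.add
      (integrable_finsetSum _ fun j _ =>
        (((contDiff_partialDeriv hv j).continuous.integrable_of_hasCompactSupport
          (hasCompactSupport_partialDeriv hvc j)).const_mul _).norm)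
  refine norm_integral_le_of_norm_le (hvi.const_mul _) ?_
  filter_upwards [hV] with x hVx
  simp only [hX, partialDeriv_cexp hΦ]
  have hp' : ∑ j, ζ₀ j * (h * partialDeriv j Φ x) = -Complex.I * h * ∑ j, ζ₀ j * b j x := by
    calc ∑ j, ζ₀ j * (h * partialDeriv j Φ x) = h * ∑ j, ζ₀ j * partialDeriv j Φ x := by
          rw [Finset.mul_sum]
          exact Finset.sum_congr rfl fun j _ => by ring
      _ = _ := by rw [hp]; ring
  have key := formDensity_sub_divergence (h := h) (A := fun j => A j x) (V := V x)
    (a := Complex.exp (Φ x)) (v := v x) (dv := fun j => h * partialDeriv j v x)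
    (t := fun j => (h : ℂ) ^ 2 * partialDeriv j (partialDeriv j Φ) x)
    (db := fun j => h * partialDeriv j (b j) x) hζ hζζ hp'
  have hcomm : (fun j => (h : ℂ) * (Complex.exp (Φ x) * partialDeriv j Φ x))
      = fun j => Complex.exp (Φ x) * (h * partialDeriv j Φ x) := by
    ext j
    ring
  rw [hcomm, key]
  set S := ∑ j, ‖h * partialDeriv j v x‖
  have hS : 0 ≤ S := Finset.sum_nonneg fun _ _ => norm_nonneg _
  have hq0 : 0 ≤ q := by positivity
  have hhe : h * e ≤ q := by
    have : 0 ≤ s ^ 2 + h * s + h ^ 2 := by positivity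
    linarith
  have hh2 : h ^ 2 ≤ q := by
    have : 0 ≤ s ^ 2 + h * s + h * e := by positivity
    linarith
  have hterm : ∀ j, ‖Complex.I * h * Complex.exp (Φ x) * (A j x - b j x) * (h * partialDeriv j v x)
      + Complex.exp (Φ x) * v x * (-(h * partialDeriv j Φ x) ^ 2
        - (h : ℂ) ^ 2 * partialDeriv j (partialDeriv j Φ) x - 2 * ζ₁ j * (h * partialDeriv j Φ x)
        - Complex.I * h * A j x * (h * partialDeriv j Φ x)
        - 2 * Complex.I * h * (A j x - b j x) * ζ₀ j - 2 * Complex.I * h * A j x * ζ₁ j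
        - Complex.I * h * (h * partialDeriv j Φ x * b j x + h * partialDeriv j (b j) x))‖
      ≤ C * q * ‖h * partialDeriv j v x‖ + 5 * C ^ 3 * q * ‖v x‖ := by
    intro j
    refine (norm_add_le _ _).trans (add_le_add ?_ ?_)
    · have hI : ‖Complex.I * (h : ℂ)‖ = h := by simp [abs_of_nonneg hh]
      rw [norm_mul, norm_mul, norm_mul, hI]
      refine mul_le_mul_of_nonneg_right ?_ (norm_nonneg _)
      calc h * ‖Complex.exp (Φ x)‖ * ‖A j x - b j x‖ ≤ h * C * e := by
            gcongr
            · exact hΦ₀ x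
            · exact hAb j x
        _ = C * (h * e) := by ring
        _ ≤ C * q := by gcongr
    · rw [norm_mul, norm_mul]
      have := norm_remainder_coefficient_le hh hs he hC (hΦ₁ j x) (hΦ₂ j x) (hζ₁ j) (hA j x)
        (hb₀ j x) (hAb j x) (hζ₀ j) (hb₁ j x)
      calc _ ≤ C * ‖v x‖ * (5 * C ^ 2 * q) := by
            gcongr
            exact hΦ₀ x
        _ = _ := by ring
  have hVt : ‖(h : ℂ) ^ 2 * V x * Complex.exp (Φ x) * v x‖ ≤ C ^ 2 * q * ‖v x‖ := by
    rw [norm_mul, norm_mul, norm_mul, norm_pow, Complex.norm_real, Real.norm_eq_abs, sq_abs]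
    refine mul_le_mul_of_nonneg_right ?_ (norm_nonneg _)
    calc h ^ 2 * ‖V x‖ * ‖Complex.exp (Φ x)‖ ≤ q * C * C := by
          gcongr
          exact hΦ₀ x
      _ = _ := by ring
  have hsum : ∑ j, (C * q * ‖h * partialDeriv j v x‖ + 5 * C ^ 3 * q * ‖v x‖)
      = C * q * S + n * (5 * C ^ 3 * q * ‖v x‖) := by
    rw [Finset.sum_add_distrib, ← Finset.mul_sum, Finset.sum_const, Finset.card_univ,
      Fintype.card_fin, nsmul_eq_mul]
  refine (norm_add_le _ _).trans ((add_le_add ((norm_sum_le _ _).trans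
    (Finset.sum_le_sum fun j _ => hterm j)) hVt).trans ?_)
  rw [hsum]
  have c1 : C ≤ C ^ 3 := le_self_pow₀ hC (by norm_num)
  have c2 : C ^ 2 ≤ C ^ 3 := pow_le_pow_right₀ hC (by norm_num)
  have t1 : C * q * S ≤ C ^ 3 * q * S := by gcongr
  have t2 : C ^ 2 * q * ‖v x‖ ≤ C ^ 3 * q * ‖v x‖ := by gcongr
  have t3 : 0 ≤ C ^ 3 * q * ‖v x‖ := by positivity
  have t4 : 0 ≤ C ^ 3 * q * S := by positivity
  have t5 : 0 ≤ (n : ℝ) * (C ^ 3 * q * ‖v x‖) := by positivity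
  have t6 : 0 ≤ (n : ℝ) * (C ^ 3 * q * S) := by positivity
  nlinarith

/-! ### Test functions and weak derivatives on `Ω`. -/

theorem integral_norm_sq_L2 (f : L2 n) : ∫ x, ‖f x‖ ^ 2 = ‖f‖ ^ 2 := by
  have h1 := L2.inner_def (𝕜 := ℂ) f f
  rw [inner_self_eq_norm_sq_to_K] at h1
  have h2 : ∀ x, ⟪f x, f x⟫_ℂ = ((‖f x‖ ^ 2 : ℝ) : ℂ) := fun x => by
    rw [inner_self_eq_norm_sq_to_K]
    push_cast
    rfl
  simp only [h2] at h1
  rw [integral_complex_ofReal] at h1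
  rw [← Complex.ofReal_inj, ← h1]
  push_cast
  rfl

theorem integrable_norm_sq_L2 (f : L2 n) : Integrable fun x => ‖f x‖ ^ 2 :=
  (Lp.memLp f).norm.integrable_sq

/-- Cauchy–Schwarz on the ball, with the square root of the volume `m` replaced by `(m + 1)/2`; the
proof integrates `2 N |g| ≤ N² + |g|²`. -/
theorem integral_norm_le_of_mem_suppS {R : ℝ} {g : Sch n} (hg : g ∈ suppS n R) :
    ∫ x, ‖g x‖ ≤ (volume.real (Metric.closedBall (0 : RSpace n) R) + 1) / 2 * ‖toL2 g‖ := by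
  set N := ‖toL2 g‖ with hN
  have h2 : ∫ x, ‖g x‖ ^ 2 = N ^ 2 := by
    rw [hN, ← integral_norm_sq_L2]
    refine integral_congr_ae ?_
    filter_upwards [coeFn_toL2 g] with x hx
    rw [hx]
  have hi2 : Integrable fun x => ‖g x‖ ^ 2 := (integrable_norm_sq_L2 (toL2 g)).congr (by
    filter_upwards [coeFn_toL2 g] with x hx
    rw [hx])
  rcases eq_or_lt_of_le (norm_nonneg (toL2 g)) with h0 | h0
  · have h1 : toL2 g = 0 := norm_eq_zero.mp h0.symm
    have h3 : ∀ᵐ x, ‖g x‖ = 0 := by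
      filter_upwards [coeFn_toL2 g, Lp.coeFn_zero ℂ 2 (volume : Measure (RSpace n))] with x hx hx'
      rw [← hx, h1, hx']
      simp
    rw [integral_congr_ae h3, hN, ← h0]
    simp
  · have hb : Integrable ((Metric.closedBall (0 : RSpace n) R).indicator fun _ => (1 : ℝ)) :=
      (integrable_indicator_iff Metric.isClosed_closedBall.measurableSet).mpr
        (integrableOn_const measure_closedBall_lt_top.ne (by simp))
    have hbI : ∫ x, (Metric.closedBall (0 : RSpace n) R).indicator (fun _ => (1 : ℝ)) x
        = volume.real (Metric.closedBall (0 : RSpace n) R) := by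
      rw [integral_indicator Metric.isClosed_closedBall.measurableSet]
      simp
    have h4 : ∫ x, N * ‖g x‖ ≤ ∫ x, ((N ^ 2 / 2)
        * (Metric.closedBall (0 : RSpace n) R).indicator (fun _ => (1 : ℝ)) x
        + (1 / 2) * ‖g x‖ ^ 2) := by
      refine integral_mono_of_nonneg (.of_forall fun x => by positivity)
        ((hb.const_mul _).add (hi2.const_mul _)) (.of_forall fun x => ?_)
      by_cases hx : ‖x‖ ≤ R
      · simp only [Set.indicator_of_mem (show x ∈ Metric.closedBall 0 R by simpa using hx)]
        nlinarith [sq_nonneg (N - ‖g x‖)]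
      · simp only [Set.indicator_of_notMem (show x ∉ Metric.closedBall 0 R by simpa using hx),
          hg x (not_le.mp hx)]
        simp
    rw [integral_const_mul, integral_add (hb.const_mul _) (hi2.const_mul _), integral_const_mul,
      integral_const_mul, hbI, h2] at h4
    refine le_of_mul_le_mul_left ?_ h0
    linarith

theorem IsTestFunction.mul_left {Ω : Set (RSpace n)} {m ψ : RSpace n → ℂ}
    (hψ : IsTestFunction Ω ψ) (hm : ContDiff ℝ ∞ m) : IsTestFunction Ω fun x => m x * ψ x :=
  ⟨hm.mul hψ.smooth, hψ.hasCompactSupport.mul_left,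
    (tsupport_mul_subset_right (f := m) (g := ψ)).trans hψ.tsupport_subset⟩

theorem IsTestFunction.eq_zero {Ω : Set (RSpace n)} {ψ : RSpace n → ℂ} (hψ : IsTestFunction Ω ψ)
    {x : RSpace n} (hx : x ∉ Ω) : ψ x = 0 :=
  image_eq_zero_of_notMem_tsupport fun h => hx (hψ.tsupport_subset h)

theorem IsTestFunction.partialDeriv {Ω : Set (RSpace n)} {ψ : RSpace n → ℂ}
    (hψ : IsTestFunction Ω ψ) (j : Fin n) : IsTestFunction Ω (partialDeriv j ψ) :=
  ⟨contDiff_partialDeriv hψ.smooth j, hasCompactSupport_partialDeriv hψ.hasCompactSupport j,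
    ((closure_mono fun x hx => by
      by_contra h
      refine hx ?_
      change fderiv ℝ ψ x _ = 0
      rw [Function.notMem_support.mp fun h' => h (support_fderiv_subset ℝ h')]
      rfl).trans (isClosed_tsupport ψ).closure_eq.subset).trans hψ.tsupport_subset⟩

theorem IsTestFunction.memLp {Ω : Set (RSpace n)} {ψ : RSpace n → ℂ}
    (hψ : IsTestFunction Ω ψ) (p : ℝ≥0∞) (μ : Measure (RSpace n)) [IsFiniteMeasureOnCompacts μ] :
    MemLp ψ p μ :=
  hψ.smooth.continuous.memLp_of_hasCompactSupport hψ.hasCompactSupport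

theorem memLp_restrict_of_continuous {Ω : Set (RSpace n)} (hΩ : Bornology.IsBounded Ω)
    {E : Type*} [NormedAddCommGroup E] [SecondCountableTopologyEither (RSpace n) E]
    {m : RSpace n → E} (hm : Continuous m) (p : ℝ≥0∞) : MemLp m p (volume.restrict Ω) := by
  have : IsFiniteMeasure (volume.restrict Ω) :=
    ⟨by rw [Measure.restrict_apply_univ]; exact hΩ.measure_lt_top⟩
  obtain ⟨M, hM⟩ := hΩ.isCompact_closure.exists_bound_of_continuousOn hm.continuousOn
  have h1 : ∀ᵐ x ∂(volume.restrict (closure Ω)), ‖m x‖ ≤ M :=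
    ae_restrict_of_forall_mem isClosed_closure.measurableSet hM
  exact MemLp.of_bound hm.aestronglyMeasurable M
    (ae_mono (Measure.restrict_mono subset_closure le_rfl) h1)

theorem continuous_gradC {f : RSpace n → ℂ} (hf : ContDiff ℝ ∞ f) : Continuous (gradC f) := by
  unfold gradC
  have := fun j => (contDiff_partialDeriv hf j).continuous
  exact (PiLp.continuous_toLp 2 _).comp (continuous_pi this)

section H1

variable {Ω : Set (RSpace n)}

theorem isH1With_of_contDiff (hΩb : Bornology.IsBounded Ω) {a : RSpace n → ℂ}
    (ha : ContDiff ℝ ∞ a) : IsH1With Ω a (gradC a) where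
  memLp := memLp_restrict_of_continuous hΩb ha.continuous 2
  memLp_grad := memLp_restrict_of_continuous hΩb (continuous_gradC ha) 2
  weak_grad := by
    intro ψ hψ j
    have h1 := integral_partialDeriv_eq_zero (hψ.mul_left ha).smooth
      (hψ.mul_left ha).hasCompactSupport j
    simp only [partialDeriv_mul' ha hψ.smooth] at h1
    have i1 : Integrable fun x => a x * partialDeriv j ψ x :=
      (memLp_one_iff_integrable.mp (((hψ.partialDeriv j).mul_left ha).memLp 1 volume))
    have i2 : Integrable fun x => partialDeriv j a x * ψ x :=
      (memLp_one_iff_integrable.mp ((hψ.mul_left (contDiff_partialDeriv ha j)).memLp 1 volume))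
    rw [integral_add i1 i2] at h1
    rw [setIntegral_eq_integral_of_forall_compl_eq_zero fun x hx => by
        rw [(hψ.partialDeriv j).eq_zero hx, mul_zero],
      setIntegral_eq_integral_of_forall_compl_eq_zero fun x hx => by rw [hψ.eq_zero hx, mul_zero]]
    exact eq_neg_of_add_eq_zero_left h1

namespace IsH1With

variable {u v : RSpace n → ℂ} {G H : RSpace n → CSpace n}

theorem integrable_mul (hu : IsH1With Ω u G) {ψ : RSpace n → ℂ} (hψ : IsTestFunction Ω ψ) :
    IntegrableOn (fun x => u x * ψ x) Ω :=
  hu.memLp.integrable_mul (hψ.memLp 2 _)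

theorem integrable_grad_mul (hu : IsH1With Ω u G) {ψ : RSpace n → ℂ} (hψ : IsTestFunction Ω ψ)
    (j : Fin n) : IntegrableOn (fun x => G x j * ψ x) Ω :=
  (hu.memLp_grad.eval_piLp j).integrable_mul (hψ.memLp 2 _)

theorem add (hu : IsH1With Ω u G) (hv : IsH1With Ω v H) :
    IsH1With Ω (fun x => u x + v x) fun x => G x + H x where
  memLp := hu.memLp.add hv.memLp
  memLp_grad := hu.memLp_grad.add hv.memLp_grad
  weak_grad := by
    intro ψ hψ j
    have hψ' := hψ.partialDeriv j
    simp only [PiLp.add_apply, add_mul]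
    rw [integral_add (hu.integrable_mul hψ') (hv.integrable_mul hψ'),
      integral_add (hu.integrable_grad_mul hψ j) (hv.integrable_grad_mul hψ j),
      hu.weak_grad ψ hψ j, hv.weak_grad ψ hψ j, neg_add]

theorem smooth_mul (hΩb : Bornology.IsBounded Ω) (hu : IsH1With Ω u G) {m : RSpace n → ℂ}
    (hm : ContDiff ℝ ∞ m) :
    IsH1With Ω (fun x => m x * u x) fun x => m x • G x + u x • gradC m x where
  memLp := hu.memLp.mul (memLp_restrict_of_continuous hΩb hm.continuous ∞)
  memLp_grad := (hu.memLp_grad.smul (memLp_restrict_of_continuous hΩb hm.continuous ∞)).add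
    ((memLp_restrict_of_continuous hΩb (continuous_gradC hm) ∞).smul hu.memLp)
  weak_grad := by
    intro ψ hψ j
    have h1 := hu.weak_grad _ (hψ.mul_left hm) j
    simp only [partialDeriv_mul' hm hψ.smooth, mul_add] at h1
    rw [integral_add (hu.integrable_mul ((hψ.partialDeriv j).mul_left hm))
      (hu.integrable_mul (hψ.mul_left (contDiff_partialDeriv hm j)))] at h1
    have e1 : ∫ x in Ω, (m x • G x + u x • gradC m x) j * ψ x
        = (∫ x in Ω, G x j * (m x * ψ x)) + ∫ x in Ω, u x * (partialDeriv j m x * ψ x) := by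
      rw [← integral_add (hu.integrable_grad_mul (hψ.mul_left hm) j)
        (hu.integrable_mul (hψ.mul_left (contDiff_partialDeriv hm j)))]
      congr 1
      ext x
      simp only [PiLp.add_apply, PiLp.smul_apply, smul_eq_mul, gradC]
      ring
    have e2 : ∫ x in Ω, m x * u x * partialDeriv j ψ x
        = ∫ x in Ω, u x * (m x * partialDeriv j ψ x) := by
      congr 1
      ext x
      ring
    rw [e1, e2]
    linear_combination h1

end IsH1With

/-- Test functions in `Ω` as a subspace of the Schwartz space. -/
def testS (Ω : Set (RSpace n)) : Submodule ℂ (Sch n) where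
  carrier := {g | IsTestFunction Ω g}
  add_mem' := fun {f g} hf hg => ⟨hf.smooth.add hg.smooth,
    hf.hasCompactSupport.add hg.hasCompactSupport,
    (tsupport_add f g).trans (Set.union_subset hf.tsupport_subset hg.tsupport_subset)⟩
  zero_mem' := ⟨contDiff_const, HasCompactSupport.zero, by simp [tsupport]⟩
  smul_mem' := fun c g hg => hg.mul_left contDiff_const

theorem testS_le_suppS {R : ℝ} (hΩ : Ω ⊆ Metric.closedBall 0 R) : testS Ω ≤ suppS n R := by
  intro g hg x hx
  refine IsTestFunction.eq_zero hg fun h => ?_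
  have := hΩ h
  rw [mem_closedBall_zero_iff] at this
  linarith

/-- A test function as a Schwartz function. -/
def IsTestFunction.toSch {ψ : RSpace n → ℂ} (hψ : IsTestFunction Ω ψ) : Sch n :=
  hψ.hasCompactSupport.toSchwartzMap hψ.smooth

theorem IsTestFunction.coe_toSch {ψ : RSpace n → ℂ} (hψ : IsTestFunction Ω ψ) :
    ⇑hψ.toSch = ψ := rfl

theorem IsTestFunction.toSch_mem {ψ : RSpace n → ℂ} (hψ : IsTestFunction Ω ψ) :
    hψ.toSch ∈ testS Ω := hψ

theorem isH1With_of_mem_h1Space {h : ℝ} (hh : 0 < h) {R : Jet n} (hR : R ∈ h1Space n h) :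
    IsH1With Ω (R none) fun x => WithLp.toLp 2 fun j => (h : ℂ)⁻¹ * R (some j) x where
  memLp := (Lp.memLp (R none)).restrict Ω
  memLp_grad := MemLp.of_eval_piLp fun j => ((Lp.memLp (R (some j))).restrict Ω).const_mul _
  weak_grad := by
    intro ψ hψ j
    have hh' : (h : ℂ) ≠ 0 := Complex.ofReal_ne_zero.mpr hh.ne'
    have h1 := mem_h1Space.mp hR hψ.toSch j
    rw [← (hasIntegral_pair_toL2 _ (R none)).2, ← (hasIntegral_pair_toL2 _ (R (some j))).2] at h1
    simp only [dh_apply, hψ.coe_toSch] at h1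
    rw [setIntegral_eq_integral_of_forall_compl_eq_zero fun x hx => by
        rw [(hψ.partialDeriv j).eq_zero hx, mul_zero],
      setIntegral_eq_integral_of_forall_compl_eq_zero fun x hx => by rw [hψ.eq_zero hx, mul_zero]]
    have e1 : ∫ x, h * partialDeriv j ψ x * R none x
        = h * ∫ x, R none x * partialDeriv j ψ x := by
      rw [← integral_const_mul]
      congr 1
      ext x
      ring
    have e2 : ∫ x, (WithLp.toLp 2 fun j => (h : ℂ)⁻¹ * R (some j) x : CSpace n) j * ψ x
        = (h : ℂ)⁻¹ * ∫ x, ψ x * R (some j) x := by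
      rw [← integral_const_mul]
      congr 1
      ext x
      change (h : ℂ)⁻¹ * R (some j) x * ψ x = _
      ring
    rw [e1] at h1
    rw [e2]
    field_simp
    linear_combination h1

end H1

/-! ### Exponential weights and construction of the solution for fixed `h`. -/

/-- The convexifying weight `e^{κ (α · x)² / 2}`. -/
def weight (κ : ℝ) (α x : RSpace n) : ℂ := Complex.exp ((κ * ⟪α, x⟫_ℝ ^ 2 / 2 : ℝ) : ℂ)

theorem weight_neg (κ : ℝ) (α x : RSpace n) : weight (-κ) α x = (weight κ α x)⁻¹ := by
  rw [weight, weight, ← Complex.exp_neg]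
  congr 1
  push_cast
  ring

theorem weight_ne_zero (κ : ℝ) (α x : RSpace n) : weight κ α x ≠ 0 := Complex.exp_ne_zero _

theorem contDiff_weightExponent (κ : ℝ) (α : RSpace n) :
    ContDiff ℝ ∞ fun x : RSpace n => ((κ * ⟪α, x⟫_ℝ ^ 2 / 2 : ℝ) : ℂ) :=
  Complex.ofRealCLM.contDiff.comp
    ((contDiff_const.mul ((contDiff_const.inner ℝ contDiff_id).pow 2)).div_const 2)

theorem contDiff_weight (κ : ℝ) (α : RSpace n) : ContDiff ℝ ∞ (weight κ α) :=
  (contDiff_weightExponent κ α).cexp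

theorem partialDeriv_weight (κ : ℝ) (α : RSpace n) (j : Fin n) (x : RSpace n) :
    partialDeriv j (weight κ α) x = weight κ α x * ((κ * ⟪α, x⟫_ℝ * α j : ℝ) : ℂ) := by
  have h1 : HasFDerivAt (fun x : RSpace n => κ * ⟪α, x⟫_ℝ ^ 2 / 2)
      ((κ * ⟪α, x⟫_ℝ) • innerSL ℝ α) x := by
    have h2 := ((((innerSL ℝ α).hasFDerivAt (x := x)).pow 2).const_mul κ).mul_const (2⁻¹ : ℝ)
    refine (h2.congr_fderiv ?_)
    ext v
    simp
    ring
  have h3 := Complex.ofRealCLM.hasFDerivAt.comp x h1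
  have h4 : partialDeriv j (fun x : RSpace n => ((κ * ⟪α, x⟫_ℝ ^ 2 / 2 : ℝ) : ℂ)) x
      = ((κ * ⟪α, x⟫_ℝ * α j : ℝ) : ℂ) := by
    have h5 : fderiv ℝ (fun x : RSpace n => ((κ * ⟪α, x⟫_ℝ ^ 2 / 2 : ℝ) : ℂ)) x = _ := h3.fderiv
    rw [partialDeriv, h5]
    simp [EuclideanSpace.inner_single_right]
  rw [← h4]
  exact partialDeriv_cexp (contDiff_weightExponent κ α) j x

theorem norm_weight (κ : ℝ) (α x : RSpace n) :
    ‖weight κ α x‖ = Real.exp (κ * ⟪α, x⟫_ℝ ^ 2 / 2) := by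
  rw [weight, Complex.norm_exp, Complex.ofReal_re]

/-- The linear phase `x · ζ / h`. -/
def linPhase (ζ : CSpace n) (h : ℝ) : RSpace n →L[ℝ] ℂ :=
  ∑ j, (EuclideanSpace.proj j : RSpace n →L[ℝ] ℝ).smulRight (ζ j / (h : ℂ))

theorem linPhase_apply (ζ : CSpace n) (h : ℝ) (x : RSpace n) :
    linPhase ζ h x = cdot (toC x) ζ / (h : ℂ) := by
  simp [linPhase, cdot, toC, Finset.sum_div, mul_div_assoc]

theorem partialDeriv_linPhase (ζ : CSpace n) (h : ℝ) (j : Fin n) (x : RSpace n) :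
    partialDeriv j (linPhase ζ h) x = ζ j / h := by
  rw [partialDeriv, ContinuousLinearMap.fderiv]
  simp [linPhase]

/-- The exponential `e^{x · ζ / h + κ (Re ζ · x)² / 2}`. -/
def carrier (ζ : CSpace n) (h κ : ℝ) (x : RSpace n) : ℂ :=
  Complex.exp (linPhase ζ h x) * weight κ (reVec ζ) x

theorem contDiff_carrier (ζ : CSpace n) (h κ : ℝ) : ContDiff ℝ ∞ (carrier ζ h κ) :=
  (linPhase ζ h).contDiff.cexp.mul (contDiff_weight κ _)

theorem mul_partialDeriv_carrier {h : ℝ} (hh : h ≠ 0) (ζ : CSpace n) (κ : ℝ) (j : Fin n)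
    (x : RSpace n) : h * partialDeriv j (carrier ζ h κ) x
      = carrier ζ h κ x * phaseGrad h κ (reVec ζ) (imVec ζ) j x := by
  have hh' : (h : ℂ) ≠ 0 := Complex.ofReal_ne_zero.mpr hh
  have h1 : carrier ζ h κ = fun x => Complex.exp (linPhase ζ h x) * weight κ (reVec ζ) x := rfl
  have h2 : ζ j = reVec ζ j + Complex.I * imVec ζ j := by
    rw [mul_comm]
    exact (Complex.re_add_im (ζ j)).symm
  rw [h1, partialDeriv_mul' (linPhase ζ h).contDiff.cexp (contDiff_weight κ _),
    partialDeriv_cexp (linPhase ζ h).contDiff, partialDeriv_linPhase, partialDeriv_weight,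
    phaseGrad, convexFactor, h2]
  push_cast
  field_simp
  ring

/-- The components of the semiclassical gradient of the exponent of the weight. -/
def weightGrad (h κ : ℝ) (α : RSpace n) (j : Fin n) (x : RSpace n) : ℂ :=
  ((h * κ * ⟪α, x⟫_ℝ * α j : ℝ) : ℂ)

theorem phaseGrad_eq_add_weightGrad (h κ : ℝ) (ζ : CSpace n) (j : Fin n) (x : RSpace n) :
    phaseGrad h κ (reVec ζ) (imVec ζ) j x = ζ j + weightGrad h κ (reVec ζ) j x := by
  have h2 : ζ j = reVec ζ j + Complex.I * imVec ζ j := by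
    rw [mul_comm]
    exact (Complex.re_add_im (ζ j)).symm
  rw [phaseGrad, convexFactor, weightGrad]
  conv_rhs => rw [h2]
  push_cast
  ring

theorem mul_partialDeriv_weight_mul (h κ : ℝ) (α : RSpace n) {f : RSpace n → ℂ}
    (hf : ContDiff ℝ ∞ f) (j : Fin n) (x : RSpace n) :
    h * partialDeriv j (fun y => weight κ α y * f y) x
      = weight κ α x * (h * partialDeriv j f x + weightGrad h κ α j x * f x) := by
  rw [partialDeriv_mul' (contDiff_weight κ α) hf, partialDeriv_weight, weightGrad]
  push_cast
  ring

theorem weightGrad_neg (h κ : ℝ) (α : RSpace n) (j : Fin n) (x : RSpace n) :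
    weightGrad h (-κ) α j x = -weightGrad h κ α j x := by
  rw [weightGrad, weightGrad]
  push_cast
  ring

theorem norm_weightGrad_le {h κ R : ℝ} {α β : RSpace n} (H : IsAdmissible h κ (R + 1) α β)
    (j : Fin n) {x : RSpace n} (hx : ‖x‖ ≤ R) : ‖weightGrad h κ α j x‖ ≤ 1 := by
  have hκ := H.κ_pos
  have hh := H.h_pos
  have hR := H.hκR_le
  have hR0 : 0 ≤ R := (norm_nonneg x).trans hx
  have h1 : |⟪α, x⟫_ℝ| ≤ 2 * R := (abs_real_inner_le_norm α x).trans
    (mul_le_mul H.α_le hx (norm_nonneg x) (by norm_num))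
  rw [weightGrad, Complex.norm_real, Real.norm_eq_abs, abs_mul, abs_mul, abs_of_pos (mul_pos hh hκ)]
  calc h * κ * |⟪α, x⟫_ℝ| * |α j| ≤ h * κ * (2 * R) * 2 := by
        gcongr
        exact (norm_coord_le α j).trans H.α_le
    _ ≤ h * κ * (2 * (R + 1)) * 2 := by gcongr; linarith
    _ ≤ 1 := by linarith

/-- A continuous function, truncated to a ball, pairs with test functions like the function. -/
theorem exists_jet_hasIntegral_formDensity {h κ R : ℝ} {α β : RSpace n}
    {A : Fin n → RSpace n → ℂ} {V : RSpace n → ℂ} (hA : ∀ j, MemLp (A j) ∞ volume)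
    (hV : MemLp V ∞ volume) {c : RSpace n → ℂ} (hc : ContDiff ℝ ∞ c) :
    ∃ k : Jet n, ∀ g ∈ suppS n R, HasIntegral (fun x => formDensity h
      (fun j => phaseGrad h κ α β j x) (fun j => A j x) (V x) (c x)
      (fun j => h * partialDeriv j c x) (g x) (fun j => h * partialDeriv j g x))
      (pairJ ((principalJet h κ α β + (h : ℂ) • lowerJet h κ α β hA hV) g) k) := by
  have hmem : ∀ f : RSpace n → ℂ, Continuous f →
      MemLp ((Metric.closedBall (0 : RSpace n) R).indicator f) 2 volume := fun f hf =>
    (memLp_indicator_iff_restrict Metric.isClosed_closedBall.measurableSet).mpr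
      (memLp_restrict_of_continuous Metric.isBounded_closedBall hf 2)
  have hcj : ∀ j, Continuous fun x => h * partialDeriv j c x := fun j =>
    continuous_const.mul (contDiff_partialDeriv hc j).continuous
  -- The truncated tuple is in general not the jet of an `H¹` function; the pairing formula holds
  -- for arbitrary tuples.
  refine ⟨WithLp.toLp 2 fun i => i.elim ((hmem c hc.continuous).toLp _)
    fun j => (hmem _ (hcj j)).toLp _, fun g hg => (hasIntegral_formDensity hA hV g _).congr ?_⟩
  have h1 : ∀ᵐ x, ∀ j, (hmem _ (hcj j)).toLp _ x
      = (Metric.closedBall (0 : RSpace n) R).indicator (fun x => h * partialDeriv j c x) x :=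
    ae_all_iff.mpr fun j => (hmem _ (hcj j)).coeFn_toLp
  filter_upwards [(hmem c hc.continuous).coeFn_toLp, h1] with x hx hx'
  simp only [Option.elim_none, Option.elim_some, hx, hx']
  by_cases hxR : ‖x‖ ≤ R
  · simp only [Set.indicator_of_mem (show x ∈ Metric.closedBall 0 R by simpa using hxR)]
  · have hz : ∀ j, partialDeriv j g x = 0 := fun j =>
      partialDeriv_eq_zero_of_norm_lt hg j x (not_le.mp hxR)
    simp [formDensity, hg x (not_le.mp hxR), hz]

/-- The weak `H¹` norm of a weighted function. -/
theorem sclH1Norm_weight_smul_le {Ω : Set (RSpace n)} {h κ R : ℝ} {α β : RSpace n}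
    (H : IsAdmissible h κ (R + 1) α β) (hΩm : MeasurableSet Ω) (hΩR : Ω ⊆ Metric.closedBall 0 R)
    (ρ : Jet n) :
    sclH1Norm Ω h (fun x => weight κ α x * ρ none x) (fun x =>
      weight κ α x • (WithLp.toLp 2 fun j => (h : ℂ)⁻¹ * ρ (some j) x : CSpace n)
        + ρ none x • gradC (weight κ α) x)
      ≤ Real.exp (2 * κ * R ^ 2) * Real.sqrt (2 * n + 2) * ‖ρ‖ := by
  have hh' : (h : ℂ) ≠ 0 := Complex.ofReal_ne_zero.mpr H.h_pos.ne'
  set W := Real.exp (2 * κ * R ^ 2) with hW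
  have hR0 : ∀ x ∈ Ω, ‖x‖ ≤ R := fun x hx => by simpa using hΩR hx
  have hw : ∀ x ∈ Ω, ‖weight κ α x‖ ≤ W := by
    intro x hx
    rw [norm_weight, hW]
    refine Real.exp_le_exp.mpr ?_
    have h1 : |⟪α, x⟫_ℝ| ≤ 2 * R := (abs_real_inner_le_norm α x).trans
      (mul_le_mul H.α_le (hR0 x hx) (norm_nonneg x) (by norm_num))
    have h2 : ⟪α, x⟫_ℝ ^ 2 ≤ (2 * R) ^ 2 := by
      rw [← sq_abs]
      exact pow_le_pow_left₀ (abs_nonneg _) h1 2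
    have := mul_le_mul_of_nonneg_left h2 H.κ_pos.le
    linarith
  have hsq : ∀ f : L2 n, ∫ x in Ω, ‖f x‖ ^ 2 ≤ ‖f‖ ^ 2 := fun f => by
    rw [← integral_norm_sq_L2]
    exact setIntegral_le_integral (integrable_norm_sq_L2 f) (.of_forall fun x => by positivity)
  have hi : ∀ f : L2 n, IntegrableOn (fun x => ‖f x‖ ^ 2) Ω := fun f =>
    (integrable_norm_sq_L2 f).integrableOn
  have b1 : ∫ x in Ω, ‖weight κ α x * ρ none x‖ ^ 2 ≤ W ^ 2 * ‖ρ none‖ ^ 2 := by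
    refine (integral_mono_of_nonneg (.of_forall fun x => by positivity)
      ((hi (ρ none)).const_mul (W ^ 2)) ?_).trans ?_
    · refine ae_restrict_of_forall_mem hΩm fun x hx => ?_
      simp only
      rw [norm_mul, mul_pow]
      gcongr
      exact hw x hx
    · rw [integral_const_mul]
      gcongr
      exact hsq _
  have b2 : ∫ x in Ω, ‖((h : ℂ) * -Complex.I) •
      (weight κ α x • (WithLp.toLp 2 fun j => (h : ℂ)⁻¹ * ρ (some j) x : CSpace n)
        + ρ none x • gradC (weight κ α) x)‖ ^ 2
      ≤ W ^ 2 * ∑ j, (2 * ‖ρ (some j)‖ ^ 2 + 2 * ‖ρ none‖ ^ 2) := by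
    have hij : ∀ j, IntegrableOn (fun x => 2 * ‖ρ (some j) x‖ ^ 2 + 2 * ‖ρ none x‖ ^ 2) Ω :=
      fun j => ((hi (ρ (some j))).const_mul 2).add ((hi (ρ none)).const_mul 2)
    have hint : IntegrableOn (fun x => W ^ 2 * ∑ j, (2 * ‖ρ (some j) x‖ ^ 2 + 2 * ‖ρ none x‖ ^ 2))
        Ω := (integrable_finsetSum _ fun j _ => hij j).const_mul _
    refine (integral_mono_of_nonneg (.of_forall fun x => by positivity) hint ?_).trans ?_
    · refine ae_restrict_of_forall_mem hΩm fun x hx => ?_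
      simp only
      rw [EuclideanSpace.norm_sq_eq, Finset.mul_sum]
      refine Finset.sum_le_sum fun j _ => ?_
      have e1 : (((h : ℂ) * -Complex.I) •
          (weight κ α x • (WithLp.toLp 2 fun j => (h : ℂ)⁻¹ * ρ (some j) x : CSpace n)
            + ρ none x • gradC (weight κ α) x)) j
          = -Complex.I * (weight κ α x * (ρ (some j) x + weightGrad h κ α j x * ρ none x)) := by
        simp only [PiLp.smul_apply, PiLp.add_apply, smul_eq_mul, gradC, partialDeriv_weight,
          weightGrad]
        push_cast
        field_simp
      rw [e1, norm_mul, norm_neg, Complex.norm_I, one_mul, norm_mul, mul_pow]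
      have e2 : ‖ρ (some j) x + weightGrad h κ α j x * ρ none x‖
          ≤ ‖ρ (some j) x‖ + ‖ρ none x‖ := by
        refine (norm_add_le _ _).trans (add_le_add le_rfl ?_)
        rw [norm_mul]
        exact mul_le_of_le_one_left (norm_nonneg _) (norm_weightGrad_le H j (hR0 x hx))
      have e3 := pow_le_pow_left₀ (norm_nonneg _) e2 2
      have e4 : ‖ρ (some j) x + weightGrad h κ α j x * ρ none x‖ ^ 2
          ≤ 2 * ‖ρ (some j) x‖ ^ 2 + 2 * ‖ρ none x‖ ^ 2 := by
        nlinarith [sq_nonneg (‖ρ (some j) x‖ - ‖ρ none x‖)]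
      gcongr
      exact hw x hx
    · rw [integral_const_mul, integral_finsetSum _ fun j _ => hij j]
      gcongr with j
      rw [integral_add ((hi (ρ (some j))).const_mul 2) ((hi (ρ none)).const_mul 2),
        integral_const_mul, integral_const_mul]
      gcongr
      · exact hsq _
      · exact hsq _
  rw [sclH1Norm]
  refine Real.sqrt_le_iff.mpr ⟨by positivity, (add_le_add b1 b2).trans ?_⟩
  rw [mul_pow, mul_pow, Real.sq_sqrt (by positivity), norm_sq_jet, Finset.sum_add_distrib,
    ← Finset.mul_sum, Finset.sum_const, Finset.card_univ, Fintype.card_fin, nsmul_eq_mul]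
  have s0 : 0 ≤ ∑ j, ‖ρ (some j)‖ ^ 2 := Finset.sum_nonneg fun _ _ => by positivity
  have s1 : 0 ≤ (n : ℝ) * ∑ j, ‖ρ (some j)‖ ^ 2 := by positivity
  have s2 : 0 ≤ ‖ρ none‖ ^ 2 := by positivity
  rw [mul_assoc, ← mul_add]
  gcongr
  nlinarith

/-- Moving the inverse weight from the amplitude to the test function restores the linear phase with
constant gradient `ζ`, for which `ζ·ζ = 0` and the transport equation can be used. -/
theorem formDensity_weight_mul {h κ : ℝ} (ζ : CSpace n) (A : Fin n → ℂ) (V : ℂ)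
    {a g : RSpace n → ℂ} (ha : ContDiff ℝ ∞ a) (hg : ContDiff ℝ ∞ g) (x : RSpace n) :
    formDensity h (fun j => phaseGrad h κ (reVec ζ) (imVec ζ) j x) A V
      (weight (-κ) (reVec ζ) x * a x)
      (fun j => h * partialDeriv j (fun y => weight (-κ) (reVec ζ) y * a y) x) (g x)
      (fun j => h * partialDeriv j g x)
      = formDensity h (fun j => ζ j) A V (a x) (fun j => h * partialDeriv j a x)
        (weight (-κ) (reVec ζ) x * g x)
        (fun j => h * partialDeriv j (fun y => weight (-κ) (reVec ζ) y * g y) x) := by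
  have hw := weight_ne_zero κ (reVec ζ) x
  rw [← formDensity_weight (w := weight κ (reVec ζ) x)
    (τ := fun j => weightGrad h κ (reVec ζ) j x) hw
    (fun j => phaseGrad_eq_add_weightGrad h κ ζ j x)]
  simp only [mul_partialDeriv_weight_mul _ _ _ ha, mul_partialDeriv_weight_mul _ _ _ hg]
  simp only [weightGrad_neg, weight_neg]
  congr 1
  · ext j
    ring
  · field_simp
  · ext j
    field_simp
    ring

/-- On the ball the inverse weight and its semiclassical logarithmic gradient are at most `1` in
absolute value, so passing between `g` and the weighted test function costs no power of `h`. -/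
theorem integral_norm_weight_mul_le {Ω : Set (RSpace n)} {h κ R : ℝ} {α β : RSpace n}
    (H : IsAdmissible h κ (R + 1) α β) (hΩR : Ω ⊆ Metric.closedBall 0 R) {g : Sch n}
    (hg : g ∈ testS Ω) :
    ∫ x, (‖weight (-κ) α x * g x‖
        + ∑ j, ‖h * partialDeriv j (fun y => weight (-κ) α y * g y) x‖)
      ≤ (volume.real (Metric.closedBall (0 : RSpace n) R) + 1) / 2 * (2 * n + 1) * ‖jet h g‖ := by
  have hgs := testS_le_suppS hΩR hg
  have hi : ∀ f : Sch n, Integrable fun x => ‖f x‖ := fun f => (f.integrable).norm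
  set N := (volume.real (Metric.closedBall (0 : RSpace n) R) + 1) / 2 with hN
  have hN0 : 0 ≤ N := by positivity
  have hint : Integrable fun x => (n + 1 : ℝ) * ‖g x‖ + ∑ j, ‖dh h j g x‖ :=
    ((hi g).const_mul _).add (integrable_finsetSum _ fun j _ => hi _)
  refine (integral_mono_of_nonneg (.of_forall fun x => add_nonneg (norm_nonneg _)
    (Finset.sum_nonneg fun _ _ => norm_nonneg _)) hint (.of_forall fun x => ?_)).trans ?_
  · simp only [mul_partialDeriv_weight_mul _ _ _ hg.smooth, dh_apply]
    rcases le_or_gt ‖x‖ R with hx | hx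
    · have hw : ‖weight (-κ) α x‖ ≤ 1 := by
        rw [norm_weight, Real.exp_le_one_iff]
        have := mul_nonneg H.κ_pos.le (sq_nonneg ⟪α, x⟫_ℝ)
        linarith
      have h0 : ‖weight (-κ) α x * g x‖ ≤ ‖g x‖ := by
        rw [norm_mul]
        exact mul_le_of_le_one_left (norm_nonneg _) hw
      have hj : ∀ j, ‖weight (-κ) α x
          * (h * partialDeriv j g x + weightGrad h (-κ) α j x * g x)‖
          ≤ ‖g x‖ + ‖h * partialDeriv j g x‖ := by
        intro j
        rw [norm_mul, weightGrad_neg]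
        refine (mul_le_of_le_one_left (norm_nonneg _) hw).trans ((norm_add_le _ _).trans ?_)
        rw [add_comm, norm_mul (-_), norm_neg]
        exact add_le_add (mul_le_of_le_one_left (norm_nonneg _) (norm_weightGrad_le H j hx)) le_rfl
      refine (add_le_add h0 (Finset.sum_le_sum fun j _ => hj j)).trans (le_of_eq ?_)
      rw [Finset.sum_add_distrib, Finset.sum_const, Finset.card_univ, Fintype.card_fin,
        nsmul_eq_mul]
      ring
    · have hz : ∀ j, partialDeriv j g x = 0 := fun j => partialDeriv_eq_zero_of_norm_lt hgs j x hx
      simp [hgs x hx, hz]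
  · rw [integral_add ((hi g).const_mul _) (integrable_finsetSum _ fun j _ => hi _),
      integral_const_mul, integral_finsetSum _ fun j _ => hi _]
    have b0 := (integral_norm_le_of_mem_suppS hgs).trans
      (mul_le_mul_of_nonneg_left (norm_toL2_le_jet h g) hN0)
    have bj : ∀ j, ∫ x, ‖dh h j g x‖ ≤ N * ‖jet h g‖ := fun j =>
      (integral_norm_le_of_mem_suppS (dh_mem_suppS hgs j)).trans
        (mul_le_mul_of_nonneg_left (norm_toL2_dh_le_jet h g j) hN0)
    have bs : ∑ j, ∫ x, ‖dh h j g x‖ ≤ n * (N * ‖jet h g‖) := by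
      refine (Finset.sum_le_sum fun j _ => bj j).trans (le_of_eq ?_)
      simp
    have := mul_le_mul_of_nonneg_left b0 (show (0 : ℝ) ≤ n + 1 by positivity)
    calc _ ≤ (n + 1) * (N * ‖jet h g‖) + n * (N * ‖jet h g‖) := add_le_add this bs
      _ = _ := by ring

/-- The integrand of the weak equation for `u = E R` in terms of the conjugated form. -/
theorem weakForm_eq_formDensity {h : ℝ} (hh : h ≠ 0) {A : CSpace n} {q R E ψ : ℂ}
    {GR GE Gψ : CSpace n} {η dR dg : Fin n → ℂ} (hGE : ∀ j, h * GE j = E * η j)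
    (hdR : ∀ j, dR j = h * GR j) (hdg : ∀ j, dg j = h * (E * Gψ j + GE j * ψ)) :
    cdot (E • GR + R • GE) Gψ + cdot A ((-Complex.I) • (E • GR + R • GE)) * ψ
        - cdot ((E * R) • A) ((-Complex.I) • Gψ) + (cdot A A + q) * (E * R) * ψ
      = ((h : ℂ) ^ 2)⁻¹ * formDensity h η (fun j => A j) (cdot A A + q) R dR (E * ψ) dg := by
  have hh' : (h : ℂ) ≠ 0 := Complex.ofReal_ne_zero.mpr hh
  have h1 : ∀ j, dg j - E * ψ * η j = h * E * Gψ j := fun j => by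
    rw [hdg]
    linear_combination ψ * hGE j
  have h2 : ∀ j, E * GR j + R * GE j = (h : ℂ)⁻¹ * (E * (dR j + R * η j)) := fun j => by
    rw [hdR]
    field_simp
    linear_combination R * hGE j
  rw [formDensity, mul_add]
  congr 1
  · simp only [cdot, PiLp.add_apply, PiLp.smul_apply, smul_eq_mul, h1, h2]
    rw [Finset.sum_mul, ← Finset.sum_add_distrib, ← Finset.sum_sub_distrib, Finset.mul_sum]
    refine Finset.sum_congr rfl fun j _ => ?_
    field_simp
    ring
  · field_simp

/-- With `w` the weight, put `r = wρ`. Then `u` is `carrier` times `w⁻¹e^Φ + ρ`, and `ρ` has to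
cancel the defect of `w⁻¹e^Φ` against test functions in `Ω`. Solvability costs `K/h`. -/
theorem exists_solution_of_admissible {Ω : Set (RSpace n)} (hΩb : Bornology.IsBounded Ω)
    (hΩm : MeasurableSet Ω) {R : ℝ} (hΩR : Ω ⊆ Metric.closedBall 0 R)
    {h κ s e C K : ℝ} (hs : 0 ≤ s) (he : 0 ≤ e) (hC : 1 ≤ C) {ζ₀ ζ₁ : CSpace n}
    (H : IsAdmissible h κ (R + 1) (reVec (ζ₀ + ζ₁)) (imVec (ζ₀ + ζ₁)))
    (hζζ : cdot (ζ₀ + ζ₁) (ζ₀ + ζ₁) = 0) (hζ₀ : ∀ j, ‖ζ₀ j‖ ≤ C) (hζ₁ : ∀ j, ‖ζ₁ j‖ ≤ C * h)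
    {A B : RSpace n → CSpace n} {q V : RSpace n → ℂ} (hAB : ∀ x ∈ Ω, B x = A x)
    (hqV : ∀ x ∈ Ω, V x = cdot (A x) (A x) + q x)
    (hBm : ∀ j, MemLp (fun x => B x j) ∞ volume) (hVm : MemLp V ∞ volume)
    (hsolve : ∀ (ℓ : testS Ω →ₗ[ℂ] ℂ) (L : ℝ), 0 ≤ L →
      (∀ g : testS Ω, ‖ℓ g‖ ≤ L * ‖jet h (g : Sch n)‖) →
      ∃ r ∈ h1Space n h, (∀ g : testS Ω, pairJ ((principalJet h κ (reVec (ζ₀ + ζ₁))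
        (imVec (ζ₀ + ζ₁)) + (h : ℂ) • lowerJet h κ (reVec (ζ₀ + ζ₁)) (imVec (ζ₀ + ζ₁)) hBm hVm)
          (g : Sch n)) r = ℓ g) ∧ ‖r‖ ≤ K / h * L)
    {b : Fin n → RSpace n → ℂ} {Φ : RSpace n → ℂ} (hΦ : ContDiff ℝ ∞ Φ)
    (hb : ∀ j, ContDiff ℝ ∞ (b j))
    (hΦ₀ : ∀ x, ‖Complex.exp (Φ x)‖ ≤ C) (hΦ₁ : ∀ j x, ‖h * partialDeriv j Φ x‖ ≤ C * s)
    (hΦ₂ : ∀ j x, ‖(h : ℂ) ^ 2 * partialDeriv j (partialDeriv j Φ) x‖ ≤ C * s ^ 2)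
    (hB₀ : ∀ j x, ‖B x j‖ ≤ C) (hb₀ : ∀ j x, ‖b j x‖ ≤ C)
    (hb₁ : ∀ j x, ‖h * partialDeriv j (b j) x‖ ≤ C * s) (hBb : ∀ j x, ‖B x j - b j x‖ ≤ e)
    (hV : ∀ᵐ x, ‖V x‖ ≤ C)
    (hp : ∀ x, ∑ j, ζ₀ j * partialDeriv j Φ x = -Complex.I * ∑ j, ζ₀ j * b j x) :
    ∃ (r : RSpace n → ℂ) (Gr : RSpace n → CSpace n),
      IsSolution Ω A q (fun x => Complex.exp (cdot (toC x) (ζ₀ + ζ₁) / (h : ℂ))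
        * (Complex.exp (Φ x) + r x)) ∧ IsH1With Ω r Gr ∧
      sclH1Norm Ω h r Gr ≤ Real.exp (2 * κ * R ^ 2) * Real.sqrt (2 * n + 2) * (K / h *
        (6 * (n + 1) * C ^ 3 * (s ^ 2 + h * s + h * e + h ^ 2) *
          ((volume.real (Metric.closedBall (0 : RSpace n) R) + 1) / 2 * (2 * n + 1)))) := by
  set ζ := ζ₀ + ζ₁ with hζ
  have hh := H.h_pos
  have ha : ContDiff ℝ ∞ fun x => Complex.exp (Φ x) := hΦ.cexp
  have hc : ContDiff ℝ ∞ fun x => weight (-κ) (reVec ζ) x * Complex.exp (Φ x) :=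
    (contDiff_weight _ _).mul ha
  obtain ⟨k, hk⟩ := exists_jet_hasIntegral_formDensity (h := h) (κ := κ) (R := R) (α := reVec ζ)
    (β := imVec ζ) hBm hVm hc
  set T := principalJet h κ (reVec ζ) (imVec ζ)
    + (h : ℂ) • lowerJet h κ (reVec ζ) (imVec ζ) hBm hVm with hT
  set N := (volume.real (Metric.closedBall (0 : RSpace n) R) + 1) / 2 * (2 * n + 1) with hN
  have hN0 : 0 ≤ N := by positivity
  set Q := 6 * (n + 1) * C ^ 3 * (s ^ 2 + h * s + h * e + h ^ 2) with hQ
  have hQ0 : 0 ≤ Q := by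
    have : 0 ≤ C := by linarith
    positivity
  have hbound : ∀ g ∈ testS Ω, ‖pairJ (T g) k‖ ≤ Q * N * ‖jet h g‖ := by
    intro g hg
    obtain ⟨hi, hv⟩ := hk g (testS_le_suppS hΩR hg)
    simp only [formDensity_weight_mul ζ _ _ ha (IsTestFunction.smooth hg)] at hi hv
    have hvt : IsTestFunction Ω fun x => weight (-κ) (reVec ζ) x * g x :=
      IsTestFunction.mul_left hg (contDiff_weight _ _)
    rw [← hv]
    refine (norm_integral_formDensity_amplitude_le hh.le hs he hC (fun j => rfl) hζζ hζ₀ hζ₁ hΦ hb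
      hvt.smooth hvt.hasCompactSupport hΦ₀ hΦ₁ hΦ₂ hB₀ hb₀ hb₁ hBb hV hp hi).trans ?_
    exact (mul_le_mul_of_nonneg_left (integral_norm_weight_mul_le H hΩR hg) hQ0).trans_eq
      (mul_assoc _ _ _).symm
  -- The right side is minus the defect of the amplitude; written as the pairing with the fixed
  -- tuple `k`, it is visibly linear in `g`.
  obtain ⟨ρ, hρ, hρT, hρn⟩ := hsolve
    (-(((pairJ (n := n)).flip k).toLinearMap ∘ₗ T ∘ₗ (testS Ω).subtype)) (Q * N) (by positivity)
    (fun g => by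
      rw [LinearMap.neg_apply, norm_neg]
      exact hbound g g.2)
  have hρ1 := isH1With_of_mem_h1Space (Ω := Ω) hh hρ
  refine ⟨_, _, ?_, hρ1.smooth_mul hΩb (contDiff_weight κ (reVec ζ)),
    (sclH1Norm_weight_smul_le H hΩm hΩR ρ).trans
      (mul_le_mul_of_nonneg_left hρn (by positivity))⟩
  have hu : (fun x => Complex.exp (cdot (toC x) ζ / (h : ℂ))
      * (Complex.exp (Φ x) + weight κ (reVec ζ) x * ρ none x))
      = fun x => carrier ζ h κ x
        * (weight (-κ) (reVec ζ) x * Complex.exp (Φ x) + ρ none x) := by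
    ext x
    have := weight_ne_zero κ (reVec ζ) x
    rw [carrier, linPhase_apply, weight_neg]
    field_simp
  rw [hu]
  refine ⟨_, ((isH1With_of_contDiff hΩb hc).add hρ1).smooth_mul hΩb (contDiff_carrier ζ h κ),
    fun ψ hψ => ?_⟩
  -- The form for `u = E R` against `ψ` is `h⁻²` times the conjugated form for `R` against `g = E
  -- ψ`, where `E` is the carrier.
  have hgt := hψ.mul_left (contDiff_carrier ζ h κ)
  set g : Sch n := hgt.toSch
  have hgx : ∀ x, g x = carrier ζ h κ x * ψ x := fun _ => rfl
  have hI := (hk g (testS_le_suppS hΩR hgt.toSch_mem)).add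
    (hasIntegral_formDensity (h := h) (κ := κ) (α := reVec ζ) (β := imVec ζ) hBm hVm g ρ)
  have h0 : pairJ (T g) k + pairJ (T g) ρ = 0 := by
    rw [hρT ⟨g, hgt.toSch_mem⟩]
    exact add_neg_cancel _
  rw [← hT, h0] at hI
  simp only [← formDensity_add_left] at hI
  have hzero : ∀ x, x ∉ Ω → formDensity h (fun j => phaseGrad h κ (reVec ζ) (imVec ζ) j x)
      (fun j => B x j) (V x) (weight (-κ) (reVec ζ) x * Complex.exp (Φ x) + ρ none x)
      (fun j => h * partialDeriv j (fun x => weight (-κ) (reVec ζ) x * Complex.exp (Φ x)) x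
        + ρ (some j) x) (g x) (fun j => h * partialDeriv j g x) = 0 := by
    intro x hx
    have z0 : g x = 0 := hgt.eq_zero hx
    have zj : ∀ j, partialDeriv j g x = 0 := fun j => (hgt.partialDeriv j).eq_zero hx
    simp [formDensity, z0, zj]
  have hI2 := hI.2
  rw [← setIntegral_eq_integral_of_forall_compl_eq_zero hzero] at hI2
  rw [← mul_zero (((h : ℂ) ^ 2)⁻¹), ← hI2, ← integral_const_mul]
  refine setIntegral_congr_fun hΩm fun x hx => ?_
  simp only [hqV x hx, hAB x hx]
  refine weakForm_eq_formDensity hh.ne'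
    (fun j => mul_partialDeriv_carrier hh.ne' ζ κ j x) (fun j => ?_) (fun j => ?_)
  · have hh' : (h : ℂ) ≠ 0 := Complex.ofReal_ne_zero.mpr hh.ne'
    rw [PiLp.add_apply, gradC, mul_add]
    congr 1
    field_simp
  · congr 1
    exact partialDeriv_mul' (contDiff_carrier ζ h κ) hψ.smooth j x

/-! ### Choice of the data as `h → 0⁺` and assembly. -/

theorem exists_isC0Extension {Ω : Set (RSpace n)} (hΩb : Bornology.IsBounded Ω)
    {A : RSpace n → CSpace n} (hA : ContinuousOn A (closure Ω)) : ∃ B, IsC0Extension Ω A B := by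
  have : TietzeExtension (CSpace n) := TietzeExtension.of_tvs ℂ
  obtain ⟨F, hF⟩ := ContinuousMap.exists_restrict_eq (s := closure Ω) isClosed_closure
    ⟨(closure Ω).domRestrict A, hA.domRestrict⟩
  obtain ⟨R, hR⟩ := (Metric.isBounded_closure_iff.mpr hΩb).subset_closedBall 0
  let χ : ContDiffBump (0 : RSpace n) := ⟨|R| + 1, |R| + 2, by positivity, by linarith⟩
  refine ⟨fun x => χ x • F x, χ.continuous.smul F.continuous, χ.hasCompactSupport.smul_right,
    fun x hx => ?_⟩
  have h1 : χ x = 1 := χ.one_of_mem_closedBall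
    (Metric.closedBall_subset_closedBall ((le_abs_self R).trans (le_add_of_nonneg_right zero_le_one)) (hR hx))
  have h2 : F x = A x := congrFun (congrArg DFunLike.coe hF) ⟨x, hx⟩
  simp only [h1, h2, one_smul]

theorem norm_cspace_coord_le (z : CSpace n) (j : Fin n) : ‖z j‖ ≤ ‖z‖ := PiLp.norm_apply_le z j

theorem continuous_reVec : Continuous (reVec : CSpace n → RSpace n) := by
  unfold reVec
  fun_prop

theorem continuous_imVec : Continuous (imVec : CSpace n → RSpace n) := by
  unfold imVec
  fun_prop

theorem continuous_cdot {X : Type*} [TopologicalSpace X] {f g : X → CSpace n} (hf : Continuous f)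
    (hg : Continuous g) : Continuous fun x => cdot (f x) (g x) := by
  unfold cdot
  fun_prop

theorem inner_reVec_imVec_eq_zero {ζ : CSpace n} (hζ : cdot ζ ζ = 0) :
    ⟪reVec ζ, imVec ζ⟫_ℝ = 0 := by
  have h1 := congrArg Complex.im hζ
  rw [cdot, Complex.im_sum, Complex.zero_im] at h1
  simp only [Complex.mul_im] at h1
  have h2 : ⟪reVec ζ, imVec ζ⟫_ℝ = ∑ j, (ζ j).re * (ζ j).im := by
    simp [PiLp.inner_apply, reVec, imVec, mul_comm]
  have h3 : 2 * ∑ j, (ζ j).re * (ζ j).im = 0 := by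
    rw [← h1, Finset.mul_sum]
    exact Finset.sum_congr rfl fun j _ => by ring
  rw [h2]
  linarith

theorem norm_le_of_norm_reVec_imVec {ζ : CSpace n} (hre : ‖reVec ζ‖ = 1) (him : ‖imVec ζ‖ = 1)
    (j : Fin n) : ‖ζ j‖ ≤ 2 := by
  have h1 := norm_coord_le (reVec ζ) j
  have h2 := norm_coord_le (imVec ζ) j
  have h3 := Complex.norm_le_abs_re_add_abs_im (ζ j)
  rw [hre] at h1
  rw [him] at h2
  exact h3.trans ((add_le_add h1 h2).trans (by norm_num))

/-- The modulus is the supremum of the error. Where the error is unbounded the real supremum is `0`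
by convention, which is harmless because the inequality is claimed only eventually. -/
theorem exists_modulus_of_tendstoUniformly {ι X : Type*} {l : Filter ι} {F : ι → X → ℂ} {f : X → ℂ}
    (hF : TendstoUniformly F f l) : ∃ e : ι → ℝ, (∀ i, 0 ≤ e i) ∧ Tendsto e l (𝓝 0) ∧
      ∀ᶠ i in l, ∀ x, ‖f x - F i x‖ ≤ e i := by
  rw [Metric.tendstoUniformly_iff] at hF
  refine ⟨fun i => ⨆ x, ‖f x - F i x‖, fun i => Real.iSup_nonneg fun x => norm_nonneg _, ?_, ?_⟩
  · rw [Metric.tendsto_nhds]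
    intro ε hε
    filter_upwards [hF (ε / 2) (by positivity)] with i hi
    rw [Real.dist_eq, sub_zero, abs_of_nonneg (Real.iSup_nonneg fun x => norm_nonneg _)]
    refine (Real.iSup_le (fun x => ?_) (by positivity)).trans_lt (half_lt_self hε)
    rw [← dist_eq_norm]
    exact (hi x).le
  · filter_upwards [hF 1 one_pos] with i hi x
    refine le_ciSup (f := fun x => ‖f x - F i x‖) ⟨1, ?_⟩ x
    rintro _ ⟨y, rfl⟩
    simp only
    rw [← dist_eq_norm]
    exact (hi y).le

theorem mollify_const_mul_sum (δ : ℝ) (c : ℂ) (a : Fin n → ℂ) {f : Fin n → RSpace n → ℂ}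
    (hf : ∀ j, Continuous (f j)) (x : RSpace n) :
    mollify δ (fun y => c * ∑ j, a j * f j y) x = c * ∑ j, a j * mollify δ (f j) x := by
  simp only [mollify, conv_apply]
  have hi : ∀ j, Integrable fun t => a j * (bump n t * f j (δ • (δ⁻¹ • x - t))) := by
    intro j
    have h1 : Continuous (bump n) := contDiff_bump.continuous
    have h2 := hf j
    refine Integrable.const_mul (Continuous.integrable_of_hasCompactSupport (by fun_prop) ?_) _
    exact hasCompactSupport_bump.mul_right
  simp only [← integral_const_mul]
  rw [← integral_finsetSum _ fun j _ => hi j, ← integral_const_mul]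
  congr 1
  ext t
  rw [Finset.mul_sum, Finset.mul_sum, Finset.mul_sum]
  exact Finset.sum_congr rfl fun j _ => by ring

theorem partialDeriv_eq_listDeriv (j : Fin n) (f : RSpace n → ℂ) :
    partialDeriv j f = listDeriv [j] f := rfl

theorem partialDeriv_partialDeriv_eq_listDeriv (i j : Fin n) (f : RSpace n → ℂ) :
    partialDeriv i (partialDeriv j f) = listDeriv [i, j] f := rfl

theorem tendsto_rpow_nhdsGT_zero {σ : ℝ} (hσ : 0 < σ) :
    Tendsto (fun h : ℝ => h ^ σ) (𝓝[>] 0) (𝓝[>] 0) := by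
  refine tendsto_nhdsWithin_iff.mpr ⟨?_, ?_⟩
  · have h1 := (Real.continuousAt_rpow_const 0 σ (Or.inr hσ.le)).tendsto
    rw [Real.zero_rpow hσ.ne'] at h1
    exact h1.mono_left nhdsWithin_le_nhds
  · filter_upwards [self_mem_nhdsWithin] with h hh
    exact Real.rpow_pos_of_pos hh σ

theorem exists_ae_norm_le_of_memLp_top {V : RSpace n → ℂ} (hV : MemLp V ∞ volume) :
    ∃ b : ℝ, 0 ≤ b ∧ ∀ᵐ x, ‖V x‖ ≤ b := by
  refine ⟨(eLpNorm V ∞ volume).toReal, ENNReal.toReal_nonneg, ?_⟩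
  have h1 : ∀ᵐ x, ‖V x‖ₑ ≤ eLpNorm V ∞ volume := by
    rw [eLpNorm_exponent_top]
    exact ae_le_eLpNormEssSup
  filter_upwards [h1] with x hx
  have h2 := ENNReal.toReal_mono hV.2.ne hx
  rwa [toReal_enorm] at h2

/-- The regularized phase `Φ♯`: the mollification of `N_{ζ₀}⁻¹(-i ζ₀ · B)` at scale `h^σ`. -/
def smoothPhase (B : RSpace n → CSpace n) (σ : ℝ) (ζ₀ : CSpace n) (h : ℝ) : RSpace n → ℂ :=
  mollify (h ^ σ) (invN ζ₀ fun z => -Complex.I * cdot ζ₀ (B z))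

theorem isUnitFrame_of_eventually {ζ₀ : CSpace n} {ζ₁ : ℝ → CSpace n} (hre : ‖reVec ζ₀‖ = 1)
    (him : ‖imVec ζ₀‖ = 1)
    (hζζ : ∀ᶠ h in 𝓝[>] (0 : ℝ), cdot (ζ₀ + ζ₁ h) (ζ₀ + ζ₁ h) = 0)
    (hζ₁ : Tendsto ζ₁ (𝓝[>] (0 : ℝ)) (𝓝 0)) : IsUnitFrame ζ₀ := by
  refine ⟨hre, him, inner_reVec_imVec_eq_zero ?_⟩
  have h1 : Tendsto (fun h => ζ₀ + ζ₁ h) (𝓝[>] (0 : ℝ)) (𝓝 ζ₀) := by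
    simpa using hζ₁.const_add ζ₀
  have h2 : Tendsto (fun h => cdot (ζ₀ + ζ₁ h) (ζ₀ + ζ₁ h)) (𝓝[>] (0 : ℝ)) (𝓝 (cdot ζ₀ ζ₀)) :=
    ((continuous_cdot continuous_id continuous_id).tendsto ζ₀).comp h1
  exact tendsto_nhds_unique (h2.congr' hζζ) tendsto_const_nhds

/-- With `s = h^{1-σ}` and `e` the mollification error of `B`, the defect divided by `h` is of size
`h^{1-2σ} + h^{1-σ} + e + h`. The first term needs `σ < 1/2`. -/
theorem exists_eventually_solution {Ω : Set (RSpace n)} (hΩ : IsOpen Ω)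
    (hΩb : Bornology.IsBounded Ω) {A B : RSpace n → CSpace n} {q : RSpace n → ℂ}
    (hq : MemLp q ∞ (volume.restrict Ω)) (hB : IsC0Extension Ω A B) {σ : ℝ} (hσ : 0 < σ)
    (hσ2 : σ < 1 / 2) {ζ₀ : CSpace n} {ζ₁ : ℝ → CSpace n} (hre : ‖reVec ζ₀‖ = 1)
    (him : ‖imVec ζ₀‖ = 1)
    (hζζ : ∀ᶠ h in 𝓝[>] (0 : ℝ), cdot (ζ₀ + ζ₁ h) (ζ₀ + ζ₁ h) = 0)
    (hζ₁ : ζ₁ =O[𝓝[>] (0 : ℝ)] fun h : ℝ => h) :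
    ∃ w : ℝ → ℝ, Tendsto w (𝓝[>] (0 : ℝ)) (𝓝 0) ∧ ∀ᶠ h in 𝓝[>] (0 : ℝ),
      ∃ (r : RSpace n → ℂ) (Gr : RSpace n → CSpace n),
        IsSolution Ω A q (fun x => Complex.exp (cdot (toC x) (ζ₀ + ζ₁ h) / (h : ℂ))
          * (Complex.exp (smoothPhase B σ ζ₀ h x) + r x)) ∧ IsH1With Ω r Gr ∧
        sclH1Norm Ω h r Gr ≤ w h := by
  have hid : Tendsto (fun h : ℝ => h) (𝓝[>] 0) (𝓝 0) := tendsto_id.mono_left nhdsWithin_le_nhds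
  have hζ₁0 : Tendsto ζ₁ (𝓝[>] (0 : ℝ)) (𝓝 0) := hζ₁.trans_tendsto hid
  have hframe := isUnitFrame_of_eventually hre him hζζ hζ₁0
  -- the region and the coefficients
  obtain ⟨R₀, hR₀⟩ := hΩb.subset_closedBall 0
  set R := max R₀ 1
  have hR : 0 < R := lt_max_of_lt_right one_pos
  have hΩR : Ω ⊆ Metric.closedBall 0 R :=
    hR₀.trans (Metric.closedBall_subset_closedBall (le_max_left _ _))
  obtain ⟨M, hM⟩ := hB.hasCompactSupport.exists_bound_of_continuous hB.continuous
  have hM0 : 0 ≤ M := (norm_nonneg _).trans (hM 0)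
  have hMj : ∀ j x, ‖B x j‖ ≤ M := fun j x => (norm_cspace_coord_le _ j).trans (hM x)
  have hBj : ∀ j, Continuous fun x => B x j := fun j => by
    have := hB.continuous
    fun_prop
  have hBjc : ∀ j : Fin n, HasCompactSupport fun x => B x j := fun j =>
    hB.hasCompactSupport.comp_left (g := fun z : CSpace n => z j) rfl
  have hBm : ∀ j, MemLp (fun x => B x j) ∞ (volume : Measure (RSpace n)) := fun j =>
    (hBj j).memLp_of_hasCompactSupport (hBjc j)
  -- The potential is extended to a bounded function on `ℝⁿ` that agrees with `A² + q` on `Ω`, since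
  -- the solvability result is global.
  set V : RSpace n → ℂ := fun x => cdot (B x) (B x) + Ω.indicator q x with hVdef
  have hVm : MemLp V ∞ volume := by
    refine MemLp.add ?_ ((memLp_indicator_iff_restrict hΩ.measurableSet).mpr hq)
    refine (continuous_cdot hB.continuous hB.continuous).memLp_of_hasCompactSupport ?_
    exact hB.hasCompactSupport.comp_left (g := fun z : CSpace n => cdot z z) (by simp [cdot])
  obtain ⟨v, hv0, hv⟩ := exists_ae_norm_le_of_memLp_top hVm
  obtain ⟨κ, hκ, h₀, hh₀, K, hK, hsolve⟩ := exists_h1Space_pairJ_eq n hR hM0 hv0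
  -- the phase
  set f : RSpace n → ℂ := fun z => -Complex.I * cdot ζ₀ (B z) with hf
  have hfc : Continuous f := continuous_const.mul (continuous_cdot continuous_const hB.continuous)
  have hfs : HasCompactSupport f :=
    hB.hasCompactSupport.comp_left (g := fun z => -Complex.I * cdot ζ₀ z) (by simp [cdot])
  have hFc := (uniformContinuous_invN hframe hfc hfs).continuous
  obtain ⟨MF, hMF⟩ := exists_norm_invN_le_of_hasCompactSupport hframe hfc hfs
  have hMF0 : 0 ≤ MF := (norm_nonneg _).trans (hMF 0)
  -- the moduli of continuity
  have hmod : ∀ j : Fin n, ∃ e : ℝ → ℝ, (∀ h, 0 ≤ e h) ∧ Tendsto e (𝓝[>] (0 : ℝ)) (𝓝 0) ∧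
      ∀ᶠ h in 𝓝[>] (0 : ℝ), ∀ x, ‖B x j - mollify (h ^ σ) (fun x => B x j) x‖ ≤ e h := fun j =>
    exists_modulus_of_tendstoUniformly fun u hu => (tendsto_rpow_nhdsGT_zero hσ).eventually
      (tendstoUniformly_mollify ((hBjc j).uniformContinuous_of_continuous (hBj j)) u hu)
  choose e he0 het heb using hmod
  obtain ⟨c, hc⟩ := hζ₁.bound
  -- the constants
  set I : List (Fin n) → ℝ := fun l => ∫ t, ‖listDeriv l (bump n) t‖
  have hI : ∀ l, 0 ≤ I l := fun l => integral_nonneg fun _ => norm_nonneg _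
  set C₁ := ∑ j, (MF + M) * I [j]
  set C₂ := ∑ j, MF * I [j, j]
  have hC₁ : ∀ j, (MF + M) * I [j] ≤ C₁ := fun j => Finset.single_le_sum
    (f := fun j => (MF + M) * I [j]) (fun i _ => mul_nonneg (by positivity) (hI _))
    (Finset.mem_univ j)
  have hC₂ : ∀ j, MF * I [j, j] ≤ C₂ := fun j => Finset.single_le_sum
    (f := fun j => MF * I [j, j]) (fun i _ => mul_nonneg hMF0 (hI _)) (Finset.mem_univ j)
  have hC₁0 : 0 ≤ C₁ := Finset.sum_nonneg fun i _ => mul_nonneg (by positivity) (hI _)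
  have hC₂0 : 0 ≤ C₂ := Finset.sum_nonneg fun i _ => mul_nonneg hMF0 (hI _)
  have hMI : 0 ≤ M * I [] := mul_nonneg hM0 (hI _)
  -- One constant for all bounds: `2` dominates the components of `ζ₀` and gives `1 ≤ C`, the
  -- exponential bounds `e^{Φ♯}`, and `|c|` appears because the constant of the `O(h)` bound comes
  -- without a sign.
  set C := 2 + Real.exp (MF * I []) + C₁ + C₂ + M + M * I [] + v + |c|
  have hexp := Real.exp_pos (MF * I [])
  have hcabs := abs_nonneg c
  have hC0 : 0 ≤ C := by positivity
  set D := Real.exp (2 * κ * R ^ 2) * Real.sqrt (2 * n + 2) * (K * (6 * (n + 1) * C ^ 3 *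
    ((volume.real (Metric.closedBall (0 : RSpace n) R) + 1) / 2 * (2 * n + 1))))
  refine ⟨fun h => D * (h ^ (1 - 2 * σ) + h ^ (1 - σ) + ∑ j, e j h + h), ?_, ?_⟩
  · have t1 := (tendsto_rpow_nhdsGT_zero (σ := 1 - 2 * σ) (by linarith)).mono_right
      nhdsWithin_le_nhds
    have t2 := (tendsto_rpow_nhdsGT_zero (σ := 1 - σ) (by linarith)).mono_right
      nhdsWithin_le_nhds
    have t3 : Tendsto (fun h => ∑ j, e j h) (𝓝[>] (0 : ℝ)) (𝓝 (∑ _j : Fin n, (0 : ℝ))) :=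
      tendsto_finsetSum _ fun j _ => het j
    simpa using (((t1.add t2).add t3).add hid).const_mul D
  have hζt : Tendsto (fun h => ζ₀ + ζ₁ h) (𝓝[>] (0 : ℝ)) (𝓝 ζ₀) := by
    simpa using hζ₁0.const_add ζ₀
  have hre1 : Tendsto (fun h => ‖reVec (ζ₀ + ζ₁ h)‖) (𝓝[>] (0 : ℝ)) (𝓝 1) := by
    rw [← hre]
    exact ((continuous_reVec.norm).tendsto ζ₀).comp hζt
  have him1 : Tendsto (fun h => ‖imVec (ζ₀ + ζ₁ h)‖) (𝓝[>] (0 : ℝ)) (𝓝 1) := by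
    rw [← him]
    exact ((continuous_imVec.norm).tendsto ζ₀).comp hζt
  filter_upwards [hζζ, hc, eventually_all.mpr heb, self_mem_nhdsWithin,
    hid.eventually (gt_mem_nhds hh₀), hre1.eventually (gt_mem_nhds (show (1 : ℝ) < 2 by norm_num)),
    hre1.eventually (lt_mem_nhds (show (1 / 2 : ℝ) < 1 by norm_num)),
    him1.eventually (gt_mem_nhds (show (1 : ℝ) < 2 by norm_num))]
    with h hζζh hch heh hh hhh₀ hα2 hα1 hβ2
  replace hh : 0 < h := hh
  obtain ⟨H, hsol⟩ := hsolve h _ _ hh hhh₀ hα1.le hα2.le hβ2.le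
  have hδ : 0 < h ^ σ := Real.rpow_pos_of_pos hh σ
  have hs : h * (h ^ σ)⁻¹ = h ^ (1 - σ) := by
    rw [Real.rpow_sub hh, Real.rpow_one, div_eq_mul_inv]
  have hs0 : 0 ≤ h ^ (1 - σ) := (Real.rpow_pos_of_pos hh _).le
  have hnorm : ‖(h : ℂ)‖ = h := by rw [Complex.norm_real, Real.norm_eq_abs, abs_of_pos hh]
  have hΦ := contDiff_mollify (h ^ σ) hFc
  have hb := fun j => contDiff_mollify (h ^ σ) (hBj j)
  obtain ⟨r, Gr, hr1, hr2, hr3⟩ := exists_solution_of_admissible (s := h ^ (1 - σ))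
    (e := ∑ j, e j h) (C := C) (A := A) (B := B) (q := q) (V := V)
    (b := fun j => mollify (h ^ σ) fun x => B x j) (Φ := smoothPhase B σ ζ₀ h)
    hΩb hΩ.measurableSet hΩR hs0 (Finset.sum_nonneg fun j _ => he0 j h)
    (by linarith) H hζζh (fun j => (norm_le_of_norm_reVec_imVec hre him j).trans (by linarith))
    (fun j => by
      refine (norm_cspace_coord_le _ j).trans (hch.trans ?_)
      rw [Real.norm_eq_abs, abs_of_pos hh]
      exact mul_le_mul_of_nonneg_right (by linarith [le_abs_self c]) hh.le)
    (fun x hx => hB.eqOn (subset_closure hx))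
    (fun x hx => by
      simp only [hVdef]
      rw [Set.indicator_of_mem hx, hB.eqOn (subset_closure hx)])
    hBm hVm (hsol (fun j x => B x j) V hBm hVm (fun j => .of_forall fun x => hMj j x) hv (testS Ω)
      (testS_le_suppS hΩR)) hΦ hb
    (fun x => by
      rw [Complex.norm_exp]
      have h1 := norm_listDeriv_mollify_le hδ hFc hMF [] x
      simp only [List.length_nil, pow_zero, mul_one] at h1
      refine (Real.exp_le_exp.mpr ((Complex.re_le_norm _).trans h1)).trans ?_
      linarith)
    (fun j x => by
      rw [norm_mul, hnorm, partialDeriv_eq_listDeriv]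
      have h1 := mul_le_mul_of_nonneg_left (norm_listDeriv_mollify_le hδ hFc hMF [j] x) hh.le
      refine h1.trans ?_
      rw [List.length_singleton, pow_one, mul_left_comm, hs]
      refine mul_le_mul_of_nonneg_right ?_ hs0
      have h2 := hC₁ j
      have h3 := mul_nonneg hM0 (hI [j])
      simp only [I] at h2 h3 ⊢
      linarith)
    (fun j x => by
      rw [norm_mul, norm_pow, hnorm, partialDeriv_partialDeriv_eq_listDeriv]
      have h1 := mul_le_mul_of_nonneg_left (norm_listDeriv_mollify_le hδ hFc hMF [j, j] x)
        (sq_nonneg h)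
      refine h1.trans ?_
      rw [List.length_cons, List.length_singleton, mul_left_comm, ← mul_pow, hs]
      refine mul_le_mul_of_nonneg_right ?_ (sq_nonneg _)
      have h2 := hC₂ j
      simp only [I] at h2 ⊢
      linarith)
    (fun j x => (hMj j x).trans (by linarith))
    (fun j x => by
      have h1 := norm_listDeriv_mollify_le hδ (hBj j) (hMj j) [] x
      simp only [List.length_nil, pow_zero, mul_one] at h1
      exact h1.trans (by linarith))
    (fun j x => by
      rw [norm_mul, hnorm, partialDeriv_eq_listDeriv]
      have h1 := mul_le_mul_of_nonneg_left (norm_listDeriv_mollify_le hδ (hBj j) (hMj j) [j] x)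
        hh.le
      refine h1.trans ?_
      rw [List.length_singleton, pow_one, mul_left_comm, hs]
      refine mul_le_mul_of_nonneg_right ?_ hs0
      have h2 := hC₁ j
      have h3 := mul_nonneg hMF0 (hI [j])
      simp only [I] at h2 h3 ⊢
      linarith)
    (fun j x => (heh j x).trans (Finset.single_le_sum (f := fun j => e j h)
      (fun i _ => he0 i h) (Finset.mem_univ j)))
    (by
      filter_upwards [hv] with x hx
      exact hx.trans (by linarith))
    (fun x => by
      have h1 := congrFun (dirDeriv_mollify_invN hframe hfc hfs hδ) x
      exact h1.trans (mollify_const_mul_sum (h ^ σ) (-Complex.I) (fun j => ζ₀ j) hBj x))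
  refine ⟨r, Gr, hr1, hr2, hr3.trans (le_of_eq ?_)⟩
  -- The factor `h` extracted here cancels the `1/h` of the solvability estimate.
  have hs2 : (h ^ (1 - σ)) ^ 2 = h * h ^ (1 - 2 * σ) := by
    rw [← Real.rpow_natCast, ← Real.rpow_mul hh.le, show (1 - σ) * ((2 : ℕ) : ℝ) = 1 + (1 - 2 * σ) by
      push_cast
      ring, Real.rpow_add hh, Real.rpow_one]
  rw [hs2]
  simp only [D]
  field_simp

end CGO

end

theorem proposition2p5 (n : ℕ) (hn : 3 ≤ n)
    (Ω : Set (CGO.RSpace n)) (hΩ : IsOpen Ω) (hΩb : Bornology.IsBounded Ω)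
    (A : CGO.RSpace n → CGO.CSpace n) (hA : ContinuousOn A (closure Ω))
    (q : CGO.RSpace n → ℂ) (hq : MemLp q ∞ (volume.restrict Ω)) :
    -- `A` has extensions in `C₀(ℝⁿ, ℂⁿ)`, and the result holds for each of them, and each `σ`
    (∃ B, CGO.IsC0Extension Ω A B) ∧
    ∀ B, CGO.IsC0Extension Ω A B → ∀ σ : ℝ, 0 < σ → σ < 1 / 2 →
      -- the phases `Φ♯(x, ζ₀; h)`, as a function of `ζ₀`, `h`, `x`
      ∃ Φs : CGO.CSpace n → ℝ → CGO.RSpace n → ℂ,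
        ∀ (ζ₀ : CGO.CSpace n) (ζ₁ : ℝ → CGO.CSpace n),
          ‖CGO.reVec ζ₀‖ = 1 → ‖CGO.imVec ζ₀‖ = 1 →
          (∀ᶠ h in 𝓝[>] (0 : ℝ), CGO.cdot (ζ₀ + ζ₁ h) (ζ₀ + ζ₁ h) = 0) →
          (ζ₁ =O[𝓝[>] (0 : ℝ)] fun h : ℝ => h) →
          ∃ h₀ > (0 : ℝ), ∃ (r : ℝ → CGO.RSpace n → ℂ) (Gr : ℝ → CGO.RSpace n → CGO.CSpace n),
            -- `u = e^{x·ζ/h} (e^{Φ♯} + r)` lies in `H¹(Ω)` and solves the equation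
            (∀ h ∈ Set.Ioo 0 h₀, CGO.IsSolution Ω A q fun x =>
              Complex.exp (CGO.cdot (CGO.toC x) (ζ₀ + ζ₁ h) / (h : ℂ))
                * (Complex.exp (Φs ζ₀ h x) + r h x)) ∧
            -- smoothness, derivative bounds and uniform limit of `Φ♯`
            (∀ h ∈ Set.Ioo 0 h₀, ContDiff ℝ ∞ (Φs ζ₀ h)) ∧
            (∀ α : Fin n → ℕ, ∃ C : ℝ, ∀ h ∈ Set.Ioo 0 h₀, ∀ x,
              ‖CGO.multiDeriv α (Φs ζ₀ h) x‖ ≤ C * h ^ (-(σ * ((∑ j, α j : ℕ) : ℝ)))) ∧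
            (∀ x, Integrable (CGO.invNKernel ζ₀ (fun z => -Complex.I * CGO.cdot ζ₀ (B z)) x)) ∧
            Continuous (CGO.invN ζ₀ fun z => -Complex.I * CGO.cdot ζ₀ (B z)) ∧
            TendstoUniformly (Φs ζ₀)
              (CGO.invN ζ₀ fun z => -Complex.I * CGO.cdot ζ₀ (B z)) (𝓝[>] (0 : ℝ)) ∧
            -- the remainder lies in `H¹(Ω)` and is `o(1)` in the semiclassical norm
            (∀ h ∈ Set.Ioo 0 h₀, CGO.IsH1With Ω (r h) (Gr h)) ∧
            Tendsto (fun h => CGO.sclH1Norm Ω h (r h) (Gr h)) (𝓝[>] (0 : ℝ)) (𝓝 0) := by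
  refine ⟨CGO.exists_isC0Extension hΩb hA, fun B hB σ hσ hσ2 => ⟨CGO.smoothPhase B σ,
    fun ζ₀ ζ₁ hre him hζζ hζ₁ => ?_⟩⟩
  have hζ₁0 : Tendsto ζ₁ (𝓝[>] (0 : ℝ)) (𝓝 0) :=
    hζ₁.trans_tendsto (tendsto_id.mono_left nhdsWithin_le_nhds)
  have hframe := CGO.isUnitFrame_of_eventually hre him hζζ hζ₁0
  have hfc : Continuous fun z => -Complex.I * CGO.cdot ζ₀ (B z) :=
    continuous_const.mul (CGO.continuous_cdot continuous_const hB.continuous)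
  have hfs : HasCompactSupport fun z => -Complex.I * CGO.cdot ζ₀ (B z) :=
    hB.hasCompactSupport.comp_left (g := fun z => -Complex.I * CGO.cdot ζ₀ z) (by simp [CGO.cdot])
  have hFu := CGO.uniformContinuous_invN hframe hfc hfs
  obtain ⟨M, hM⟩ := CGO.exists_norm_invN_le_of_hasCompactSupport hframe hfc hfs
  obtain ⟨w, hw, hsol⟩ := CGO.exists_eventually_solution hΩ hΩb hq hB hσ hσ2 hre him hζζ hζ₁
  obtain ⟨h₀, hh₀, hsub⟩ := mem_nhdsGT_iff_exists_Ioo_subset.mp hsol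
  -- Outside `(0, h₀)` the remainder is given the value zero, only to have functions of all `h` from
  -- which to choose.
  have hall : ∀ h : ℝ, ∃ (r : CGO.RSpace n → ℂ) (Gr : CGO.RSpace n → CGO.CSpace n),
      h ∈ Set.Ioo 0 h₀ → CGO.IsSolution Ω A q (fun x =>
        Complex.exp (CGO.cdot (CGO.toC x) (ζ₀ + ζ₁ h) / (h : ℂ))
          * (Complex.exp (CGO.smoothPhase B σ ζ₀ h x) + r x)) ∧ CGO.IsH1With Ω r Gr ∧
        CGO.sclH1Norm Ω h r Gr ≤ w h := by
    intro h
    by_cases hh : h ∈ Set.Ioo 0 h₀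
    · obtain ⟨r, Gr, H⟩ := hsub hh
      exact ⟨r, Gr, fun _ => H⟩
    · exact ⟨0, 0, fun hh' => absurd hh' hh⟩
  choose r Gr H using hall
  -- The derivative bounds on the phase come from `norm_listDeriv_mollify_le`, valid at every
  -- positive scale, so `h₀` is independent of the multi-index.
  refine ⟨h₀, hh₀, r, Gr, fun h hh => (H h hh).1,
    fun h _ => CGO.contDiff_mollify _ hFu.continuous, fun α => ?_,
    CGO.integrable_invNKernel hframe hfc hfs, hFu.continuous, fun u hu =>
      (CGO.tendsto_rpow_nhdsGT_zero hσ).eventually (CGO.tendstoUniformly_mollify hFu u hu),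
    fun h hh => (H h hh).2.1, ?_⟩
  · obtain ⟨l, hl, hα⟩ := CGO.multiDeriv_eq_listDeriv α
    refine ⟨M * ∫ t, ‖CGO.listDeriv l (CGO.bump n) t‖, fun h hh x => ?_⟩
    rw [hα]
    refine (CGO.norm_listDeriv_mollify_le (Real.rpow_pos_of_pos hh.1 σ) hFu.continuous hM l
      x).trans (le_of_eq ?_)
    rw [hl, Real.rpow_neg hh.1.le, Real.rpow_mul hh.1.le, Real.rpow_natCast, inv_pow]
  · refine squeeze_zero' (.of_forall fun h => Real.sqrt_nonneg _) ?_ hw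
    filter_upwards [Ioo_mem_nhdsGT hh₀] with h hh
    exact (H h hh).2.2
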